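/- **Theorem 1.1.** Let $N\ge 1$ and $k\ge 2$ be integers and let $\chi$ be a Dirichlet character modulo $N$ with $\chi(-1)=(-1)^k$; if $k=2$, assume that $\chi\neq\mathbf 1_N$, the principal character modulo $N$. Write $q=e^{2\pi i z}$, $z=x+iy\in\mathbb H$. *Coefficients.* Let $\chi^0$ be the primitive character inducing $\chi$, $m_\chi$ its modulus, $\ell_\chi=N/m_\chi$, $\tau(\overline{\chi}^0)=\sum_{m \bmod m_\chi}\overline{\chi}^0(m)e^{2\pi i m/m_\chi}$, let $L(s,\cdot)$ be the (analytically continued) Dirichlet $L$-function modulo $N$, and put $$\sigma_{k-1}^{\chi}(n)=\sum_{0<c\mid n}c^{k-1}\sum_{0<d\mid \gcd(\ell_\chi,c)}d\,\mu\!\left(\frac{\ell_\chi}{d}\right)\overline{\chi^0}\!\left(\frac{\ell_\chi}{d}\right)\chi^0\!\left(\frac cd\right),\qquad \widehat\sigma_{1-k}^{\chi}(n)=\sum_{\substack{0<c\mid n\\ \gcd(c,N)=1}}\chi(c)c^{1-k}.$$ For $n\ge 1$ let $$a_{2-k}^+(n,\chi)=\frac{(-2i)^{2-k}\pi\, n^{1-k}}{N^k(k-1)\,L(k,\overline\chi)}\,\tau(\overline\chi^0)\,\sigma_{k-1}^{\chi}(n),\qquad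 b_{2-k}^+(n,\chi)=\frac{(-2i)^{2-k}\pi}{N^{k/2}(k-1)\,L(k,\chi)}\,\widehat\sigma_{1-k}^{\chi}(n),$$ and let $$a_{2-k}^+(0,\chi)=\frac{(-2i)^{2-k}\pi}{N^{k-1}(k-1)L(k,\overline\chi)}\cdot\begin{cases}\zeta(k-1)\prod_{p\mid N}(1-p^{-1})&\text{if }\chi=\mathbf 1_N,\\ 0&\text{if }\chi\ne\mathbf 1_N,\end{cases}\qquad b_{2-k}^+(0,\chi)=\frac{(-2i)^{2-k}\pi}{N^{k/2}(k-1)}\cdot\frac{L(k-1,\chi)}{L(k,\chi)}.$$ *Eisenstein series.* For a character $\psi$ modulo $N$ with $\psi(-1)=(-1)^k$ and $k\ge 3$ let $$E_k(\Gamma_0(N),\psi,z)=\frac12\sum_{\substack{(c,d)\in\mathbb Z^2,\ \gcd(c,d)=1\\ N\mid c}}\overline\psi(d)(cz+d)^{-k},\qquad F_k(\Gamma_0(N),\psi,z)=\frac12\sum_{\substack{(a,b)\in\mathbb Z^2,\ \gcd(a,b)=1\\ \gcd(a,N)=1}}\psi(a)\bigl(\sqrt N(az+b)\bigr)^{-k}.$$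 These are the series $\sum_{\gamma\in\Gamma_{\mathfrak a}\backslash\Gamma_0(N)}\overline{\psi}(\gamma)j(\sigma_{\mathfrak a}^{-1}\gamma,z)^{-k}$ of the cusps $\mathfrak a=\infty$ and $\mathfrak a=0$, with $\psi(\gamma)=\psi(d)$ for $\gamma=\left(\begin{smallmatrix}a&b\\c&d\end{smallmatrix}\right)$, $j(\gamma,z)=cz+d$, $\sigma_\infty=I$ and $\sigma_0=\left(\begin{smallmatrix}0&1/\sqrt N\\-\sqrt N&0\end{smallmatrix}\right)$. For $k=2$ and $\psi\neq\mathbf 1_N$ they are defined by their Fourier expansions $$E_2=1+\sum_{n\ge1}\Bigl(\tfrac{2\pi}{i}\Bigr)^2 n\Bigl(\sum_{c>0,\,N\mid c}c^{-2}\!\!\sum_{\substack{d\bmod c\\(d,c)=1}}\!\overline\psi(d)e^{2\pi i nd/c}\Bigr)q^n,\qquad F_2=\sum_{n\ge1}\Bigl(\tfrac{2\pi}{i}\Bigr)^2 n\Bigl(\sum_{\substack{l>0\\(l,N)=1}}(\sqrt N\,l)^{-2}\psi(l)\!\!\sum_{\substack{d\bmod l\\(d,l)=1}}\!e^{2\pi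 i nd/l}\Bigr)q^n .$$ *Mock modular forms.* For an integer $\kappa\le 0$, a harmonic Maass form of weight $\kappa$ for $\Gamma_0(N)$ with nebentypus $\chi$ is a (real) smooth function $f:\mathbb H\to\mathbb C$ such that $(cz+d)^{-\kappa}f(\gamma z)=\chi(d)f(z)$ for all $\gamma=\left(\begin{smallmatrix}a&b\\c&d\end{smallmatrix}\right)\in\Gamma_0(N)$, such that $\Delta_\kappa f=0$ for $\Delta_\kappa=-y^2(\partial_x^2+\partial_y^2)+i\kappa y(\partial_x+i\partial_y)$, and such that for every $\left(\begin{smallmatrix}a&b\\c&d\end{smallmatrix}\right)\in \mathrm{SL}_2(\mathbb Z)$ there is an $\varepsilon>0$ with $(cz+d)^{-\kappa}f\!\left(\frac{az+b}{cz+d}\right)=O(e^{\varepsilon y})$ as $y\to\infty$, uniformly in $x$ (manageable growth). It has a unique expansion $f=f^++f^-$ with holomorphic part $f^+=\sum_{n\gg-\infty}c^+(n)q^n$ and nonholomorphic part $$f^-=c^-(0)y^{1-\kappa}+\sum_{n\ll\infty,\,n\ne0}c^-(n)\Gamma(1-\kappa,-4\pi ny)q^n,\qquad \Gamma(s,x)=\int_x^\infty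 e^{-t}t^{s-1}\,dt .$$ A mock modular form of weight $\kappa$ for $\Gamma_0(N)$ with nebentypus $\chi$ is the holomorphic part $f^+$ of such an $f$ with $f^-\ne0$, and its shadow is $\xi_\kappa f=2iy^\kappa\,\overline{\partial f/\partial\bar z}$. *Conclusion.* The series $$\sum_{n=0}^\infty a_{2-k}^+(n,\chi)q^n\qquad\text{and}\qquad\sum_{n=0}^\infty b_{2-k}^+(n,\chi)q^n$$ converge absolutely on $\mathbb H$ and are mock modular forms of weight $2-k$ for $\Gamma_0(N)$ with nebentypus $\chi$, with shadows $E_k(\Gamma_0(N),\overline\chi,z)$ and $F_k(\Gamma_0(N),\overline\chi,z)$ respectively. -/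

import Mathlib

namespace MockEisenstein

open Complex Filter Asymptotics
open scoped UpperHalfPlane ModularForm MatrixGroups ContDiff ComplexConjugate

noncomputable section

/-! ### Harmonic Maass forms of integral weight -/

/-- `q ^ n = exp (2 π i n z)`. -/
def qPow (n : ℤ) (z : ℍ) : ℂ := exp (2 * Real.pi * I * n * z)

/-- The partial derivative `∂F/∂x` of a function of `z = x + i y` (in the real sense). -/
def partialX (F : ℂ → ℂ) (z : ℂ) : ℂ := fderiv ℝ F z 1

/-- The partial derivative `∂F/∂y` of a function of `z = x + i y` (in the real sense). -/
def partialY (F : ℂ → ℂ) (z : ℂ) : ℂ := fderiv ℝ F z I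

/-- A function on `ℍ`, viewed as a function on the open set `{y > 0}` of `ℂ`; its values outside
that set are irrelevant. -/
def extend (f : ℍ → ℂ) : ℂ → ℂ := f ∘ UpperHalfPlane.ofComplex

/-- The weight-`κ` hyperbolic Laplacian
`Δ_κ = -y² (∂²/∂x² + ∂²/∂y²) + i κ y (∂/∂x + i ∂/∂y)`. -/
def laplacian (κ : ℤ) (f : ℍ → ℂ) (z : ℍ) : ℂ :=
  -(z.im : ℂ) ^ 2 * (partialX (partialX (extend f)) z + partialY (partialY (extend f)) z)
    + I * κ * z.im * (partialX (extend f) z + I * partialY (extend f) z)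

/-- The shadow operator `ξ_κ f = 2 i y^κ · conj (∂f/∂z̄)`, with `∂/∂z̄ = (∂/∂x + i ∂/∂y) / 2`. -/
def shadow (κ : ℤ) (f : ℍ → ℂ) (z : ℍ) : ℂ :=
  2 * I * (z.im : ℂ) ^ κ * conj ((partialX (extend f) z + I * partialY (extend f) z) / 2)

/-- Harmonic (weak) Maass forms of weight `κ` and manageable growth, for `Γ₀(N)` with nebentypus
`χ`: smooth in the real sense, `(cz+d)^(-κ) f(γz) = χ(d) f(z)` for `γ = (a b; c d)` in `Γ₀(N)`,
annihilated by `Δ_κ`, and `O(e^{ε y})` for some `ε > 0` at every cusp. -/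
structure IsHarmonicMaassForm (N : ℕ) (κ : ℤ) (χ : DirichletCharacter ℂ N) (f : ℍ → ℂ) :
    Prop where
  smooth : ContDiffOn ℝ ∞ (extend f) {z : ℂ | 0 < z.im}
  modular : ∀ γ ∈ CongruenceSubgroup.Gamma0 N, ∀ z : ℍ,
    (f ∣[κ] γ) z = χ ((γ 1 1 : ℤ) : ZMod N) * f z
  harmonic : ∀ z : ℍ, laplacian κ f z = 0
  growth : ∀ γ : SL(2, ℤ), ∃ ε : ℝ, 0 < ε ∧
    (f ∣[κ] γ) =O[UpperHalfPlane.atImInfty] fun z : ℍ => Real.exp (ε * z.im)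

/-- The incomplete Gamma function `Γ(s, x) = ∫_x^∞ e^{-t} t^{s-1} dt` for integral `s`; for `s ≥ 1`
the integral converges for every real `x`. -/
def incGamma (s : ℤ) (x : ℝ) : ℝ := ∫ t in Set.Ioi x, Real.exp (-t) * t ^ (s - 1)

/-- The `n`-th term of the nonholomorphic part of a harmonic Maass form of weight `κ`: it is
`c(0) y^{1-κ}` for `n = 0`, and `c(n) Γ(1-κ, -4πny) q^n` otherwise. -/
def nonholTerm (κ : ℤ) (c : ℤ → ℂ) (n : ℤ) (z : ℍ) : ℂ :=
  if n = 0 then c 0 * (z.im : ℂ) ^ (1 - κ)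
  else c n * (incGamma (1 - κ) (-4 * Real.pi * n * z.im) : ℂ) * qPow n z

/-- `f` has the Fourier expansion
`∑_{n ≫ -∞} c⁺(n) q^n + c⁻(0) y^{1-κ} + ∑_{n ≪ ∞, n ≠ 0} c⁻(n) Γ(1-κ, -4πny) q^n`.
It is used for weights `κ ≤ 0`, where the coefficients are determined by `f`. -/
structure HasMaassExpansion (κ : ℤ) (f : ℍ → ℂ) (cplus cminus : ℤ → ℂ) : Prop where
  plus_bdd : ∃ n₀ : ℤ, ∀ n < n₀, cplus n = 0
  minus_bdd : ∃ n₁ : ℤ, ∀ n > n₁, cminus n = 0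
  plus_summable : ∀ z : ℍ, Summable fun n : ℤ => cplus n * qPow n z
  minus_summable : ∀ z : ℍ, Summable fun n : ℤ => nonholTerm κ cminus n z
  eq : ∀ z : ℍ, f z = (∑' n : ℤ, cplus n * qPow n z) + ∑' n : ℤ, nonholTerm κ cminus n z

/-- `g` is a mock modular form of weight `κ` for `Γ₀(N)` with nebentypus `χ` and with shadow `h`:
it is the holomorphic part of a harmonic Maass form `f` whose nonholomorphic part is not zero,
and `ξ_κ f = h`. -/
def IsMockModularFormWithShadow (N : ℕ) (κ : ℤ) (χ : DirichletCharacter ℂ N) (g h : ℍ → ℂ) :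
    Prop :=
  ∃ (f : ℍ → ℂ) (cplus cminus : ℤ → ℂ),
    IsHarmonicMaassForm N κ χ f ∧ HasMaassExpansion κ f cplus cminus ∧
    (∀ z : ℍ, g z = ∑' n : ℤ, cplus n * qPow n z) ∧
    (∃ z : ℍ, (∑' n : ℤ, nonholTerm κ cminus n z) ≠ 0) ∧
    ∀ z : ℍ, shadow κ f z = h z

/-! ### Holomorphic Eisenstein series for `Γ₀(N)` at the cusps `∞` and `0`

For a character `ψ` mod `N`, the inverse `ψ⁻¹` is the complex conjugate character. The nebentypus
is `γ = (a b; c d) ↦ ψ(d)`, and `conj ψ(d) = ψ(a)` for `γ` in `Γ₀(N)`. -/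

/-- The coefficient `η(n)`, `n ≥ 1`, of the Eisenstein series of weight `k` at `∞`:
`(2π/i)^k n^{k-1} / Γ(k) · ∑_{c > 0, N ∣ c} c^{-k} ∑_{d mod c, (d,c) = 1} conj ψ(d) e(nd/c)`. -/
def etaInfty (N k : ℕ) (ψ : DirichletCharacter ℂ N) (n : ℕ) : ℂ :=
  (2 * Real.pi / I) ^ k * (n : ℂ) ^ (k - 1) / (Nat.factorial (k - 1) : ℂ) *
    ∑' c : ℕ, if 0 < c ∧ N ∣ c then
      ((c : ℂ) ^ k)⁻¹ * ∑ d ∈ (Finset.range c).filter (fun d => Nat.Coprime d c),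
        ψ⁻¹ (d : ZMod N) * exp (2 * Real.pi * I * n * d / c)
    else 0

/-- The coefficient `η(n)`, `n ≥ 1`, of the Eisenstein series of weight `k` at `0`:
`(2π/i)^k n^{k-1} / Γ(k) · ∑_{l > 0, (l,N) = 1} (√N l)^{-k} ψ(l) ∑_{d mod l, (d,l) = 1} e(nd/l)`. -/
def etaZero (N k : ℕ) (ψ : DirichletCharacter ℂ N) (n : ℕ) : ℂ :=
  (2 * Real.pi / I) ^ k * (n : ℂ) ^ (k - 1) / (Nat.factorial (k - 1) : ℂ) *
    ∑' l : ℕ, if 0 < l ∧ Nat.Coprime l N then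
      (((Real.sqrt N : ℂ) * l) ^ k)⁻¹ * ψ (l : ZMod N) *
        ∑ d ∈ (Finset.range l).filter (fun d => Nat.Coprime d l),
          exp (2 * Real.pi * I * n * d / l)
    else 0

/-- The Eisenstein series `E_k(Γ₀(N), ψ, z)` of the cusp `∞`. For `k ≠ 2` it is
`∑_{γ ∈ Γ_∞ \ Γ₀(N)} conj ψ(γ) j(γ,z)^{-k}`: a coset is determined by the bottom row `(c, d)` of
`γ` up to sign, and these rows are the coprime pairs with `N ∣ c`; the factor `1/2` accounts for
the sign. In weight `2`, where this series does not converge absolutely, it is given by its Fourier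
expansion. -/
def eisensteinInfty (N k : ℕ) (ψ : DirichletCharacter ℂ N) (z : ℍ) : ℂ :=
  if k = 2 then 1 + ∑' n : ℕ, if 0 < n then etaInfty N 2 ψ n * qPow n z else 0
  else (1 / 2) * ∑' p : ℤ × ℤ, if Int.gcd p.1 p.2 = 1 ∧ (N : ℤ) ∣ p.1 then
      ψ⁻¹ (p.2 : ZMod N) * (((p.1 : ℂ) * z + p.2) ^ k)⁻¹
    else 0

/-- The Eisenstein series `F_k(Γ₀(N), ψ, z)` of the cusp `0`. For `k ≠ 2` it is
`∑_{γ ∈ Γ_0 \ Γ₀(N)} conj ψ(γ) j(σ⁻¹γ,z)^{-k}` with the stabilizer `Γ_0` of the cusp `0` and the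
scaling matrix `σ = (0 1/√N; -√N 0)`: for `γ` with top row `(a, b)` one has
`j(σ⁻¹γ,z) = √N (az+b)` and `conj ψ(γ) = ψ(a)`, a coset is determined by `(a, b)` up to sign, and
these rows are the coprime pairs with `a` prime to `N`. In weight `2` it is given by its Fourier
expansion, whose constant term is `0` unless the cusps `0` and `∞` are equivalent. -/
def eisensteinZero (N k : ℕ) (ψ : DirichletCharacter ℂ N) (z : ℍ) : ℂ :=
  if k = 2 then (if N = 1 then 1 else 0) +
    ∑' n : ℕ, if 0 < n then etaZero N 2 ψ n * qPow n z else 0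
  else (1 / 2) * ∑' p : ℤ × ℤ, if Int.gcd p.1 p.2 = 1 ∧ Int.gcd p.1 N = 1 then
      ψ (p.1 : ZMod N) * (((Real.sqrt N : ℂ) * ((p.1 : ℂ) * z + p.2)) ^ k)⁻¹
    else 0

/-! ### The explicit coefficients -/

/-- The Gauss sum `τ(χ⁰)` of the primitive character `χ⁰`, of modulus `m_χ`, inducing `χ`. -/
def gaussSumPrim {N : ℕ} (χ : DirichletCharacter ℂ N) : ℂ :=
  ∑ m ∈ Finset.range χ.conductor,
    χ.primitiveCharacter (m : ZMod χ.conductor) * exp (2 * Real.pi * I * m / χ.conductor)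

/-- The twisted divisor function, with `l = N / m_χ`:
`σ(n) = ∑_{c ∣ n} c^{k-1} ∑_{d ∣ gcd(l, c)} d μ(l/d) conj χ⁰(l/d) χ⁰(c/d)`. -/
def twistedSigma (N k : ℕ) (χ : DirichletCharacter ℂ N) (n : ℕ) : ℂ :=
  ∑ c ∈ n.divisors, (c : ℂ) ^ (k - 1) *
    ∑ d ∈ (Nat.gcd (N / χ.conductor) c).divisors,
      (d : ℂ) * (ArithmeticFunction.moebius (N / χ.conductor / d) : ℂ) *
        conj (χ.primitiveCharacter ((N / χ.conductor / d : ℕ) : ZMod χ.conductor)) *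
        χ.primitiveCharacter ((c / d : ℕ) : ZMod χ.conductor)

/-- The divisor function `∑_{c ∣ n, (c,N) = 1} χ(c) c^{1-k}`. -/
def hatSigma (N k : ℕ) (χ : DirichletCharacter ℂ N) (n : ℕ) : ℂ :=
  ∑ c ∈ n.divisors.filter (fun c => Nat.Coprime c N),
    χ (c : ZMod N) * (c : ℂ) ^ (1 - (k : ℤ))

open Classical in
/-- The coefficients of the first series, with shadow at the cusp `∞`. Here `χ⁻¹` is the complex
conjugate of `χ`, and `1` is the principal character mod `N`. -/
def aCoeff (N k : ℕ) [NeZero N] (χ : DirichletCharacter ℂ N) (n : ℕ) : ℂ :=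
  if n = 0 then
    (-2 * I) ^ (2 - (k : ℤ)) * Real.pi /
        ((N : ℂ) ^ (k - 1) * ((k : ℂ) - 1) * DirichletCharacter.LFunction χ⁻¹ k) *
      (if χ = 1 then riemannZeta ((k : ℂ) - 1) * ∏ p ∈ N.primeFactors, (1 - (p : ℂ)⁻¹) else 0)
  else
    (-2 * I) ^ (2 - (k : ℤ)) * Real.pi * (n : ℂ) ^ (1 - (k : ℤ)) /
        ((N : ℂ) ^ k * ((k : ℂ) - 1) * DirichletCharacter.LFunction χ⁻¹ k) *
      gaussSumPrim χ⁻¹ * twistedSigma N k χ n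

/-- The coefficients of the second series, with shadow at the cusp `0`; `N^{k/2} = (√N)^k`. -/
def bCoeff (N k : ℕ) [NeZero N] (χ : DirichletCharacter ℂ N) (n : ℕ) : ℂ :=
  (-2 * I) ^ (2 - (k : ℤ)) * Real.pi /
      ((Real.sqrt N : ℂ) ^ k * ((k : ℂ) - 1) * DirichletCharacter.LFunction χ k) *
    (if n = 0 then DirichletCharacter.LFunction χ ((k : ℂ) - 1) else hatSigma N k χ n)

end

end MockEisenstein

namespace MockEisenstein

open Complex Filter Asymptotics
open scoped UpperHalfPlane ModularForm MatrixGroups ContDiff ComplexConjugate Topology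

noncomputable section

/-! Put m = k - 1, so that the weight 2 - k is 1 - m. For a function φ on pairs of residues modulo N
with φ(-p) = (-1)^(m+1) φ(p), consider the nonholomorphic Eisenstein series y^m ∑ φ(c,d) (cz+d)⁻¹
conj(cz+d)^(-m) over all integer pairs (c,d). It has weight 1 - m, and SL₂(ℤ) acts on it only by
permuting the rows, that is, through φ (`eisFourier_slash`). Both mock modular forms come from this
one construction: φ(c,d) = 1_{c = 0} conj χ(d) gives the cusp ∞ and φ(c,d) = χ(c) gives the cusp 0,
and on each of these Γ₀(N) acts through the character χ.

The Fourier expansion is found row by row. The sum of w⁻¹ conj(w)^(-m) over a translate w + ℤ is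
computed by induction on m (`tsum_kern`): the case m = 1 is the partial fraction expansion of the
cotangent, and partial fractions in w and conj w reduce the step to Lipschitz's formula. The result
is A y^m + ∑ a(n) q^n + ∑ b(n) R_m(4πny) conj(q^n), where R_m is the truncated exponential series;
as (m-1)! e^(-x) R_m(x) = Γ(m,x), this is the expansion of a harmonic Maass form. For m ≥ 2
everything converges absolutely (`tsum_lattice_kern`). For m = 1 Hecke's factor |cz+d|^(-2s) is
inserted and s tends to 0 from above (`tendsto_lattice_hecke`); there the only possible obstruction
is the pole at 1 of an L-function, which is absent because χ is not principal.

Analytically, (∂/∂x + i∂/∂y) sends such an expansion to y^(m-1) conj(g) with g holomorphic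
(`hasDbarAt_maassFn`). This gives harmonicity at once and shows that the shadow is i g, a
holomorphic Eisenstein series of weight k attached to conj φ (`shadow_eq_holoEis`). Growth at every
cusp follows from the expansion of the series attached to the translated φ.

It remains to identify constants. The sum over all pairs is L(k) times the sum over coprime pairs
(`IsHomogeneousBy.tsum_coprime`). In weight 2 the same division by an L-value is performed on the
Fourier coefficients by Dirichlet inversion (`tsum_primSum`). At ∞ the coefficients are Gauss sums
of imprimitive characters, evaluated in `charSum_eq`; at 0 they are plain divisor sums. -/

/-! ### Power series in q with polynomially bounded coefficients -/

/-- Sequences bounded by a polynomial. -/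
def PolyGrowth (a : ℕ → ℂ) : Prop := ∃ (C : ℝ) (K : ℕ), ∀ n, ‖a n‖ ≤ C * ((n : ℝ) + 1) ^ K

lemma PolyGrowth.of_le {a b : ℕ → ℂ} (h : PolyGrowth b) (hab : ∀ n, ‖a n‖ ≤ ‖b n‖) :
    PolyGrowth a := by
  obtain ⟨C, K, h⟩ := h
  exact ⟨C, K, fun n => (hab n).trans (h n)⟩

lemma PolyGrowth.const_mul {a : ℕ → ℂ} (h : PolyGrowth a) (c : ℂ) :
    PolyGrowth (fun n => c * a n) := by
  obtain ⟨C, K, h⟩ := h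
  refine ⟨‖c‖ * C, K, fun n => ?_⟩
  rw [norm_mul, mul_assoc]
  gcongr
  exact h n

lemma PolyGrowth.conj {a : ℕ → ℂ} (h : PolyGrowth a) :
    PolyGrowth (fun n => conj (a n)) :=
  h.of_le fun n => by simp

lemma PolyGrowth.pow_mul {a : ℕ → ℂ} (h : PolyGrowth a) (j : ℕ) :
    PolyGrowth (fun n => (n : ℂ) ^ j * a n) := by
  obtain ⟨C, K, h⟩ := h
  refine ⟨C, j + K, fun n => ?_⟩
  have h1 : ((n : ℝ)) ^ j ≤ ((n : ℝ) + 1) ^ j := by gcongr; linarith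
  calc ‖(n : ℂ) ^ j * a n‖ = (n : ℝ) ^ j * ‖a n‖ := by simp
    _ ≤ ((n : ℝ) + 1) ^ j * (C * ((n : ℝ) + 1) ^ K) :=
        mul_le_mul h1 (h n) (norm_nonneg _) (by positivity)
    _ = C * ((n : ℝ) + 1) ^ (j + K) := by ring

lemma PolyGrowth.shift {a : ℕ → ℂ} (h : PolyGrowth a) :
    PolyGrowth (fun n => a (n + 1)) := by
  obtain ⟨C, K, h⟩ := h
  have hC : 0 ≤ C := by
    have := (norm_nonneg _).trans (h 0)
    simpa using this
  refine ⟨C * 2 ^ K, K, fun n => (h _).trans ?_⟩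
  rw [mul_assoc, ← mul_pow]
  gcongr
  push_cast
  linarith [(Nat.cast_nonneg n : (0 : ℝ) ≤ n)]

lemma PolyGrowth.summable_geometric {a : ℕ → ℂ} (h : PolyGrowth a) {r : ℝ} (h0 : 0 ≤ r)
    (h1 : r < 1) : Summable fun n => ‖a n‖ * r ^ n := by
  obtain ⟨C, K, h⟩ := h
  have hs : Summable fun n : ℕ => ((n : ℝ) + 1) ^ K * r ^ n := by
    have : Summable fun n : ℕ => ‖(((n : ℝ) + 1) ^ K) * r ^ n‖ := by
      refine summable_norm_mul_geometric_of_norm_lt_one' (k := K) ?_ ?_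
      · rwa [Real.norm_of_nonneg h0]
      · refine Asymptotics.IsBigO.of_bound (2 ^ K) ?_
        filter_upwards [eventually_ge_atTop 1] with n hn
        have hn' : (1 : ℝ) ≤ n := by exact_mod_cast hn
        rw [Real.norm_of_nonneg (by positivity)]
        push_cast
        rw [Real.norm_of_nonneg (by positivity), ← mul_pow]
        gcongr
        linarith
    exact this.of_norm
  refine Summable.of_nonneg_of_le (fun n => by positivity) (fun n => ?_) (hs.mul_left C)
  rw [← mul_assoc]
  gcongr
  exact h n

/-- `e(n z) = exp (2 π i n z)` for complex `z`. -/
def qE (n : ℕ) (z : ℂ) : ℂ := exp (2 * Real.pi * I * n * z)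

lemma qE_zero (z : ℂ) : qE 0 z = 1 := by simp [qE]

lemma qE_succ (n : ℕ) (z : ℂ) : qE (n + 1) z = qE 1 z * qE n z := by
  rw [qE, qE, qE, ← exp_add]; congr 1; push_cast; ring

lemma qE_eq_pow (n : ℕ) (z : ℂ) : qE n z = qE 1 z ^ n := by
  rw [qE, qE, ← exp_nat_mul]; congr 1; push_cast; ring

lemma norm_qE (n : ℕ) (z : ℂ) : ‖qE n z‖ = Real.exp (-2 * Real.pi * z.im) ^ n := by
  rw [qE_eq_pow, norm_pow, qE, norm_exp]
  congr 2
  simp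

lemma exp_lt_one_of_im_pos {y : ℝ} (hy : 0 < y) : Real.exp (-2 * Real.pi * y) < 1 := by
  rw [Real.exp_lt_one_iff]
  have := Real.pi_pos
  nlinarith [mul_pos this hy]

lemma summable_norm_qE {a : ℕ → ℂ} (h : PolyGrowth a) {z : ℂ} (hz : 0 < z.im) :
    Summable fun n => ‖a n * qE n z‖ := by
  simp_rw [norm_mul, norm_qE]
  exact h.summable_geometric (Real.exp_pos _).le (exp_lt_one_of_im_pos hz)

/-- The `q`-series `∑ a(n) q^n`. -/
def qSer (a : ℕ → ℂ) (z : ℂ) : ℂ := ∑' n : ℕ, a n * qE n z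

lemma summable_qE {a : ℕ → ℂ} (h : PolyGrowth a) {z : ℂ} (hz : 0 < z.im) :
    Summable fun n => a n * qE n z := (summable_norm_qE h hz).of_norm

lemma hasDerivAt_qSer {a : ℕ → ℂ} (h : PolyGrowth a) {z : ℂ} (hz : 0 < z.im) :
    HasDerivAt (qSer a) (2 * Real.pi * I * qSer (fun n => (n : ℂ) * a n) z) z := by
  -- On Im w > δ one has |q^n| ≤ e^(-2πδn), so the termwise derivatives have a summable majorant; no
  -- uniform bound holds up to the real axis.
  set δ := z.im / 2 with hδ
  have hδ0 : 0 < δ := by positivity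
  have hδz : δ < z.im := by rw [hδ]; linarith
  have hg : PolyGrowth (fun n => 2 * Real.pi * I * ((n : ℂ) * a n)) := by
    simpa using (h.pow_mul 1).const_mul (2 * Real.pi * I)
  have key := hasDerivAt_tsum_of_isPreconnected (𝕜 := ℂ) (t := {w : ℂ | δ < w.im})
    (g := fun n w => a n * qE n w) (g' := fun n w => 2 * Real.pi * I * ((n : ℂ) * a n) * qE n w)
    (y₀ := z) (y := z)
    (hg.summable_geometric (Real.exp_pos (-2 * Real.pi * δ)).le (exp_lt_one_of_im_pos hδ0))
    (isOpen_lt continuous_const continuous_im)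
    (convex_halfSpace_im_gt δ).isPreconnected ?_ ?_ hδz (summable_qE h hz) hδz
  · refine key.congr_deriv ?_
    rw [qSer, ← tsum_mul_left]
    exact tsum_congr fun n => by ring
  · intro n w _
    have : HasDerivAt (fun w => qE n w) (qE n w * (2 * Real.pi * I * n)) w := by
      unfold qE
      simpa using ((hasDerivAt_id w).const_mul (2 * Real.pi * I * n)).cexp
    exact (this.const_mul (a n)).congr_deriv (by ring)
  · intro n w hw
    rw [norm_mul, norm_qE]
    gcongr ?_ * ?_ ^ n
    apply Real.exp_le_exp.mpr
    have := Real.pi_pos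
    have hw' : δ < w.im := hw
    nlinarith [mul_pos this (sub_pos.mpr hw')]

lemma differentiableOn_qSer {a : ℕ → ℂ} (h : PolyGrowth a) :
    DifferentiableOn ℂ (qSer a) {z : ℂ | 0 < z.im} := fun _ hz =>
  (hasDerivAt_qSer h hz).differentiableAt.differentiableWithinAt

lemma contDiffOn_qSer {a : ℕ → ℂ} (h : PolyGrowth a) :
    ContDiffOn ℝ ∞ (qSer a) {z : ℂ | 0 < z.im} :=
  ((differentiableOn_qSer h).contDiffOn (isOpen_lt continuous_const continuous_im)).restrict_scalars ℝ

lemma exists_bound_qSer {a : ℕ → ℂ} (h : PolyGrowth a) (δ : ℝ) (hδ : 0 < δ) :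
    ∃ M : ℝ, 0 ≤ M ∧ ∀ z : ℂ, δ ≤ z.im → ‖qSer a z‖ ≤ M := by
  have hs := h.summable_geometric (Real.exp_pos (-2 * Real.pi * δ)).le (exp_lt_one_of_im_pos hδ)
  refine ⟨_, tsum_nonneg fun n => by positivity, fun z hz => tsum_of_norm_bounded hs.hasSum fun n => ?_⟩
  rw [norm_mul, norm_qE]
  gcongr ?_ * ?_ ^ n
  apply Real.exp_le_exp.mpr
  nlinarith [Real.pi_pos]

lemma qSer_eq_zero_add {a : ℕ → ℂ} (h : PolyGrowth a) {z : ℂ} (hz : 0 < z.im) :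
    qSer a z = a 0 + qE 1 z * qSer (fun n => a (n + 1)) z := by
  rw [qSer, (summable_qE h hz).tsum_eq_zero_add, qE_zero, mul_one, qSer, ← tsum_mul_left]
  congr 1
  exact tsum_congr fun n => by rw [qE_succ]; ring

/-- Letting y tend to infinity along the imaginary axis isolates a(0). Once a(0) = 0, dividing by q
shifts the sequence, and induction applies. -/
lemma eq_zero_of_qSer_eq_zero {a : ℕ → ℂ} (h : PolyGrowth a)
    (h0 : ∀ z : ℂ, 0 < z.im → qSer a z = 0) (n : ℕ) : a n = 0 := by
  have first : ∀ {a : ℕ → ℂ}, PolyGrowth a → (∀ z : ℂ, 0 < z.im → qSer a z = 0) → a 0 = 0 := by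
    intro a h h0
    obtain ⟨M, hM, hb⟩ := exists_bound_qSer h.shift 1 one_pos
    have hle : ∀ y : ℝ, 1 ≤ y → ‖a 0‖ ≤ Real.exp (-2 * Real.pi * y) * M := by
      intro y hy
      have him : ((y : ℂ) * I).im = y := by simp
      have hy0 : 0 < ((y : ℂ) * I).im := by rw [him]; linarith
      have h1 := qSer_eq_zero_add h hy0
      rw [h0 _ hy0] at h1
      have h2 : a 0 = -(qE 1 (y * I) * qSer (fun n => a (n + 1)) (y * I)) := by
        linear_combination -h1
      rw [h2, norm_neg, norm_mul, norm_qE, him, pow_one]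
      gcongr
      exact hb _ (by rw [him]; exact hy)
    have hlim : Tendsto (fun y : ℝ => Real.exp (-2 * Real.pi * y) * M) atTop (𝓝 0) := by
      have : Tendsto (fun y : ℝ => Real.exp (-2 * Real.pi * y)) atTop (𝓝 0) := by
        refine Real.tendsto_exp_atBot.comp ?_
        refine tendsto_id.const_mul_atTop_of_neg ?_
        nlinarith [Real.pi_pos]
      simpa using this.mul_const M
    have := ge_of_tendsto hlim ((eventually_ge_atTop 1).mono hle)
    exact norm_le_zero_iff.mp this
  induction n generalizing a with
  | zero => exact first h h0
  | succ n ih =>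
    refine ih h.shift fun z hz => ?_
    have h1 := qSer_eq_zero_add h hz
    rw [h0 z hz, first h h0, zero_add] at h1
    exact (mul_eq_zero.mp h1.symm).resolve_left (exp_ne_zero _)

/-! ### Calculus of the operator ∂/∂x + i ∂/∂y -/

/-- `F` is real differentiable at `z` and `(∂/∂x + i ∂/∂y) F = d` there. -/
def HasDbarAt (F : ℂ → ℂ) (d z : ℂ) : Prop :=
  ∃ L : ℂ →L[ℝ] ℂ, HasFDerivAt F L z ∧ L 1 + I * L I = d

lemma HasDbarAt.eq {F : ℂ → ℂ} {d z : ℂ} (h : HasDbarAt F d z) :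
    partialX F z + I * partialY F z = d := by
  obtain ⟨L, hL, h⟩ := h
  rw [partialX, partialY, hL.fderiv, h]

lemma HasDbarAt.add {F G : ℂ → ℂ} {d e z : ℂ} (hF : HasDbarAt F d z) (hG : HasDbarAt G e z) :
    HasDbarAt (fun w => F w + G w) (d + e) z := by
  obtain ⟨L, hL, rfl⟩ := hF
  obtain ⟨M, hM, rfl⟩ := hG
  refine ⟨L + M, hL.add hM, ?_⟩
  simp only [add_apply]
  ring

lemma HasDbarAt.mul {F G : ℂ → ℂ} {d e z : ℂ} (hF : HasDbarAt F d z) (hG : HasDbarAt G e z) :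
    HasDbarAt (fun w => F w * G w) (d * G z + F z * e) z := by
  obtain ⟨L, hL, rfl⟩ := hF
  obtain ⟨M, hM, rfl⟩ := hG
  refine ⟨_, hL.mul hM, ?_⟩
  simp only [add_apply, smul_apply, smul_eq_mul]
  ring

lemma hasDbarAt_const (c z : ℂ) : HasDbarAt (fun _ => c) 0 z :=
  ⟨0, hasFDerivAt_const c z, by simp⟩

lemma HasDbarAt.sum {F : ℕ → ℂ → ℂ} {d : ℕ → ℂ} {z : ℂ} (m : ℕ)
    (h : ∀ j < m, HasDbarAt (F j) (d j) z) :
    HasDbarAt (fun w => ∑ j ∈ Finset.range m, F j w) (∑ j ∈ Finset.range m, d j) z := by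
  induction m with
  | zero => simpa using hasDbarAt_const 0 z
  | succ m ih =>
    simp_rw [Finset.sum_range_succ]
    exact (ih fun j hj => h j (by omega)).add (h m (by omega))

lemma HasDerivAt.hasDbarAt {h : ℂ → ℂ} {h' z : ℂ} (hh : HasDerivAt h h' z) :
    HasDbarAt h 0 z := by
  refine ⟨_, hh.complexToReal_fderiv, ?_⟩
  simp only [smul_apply, one_apply_eq_self, smul_eq_mul]
  linear_combination h' * I_mul_I

/-- The real derivative is conjugate linear here, so the contributions of the directions 1 and i add
up instead of cancelling; hence the factor 2. -/
lemma HasDerivAt.hasDbarAt_conj {h : ℂ → ℂ} {h' z : ℂ} (hh : HasDerivAt h h' z) :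
    HasDbarAt (fun w => conj (h w)) (2 * conj h') z := by
  refine ⟨_, (conjCLE.toContinuousLinearMap.hasFDerivAt).comp z hh.complexToReal_fderiv, ?_⟩
  simp
  linear_combination -(conj h') * I_mul_I

lemma hasDbarAt_im (z : ℂ) : HasDbarAt (fun w => (w.im : ℂ)) I z := by
  refine ⟨_, (ofRealCLM.hasFDerivAt).comp z imCLM.hasFDerivAt, ?_⟩
  simp

lemma hasDbarAt_im_pow (j : ℕ) (z : ℂ) :
    HasDbarAt (fun w => (w.im : ℂ) ^ j) (j * (z.im : ℂ) ^ (j - 1) * I) z := by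
  induction j with
  | zero => simpa using hasDbarAt_const 1 z
  | succ j ih =>
    simp_rw [pow_succ]
    convert ih.mul (hasDbarAt_im z) using 1
    rcases j with _ | j
    · simp
    · simp only [Nat.add_sub_cancel, pow_succ]
      push_cast
      ring

/-! ### Incomplete Gamma function and harmonic expansions -/

/-- The truncated exponential series `∑_{j < m} x^j / j!`. -/
def expTrunc (m : ℕ) (x : ℝ) : ℝ := ∑ j ∈ Finset.range m, x ^ j / j.factorial

/-- Differentiating the truncated exponential removes exactly its top term t^(m-1)/(m-1)!, so
-(m-1)! e^(-t) R_m(t) is an antiderivative of e^(-t) t^(m-1), and it vanishes at infinity. -/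
lemma incGamma_eq {m : ℕ} (hm : 1 ≤ m) {x : ℝ} (hx : 0 < x) :
    incGamma m x = (m - 1).factorial * Real.exp (-x) * expTrunc m x := by
  obtain ⟨m, rfl⟩ : ∃ p, m = p + 1 := ⟨m - 1, by omega⟩
  have hT : ∀ t : ℝ, HasDerivAt (expTrunc (m + 1)) (expTrunc m t) t := by
    intro t
    unfold expTrunc
    have h1 := HasDerivAt.fun_sum (u := Finset.range (m + 1)) (x := t)
      (A := fun j (t : ℝ) => t ^ j / j.factorial)
      (A' := fun j => (j * t ^ (j - 1)) / j.factorial)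
      (fun j _ => (hasDerivAt_pow j t).div_const _)
    refine h1.congr_deriv ?_
    rw [Finset.sum_range_succ']
    simp only [Nat.cast_zero, zero_mul, zero_div, add_zero, Nat.add_sub_cancel]
    refine Finset.sum_congr rfl fun j _ => ?_
    rw [Nat.factorial_succ]
    push_cast
    have : (j.factorial : ℝ) ≠ 0 := by positivity
    field_simp
  have hd : ∀ t ∈ Set.Ici x, HasDerivAt
      (fun t => -((m.factorial : ℝ) * (Real.exp (-t) * expTrunc (m + 1) t)))
      (Real.exp (-t) * t ^ (((m + 1 : ℕ) : ℤ) - 1)) t := by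
    intro t _
    have h1 := ((hasDerivAt_neg t).exp.mul (hT t)).const_mul (-(m.factorial : ℝ))
    refine HasDerivAt.congr_deriv (f' := _) (by simpa [neg_mul] using h1) ?_
    have h2 : expTrunc (m + 1) t = expTrunc m t + t ^ m / m.factorial := by
      rw [expTrunc, Finset.sum_range_succ, expTrunc]
    have h3 : (((m + 1 : ℕ) : ℤ) - 1) = (m : ℤ) := by push_cast; ring
    rw [h2, h3, zpow_natCast]
    have : (m.factorial : ℝ) ≠ 0 := by positivity
    field_simp
    ring
  have hlim : Tendsto (fun t => -((m.factorial : ℝ) * (Real.exp (-t) * expTrunc (m + 1) t)))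
      atTop (𝓝 0) := by
    have h1 : Tendsto (fun t => Real.exp (-t) * expTrunc (m + 1) t) atTop (𝓝 0) := by
      unfold expTrunc
      simp_rw [Finset.mul_sum]
      rw [← Finset.sum_const_zero (s := Finset.range (m + 1))]
      refine tendsto_finsetSum _ fun j _ => ?_
      have := (Real.tendsto_pow_mul_exp_neg_atTop_nhds_zero j).div_const (j.factorial : ℝ)
      rw [zero_div] at this
      exact this.congr fun t => by ring
    simpa using (h1.const_mul (m.factorial : ℝ)).neg
  have key := MeasureTheory.integral_Ioi_of_hasDerivAt_of_nonneg'
    hd (fun t ht => by have : 0 < t := hx.trans ht; positivity) hlim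
  rw [incGamma, key, Nat.add_sub_cancel]
  ring

/-- The function `A y^m + ∑ a(n) q^n + ∑ b(n) R_m(4πny) conj (q^n)`, where
`R_m(x) = ∑_{j < m} x^j / j!`, written as a finite sum of powers of `y` times (anti)holomorphic
functions. -/
def maassFn (m : ℕ) (A : ℂ) (a b : ℕ → ℂ) (z : ℂ) : ℂ :=
  A * (z.im : ℂ) ^ m + qSer a z + ∑ j ∈ Finset.range m,
    ((4 * Real.pi) ^ j / j.factorial * (z.im : ℂ) ^ j) *
      conj (qSer (fun n => (n : ℂ) ^ j * conj (b n)) z)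

/-- The antiholomorphic series occurring in `maassFn`. -/
def conjSer (m : ℕ) (b : ℕ → ℂ) (z : ℂ) : ℂ :=
  ∑' n : ℕ, b n * (expTrunc m (4 * Real.pi * n * z.im) : ℂ) * conj (qE n z)

/-- Expanding R_m(4πny) in powers of y moves each n^j into the coefficients. The series thus becomes
a finite sum of powers of y times antiholomorphic series, a form that can be differentiated without
any interchange of limits. -/
lemma hasSum_conjSer {m : ℕ} {b : ℕ → ℂ} (hb : PolyGrowth b) {z : ℂ} (hz : 0 < z.im) :
    HasSum (fun n : ℕ => b n * (expTrunc m (4 * Real.pi * n * z.im) : ℂ) * conj (qE n z))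
      (∑ j ∈ Finset.range m, ((4 * Real.pi) ^ j / j.factorial * (z.im : ℂ) ^ j) *
        conj (qSer (fun n => (n : ℂ) ^ j * conj (b n)) z)) := by
  have h1 : ∀ j ∈ Finset.range m, HasSum (fun n : ℕ =>
      ((4 * Real.pi) ^ j / j.factorial * (z.im : ℂ) ^ j) *
        conj ((n : ℂ) ^ j * conj (b n) * qE n z))
      (((4 * Real.pi) ^ j / j.factorial * (z.im : ℂ) ^ j) *
        conj (qSer (fun n => (n : ℂ) ^ j * conj (b n)) z)) := by
    intro j _
    refine HasSum.mul_left _ ?_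
    exact hasSum_conj'.mpr (by simpa [qSer] using (summable_qE (hb.conj.pow_mul j) hz).hasSum)
  convert hasSum_sum h1 using 2 with n
  unfold expTrunc
  push_cast
  rw [Finset.mul_sum, Finset.sum_mul]
  refine Finset.sum_congr rfl fun j _ => ?_
  simp only [map_mul, map_pow, conj_natCast, conj_conj]
  ring

lemma maassFn_eq {m : ℕ} (A : ℂ) (a : ℕ → ℂ) {b : ℕ → ℂ} (hb : PolyGrowth b) {z : ℂ}
    (hz : 0 < z.im) : maassFn m A a b z = A * (z.im : ℂ) ^ m + qSer a z + conjSer m b z := by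
  rw [conjSer, (hasSum_conjSer hb hz).tsum_eq, maassFn]

lemma contDiffOn_maassFn {m : ℕ} (A : ℂ) {a b : ℕ → ℂ} (ha : PolyGrowth a) (hb : PolyGrowth b) :
    ContDiffOn ℝ ∞ (maassFn m A a b) {z : ℂ | 0 < z.im} := by
  have him : ContDiff ℝ ∞ (fun w : ℂ => (w.im : ℂ)) := ofRealCLM.contDiff.comp imCLM.contDiff
  unfold maassFn
  refine ((contDiffOn_const.mul (him.pow m).contDiffOn).add (contDiffOn_qSer ha)).add ?_
  refine ContDiffOn.sum fun j _ => ?_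
  refine (contDiffOn_const.mul (him.pow j).contDiffOn).mul ?_
  exact conjCLE.toContinuousLinearMap.contDiff.comp_contDiffOn (contDiffOn_qSer (hb.conj.pow_mul j))

/-- The holomorphic function `g` with `(∂/∂x + i ∂/∂y) F = y^{m-1} conj g` for `F = maassFn`. -/
def maassDbar (m : ℕ) (A : ℂ) (b : ℕ → ℂ) (z : ℂ) : ℂ :=
  -(I * m * conj A) + 4 * Real.pi * I * ((4 * Real.pi) ^ (m - 1) / (m - 1).factorial) *
    qSer (fun n => (n : ℂ) ^ m * conj (b n)) z

lemma hasDbarAt_maassFn {m : ℕ} (hm : 1 ≤ m) (A : ℂ) {a b : ℕ → ℂ} (ha : PolyGrowth a)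
    (hb : PolyGrowth b) {z : ℂ} (hz : 0 < z.im) :
    HasDbarAt (maassFn m A a b) ((z.im : ℂ) ^ (m - 1) * conj (maassDbar m A b z)) z := by
  set H : ℕ → ℂ := fun j => conj (qSer (fun n => (n : ℂ) ^ j * conj (b n)) z) with hH
  have hder : ∀ j, HasDerivAt (qSer (fun n => (n : ℂ) ^ j * conj (b n)))
      (2 * Real.pi * I * qSer (fun n => (n : ℂ) ^ (j + 1) * conj (b n)) z) z := by
    intro j
    refine (hasDerivAt_qSer (hb.conj.pow_mul j) hz).congr_deriv ?_
    congr 2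
    funext n
    ring
  have h1 := ((hasDbarAt_const A z).mul (hasDbarAt_im_pow m z)).add
    (HasDerivAt.hasDbarAt (hasDerivAt_qSer ha hz))
  have h2 := HasDbarAt.sum m (fun j _ =>
    ((hasDbarAt_const ((4 * Real.pi) ^ j / j.factorial : ℂ) z).mul (hasDbarAt_im_pow j z)).mul
      (HasDerivAt.hasDbarAt_conj (hder j)))
  have h3 := h1.add h2
  unfold maassFn
  convert h3 using 1
  set T : ℕ → ℂ := fun j => (4 * Real.pi) ^ (j + 1) / j.factorial * (z.im : ℂ) ^ j * I * H (j + 1)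
    with hT
  -- The sum telescopes: differentiating y^j in the j-th summand gives T (j-1), while
  -- differentiating the conjugated series there gives -T j. Only the top term survives, which is
  -- why the result is a single power of y times an antiholomorphic function.
  have htel : ∀ p : ℕ, (∑ j ∈ Finset.range (p + 1),
      ((0 * (z.im : ℂ) ^ j + (4 * Real.pi) ^ j / j.factorial * (j * (z.im : ℂ) ^ (j - 1) * I)) *
        conj (qSer (fun n => (n : ℂ) ^ j * conj (b n)) z) +
        (4 * Real.pi) ^ j / j.factorial * (z.im : ℂ) ^ j * (2 * conj (2 * Real.pi * I *
          qSer (fun n => (n : ℂ) ^ (j + 1) * conj (b n)) z)))) = -T p := by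
    intro p
    induction p with
    | zero =>
      simp only [hT, hH, zero_add, Finset.sum_range_one, map_mul, conj_ofReal, conj_I, map_ofNat]
      simp
      ring
    | succ p ih =>
      rw [Finset.sum_range_succ, ih]
      simp only [hT, hH, map_mul, conj_ofReal, conj_I, map_ofNat, Nat.add_sub_cancel,
        Nat.factorial_succ]
      push_cast
      have h1 : (p.factorial : ℂ) ≠ 0 := by exact_mod_cast p.factorial_ne_zero
      have h2 : (p : ℂ) + 1 ≠ 0 := by exact_mod_cast p.succ_ne_zero
      field_simp
      ring
  obtain ⟨p, rfl⟩ : ∃ p, m = p + 1 := ⟨m - 1, by omega⟩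
  rw [htel p]
  simp only [maassDbar, hT, hH, Nat.add_sub_cancel, map_add, map_mul, map_neg, conj_I, conj_conj,
    map_div₀, map_pow, conj_ofReal, map_ofNat, conj_natCast]
  push_cast
  ring

lemma hasDerivAt_maassDbar {m : ℕ} (A : ℂ) {b : ℕ → ℂ} (hb : PolyGrowth b) {z : ℂ}
    (hz : 0 < z.im) : ∃ g', HasDerivAt (maassDbar m A b) g' z :=
  ⟨_, ((hasDerivAt_qSer (hb.conj.pow_mul m) hz).const_mul _).const_add _⟩

lemma extend_eventuallyEq {f : ℍ → ℂ} {F : ℂ → ℂ} (h : ∀ z : ℍ, f z = F z) {z : ℂ}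
    (hz : 0 < z.im) : extend f =ᶠ[𝓝 z] F := by
  filter_upwards [(isOpen_lt continuous_const continuous_im).mem_nhds hz] with w hw
  rw [extend, Function.comp_apply, h, UpperHalfPlane.ofComplex_apply_of_im_pos hw]

/-- A smooth function with `(∂/∂x + i ∂/∂y) F = y^{m-1} conj g`, `g` holomorphic, is harmonic of
weight `1 - m`. -/
lemma laplacian_eq_zero {f : ℍ → ℂ} {F g : ℂ → ℂ} {m : ℕ} (hm : 1 ≤ m) (hf : ∀ z : ℍ, f z = F z)
    (hF : ContDiffOn ℝ ∞ F {z : ℂ | 0 < z.im})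
    (hD : ∀ z : ℂ, 0 < z.im → HasDbarAt F ((z.im : ℂ) ^ (m - 1) * conj (g z)) z)
    (hg : ∀ z : ℂ, 0 < z.im → ∃ g', HasDerivAt g g' z) (z : ℍ) :
    laplacian (1 - (m : ℤ)) f z = 0 := by
  have hz : 0 < (z : ℂ).im := z.im_pos
  have hopen : IsOpen {z : ℂ | 0 < z.im} := isOpen_lt continuous_const continuous_im
  have e0 := extend_eventuallyEq hf hz
  have eX : partialX (extend f) =ᶠ[𝓝 (z : ℂ)] partialX F := by
    filter_upwards [e0.eventuallyEq_nhds] with w hw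
    rw [partialX, partialX, hw.fderiv_eq]
  have eY : partialY (extend f) =ᶠ[𝓝 (z : ℂ)] partialY F := by
    filter_upwards [e0.eventuallyEq_nhds] with w hw
    rw [partialY, partialY, hw.fderiv_eq]
  have hFz : ContDiffAt ℝ ∞ F z := hF.contDiffAt (hopen.mem_nhds hz)
  have hsym : IsSymmSndFDerivAt ℝ F z := hFz.isSymmSndFDerivAt (by simpa using ENat.LEInfty.out)
  have hdF : DifferentiableAt ℝ (fderiv ℝ F) (z : ℂ) :=
    (hFz.fderiv_right (m := 1) (by norm_cast)).differentiableAt (by simp)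
  have hX : ∀ v, fderiv ℝ (partialX F) z v = fderiv ℝ (fderiv ℝ F) z v 1 := by
    intro v
    have : HasFDerivAt (partialX F) _ (z : ℂ) := hdF.hasFDerivAt.clm_apply (hasFDerivAt_const 1 _)
    rw [this.fderiv]; simp
  have hY : ∀ v, fderiv ℝ (partialY F) z v = fderiv ℝ (fderiv ℝ F) z v I := by
    intro v
    have : HasFDerivAt (partialY F) _ (z : ℂ) := hdF.hasFDerivAt.clm_apply (hasFDerivAt_const I _)
    rw [this.fderiv]; simp
  have hdX : DifferentiableAt ℝ (partialX F) (z : ℂ) :=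
    hdF.clm_apply (differentiableAt_const 1)
  have hdY : DifferentiableAt ℝ (partialY F) (z : ℂ) :=
    hdF.clm_apply (differentiableAt_const I)
  have eD : (fun w => partialX F w + I * partialY F w) =ᶠ[𝓝 (z : ℂ)]
      fun w => (w.im : ℂ) ^ (m - 1) * conj (g w) := by
    filter_upwards [hopen.mem_nhds hz] with w hw
    exact (hD w hw).eq
  obtain ⟨g', hg'⟩ := hg z hz
  have hG : HasFDerivAt (fun w => conj (g w)) _ (z : ℂ) :=
    (conjCLE.toContinuousLinearMap.hasFDerivAt).comp (z : ℂ) hg'.complexToReal_fderiv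
  have him : HasFDerivAt (fun w : ℂ => (w.im : ℂ)) _ (z : ℂ) :=
    (ofRealCLM.hasFDerivAt).comp (z : ℂ) imCLM.hasFDerivAt
  have hR := (him.pow (m - 1)).mul hG
  have hL := hdX.hasFDerivAt.add (hdY.hasFDerivAt.const_mul I)
  have hLR := (hR.congr_of_eventuallyEq eD).unique hL
  have h1 := congrArg (fun L : ℂ →L[ℝ] ℂ => L 1) hLR
  have hI := congrArg (fun L : ℂ →L[ℝ] ℂ => L I) hLR
  simp [hX, hY] at h1 hI
  have hs := hsym I 1
  have hxx : partialX (partialX (extend f)) z = fderiv ℝ (partialX F) z 1 := by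
    rw [partialX, eX.fderiv_eq]
  have hyy : partialY (partialY (extend f)) z = fderiv ℝ (partialY F) z I := by
    rw [partialY, eY.fderiv_eq]
  rw [laplacian, hxx, hyy, eX.self_of_nhds, eY.self_of_nhds, (hD z hz).eq, hX, hY]
  obtain ⟨p, rfl⟩ : ∃ p, m = p + 1 := ⟨m - 1, by omega⟩
  simp only [Nat.add_sub_cancel] at h1 hI ⊢
  -- The Laplacian factors as (∂/∂x - i∂/∂y)(∂/∂x + i∂/∂y), the mixed terms cancelling by symmetry
  -- of the second derivative. The first factor annihilates conj g, so it acts only on y^p, giving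
  -- -i p y^(p-1).
  have e1 : (fderiv ℝ (fderiv ℝ F) (z : ℂ) 1) 1 + (fderiv ℝ (fderiv ℝ F) (z : ℂ) I) I =
      -(I * (conj (g z) * (p * (z.im : ℂ) ^ (p - 1)))) := by
    linear_combination -h1 + I * hI + I * hs + ((z.im : ℂ) ^ p * conj g' +
      (fderiv ℝ (fderiv ℝ F) (z : ℂ) I) I) * I_mul_I
  rw [e1]
  rcases p with _ | p
  · simp
  · push_cast
    simp only [UpperHalfPlane.coe_im]
    ring

/-- The weight factor y^(1-m) cancels y^(m-1), and the conjugation in the shadow operator undoes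
that of g. -/
lemma shadow_eq {f : ℍ → ℂ} {F g : ℂ → ℂ} {m : ℕ} (hm : 1 ≤ m) (hf : ∀ z : ℍ, f z = F z)
    (hD : ∀ z : ℂ, 0 < z.im → HasDbarAt F ((z.im : ℂ) ^ (m - 1) * conj (g z)) z) (z : ℍ) :
    shadow (1 - (m : ℤ)) f z = I * g z := by
  have hz : 0 < (z : ℂ).im := z.im_pos
  have e0 := extend_eventuallyEq hf hz
  have hX : partialX (extend f) z = partialX F z := by rw [partialX, partialX, e0.fderiv_eq]
  have hY : partialY (extend f) z = partialY F z := by rw [partialY, partialY, e0.fderiv_eq]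
  have hy : (z.im : ℂ) ≠ 0 := by exact_mod_cast z.im_ne_zero
  rw [shadow, hX, hY, (hD z hz).eq]
  obtain ⟨p, rfl⟩ : ∃ p, m = p + 1 := ⟨m - 1, by omega⟩
  have h1 : (1 - ((p + 1 : ℕ) : ℤ)) = -(p : ℤ) := by push_cast; ring
  rw [h1, zpow_neg, zpow_natCast]
  simp only [Nat.add_sub_cancel, UpperHalfPlane.coe_im, map_div₀, map_mul, map_pow, conj_ofReal,
    conj_conj, map_ofNat]
  field_simp

lemma shadow_maassFn {f : ℍ → ℂ} {m : ℕ} (hm : 1 ≤ m) (A : ℂ) {a b : ℕ → ℂ} (ha : PolyGrowth a)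
    (hb : PolyGrowth b) (hf : ∀ z : ℍ, f z = maassFn m A a b z) (z : ℍ) :
    shadow (1 - (m : ℤ)) f z = m * conj A - (4 * Real.pi) ^ m / (m - 1).factorial *
      qSer (fun n => (n : ℂ) ^ m * conj (b n)) z := by
  rw [shadow_eq hm hf (fun z hz => hasDbarAt_maassFn hm A ha hb hz) z, maassDbar]
  obtain ⟨p, rfl⟩ : ∃ p, m = p + 1 := ⟨m - 1, by omega⟩
  simp only [Nat.add_sub_cancel, pow_succ]
  linear_combination (-((p + 1 : ℕ) : ℂ) * conj A + 4 * Real.pi * ((4 * Real.pi) ^ p / p.factorial) *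
    qSer (fun n => (n : ℂ) ^ p * (n : ℂ) * conj (b n)) z) * I_mul_I

lemma PolyGrowth.add {a b : ℕ → ℂ} (ha : PolyGrowth a) (hb : PolyGrowth b) :
    PolyGrowth (fun n => a n + b n) := by
  obtain ⟨C, K, ha⟩ := ha
  obtain ⟨D, L, hb⟩ := hb
  have hC : 0 ≤ C := by simpa using (norm_nonneg _).trans (ha 0)
  have hD : 0 ≤ D := by simpa using (norm_nonneg _).trans (hb 0)
  refine ⟨C + D, K + L, fun n => (norm_add_le _ _).trans ?_⟩
  have h1 : (1 : ℝ) ≤ (n : ℝ) + 1 := by linarith [(Nat.cast_nonneg n : (0 : ℝ) ≤ n)]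
  calc ‖a n‖ + ‖b n‖ ≤ C * ((n : ℝ) + 1) ^ K + D * ((n : ℝ) + 1) ^ L := add_le_add (ha n) (hb n)
    _ ≤ C * ((n : ℝ) + 1) ^ (K + L) + D * ((n : ℝ) + 1) ^ (K + L) := by
      gcongr <;> first | exact h1 | omega
    _ = _ := by ring

lemma polyGrowth_single (c : ℂ) : PolyGrowth (fun n => if n = 0 then c else 0) :=
  ⟨‖c‖, 0, fun n => by by_cases h : n = 0 <;> simp [h]⟩

/-- If the nonholomorphic part vanished identically, so would its image under ∂/∂x + i∂/∂y, hence
the holomorphic series `maassDbar`, and uniqueness of q-coefficients would kill A and every b(n)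
with n ≥ 1. The factor n^m hides b(0), hence the restriction on n. -/
lemma exists_nonhol_ne_zero {m : ℕ} (hm : 1 ≤ m) {A : ℂ} {b : ℕ → ℂ} (hb : PolyGrowth b)
    (h : A ≠ 0 ∨ ∃ n, 1 ≤ n ∧ b n ≠ 0) :
    ∃ z : ℍ, A * (z.im : ℂ) ^ m + conjSer m b z ≠ 0 := by
  by_contra! hcon
  have h0 : PolyGrowth (fun _ => (0 : ℂ)) := ⟨0, 0, by simp⟩
  have hF : ∀ z : ℂ, 0 < z.im → maassFn m A (fun _ => 0) b z = 0 := by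
    intro z hz
    have := hcon ⟨z, hz⟩
    rw [maassFn_eq A _ hb hz]
    simpa [qSer] using this
  have hd : ∀ z : ℂ, 0 < z.im → maassDbar m A b z = 0 := by
    intro z hz
    have h1 := (hasDbarAt_maassFn hm A h0 hb hz).eq
    have e : maassFn m A (fun _ => 0) b =ᶠ[𝓝 z] fun _ => 0 := by
      filter_upwards [(isOpen_lt continuous_const continuous_im).mem_nhds hz] with w hw
      exact hF w hw
    rw [partialX, partialY, e.fderiv_eq] at h1
    have hy : (z.im : ℂ) ≠ 0 := by exact_mod_cast hz.ne'
    simpa [hy] using h1.symm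
  set c : ℂ := 4 * Real.pi * I * ((4 * Real.pi) ^ (m - 1) / (m - 1).factorial) with hc
  have hc0 : c ≠ 0 := by
    have : (Real.pi : ℂ) ≠ 0 := by exact_mod_cast Real.pi_ne_zero
    have h2 : ((m - 1).factorial : ℂ) ≠ 0 := by exact_mod_cast Nat.factorial_ne_zero _
    simp [hc, this, h2]
  have hs := (hb.conj.pow_mul m).const_mul c
  have hg := (polyGrowth_single (-(I * m * conj A))).add hs
  have hz0 := eq_zero_of_qSer_eq_zero hg (fun z hz => by
    refine Eq.trans ?_ (hd z hz)
    rw [maassDbar, ← hc, qSer]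
    simp_rw [add_mul]
    rw [Summable.tsum_add (summable_qE (polyGrowth_single _) hz) (summable_qE hs hz)]
    congr 1
    · rw [tsum_eq_single 0 (by intro n hn; simp [hn])]
      simp [qE_zero]
    · rw [qSer, ← tsum_mul_left]
      exact tsum_congr fun n => by ring)
  rcases h with hA | ⟨n, hn, hbn⟩
  · have := hz0 0
    have hm0 : m ≠ 0 := by omega
    simp [hm0, hA] at this
  · have := hz0 n
    have hn0 : n ≠ 0 := by omega
    simp [hn0, hc0, hbn] at this

lemma qPow_natCast (n : ℕ) (z : ℍ) : qPow n z = qE n z := by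
  rw [qPow, qE]
  push_cast
  rfl

/-- The exponential factor split off here is the one that completes R_m(4πny) to Γ(m, 4πny), and
conj(q^n) becomes q^(-n). -/
lemma conj_qE (n : ℕ) (z : ℂ) :
    conj (qE n z) = Real.exp (-(4 * Real.pi * n * z.im)) * exp (2 * Real.pi * I * (-n : ℤ) * z) := by
  rw [qE, ← exp_conj, ofReal_exp, ← exp_add]
  congr 1
  simp only [map_mul, conj_ofReal, conj_I, map_ofNat, conj_natCast]
  apply Complex.ext <;> simp <;> ring

lemma hasMaassExpansion_maassFn {f : ℍ → ℂ} {m : ℕ} (hm : 1 ≤ m) {A : ℂ} {a b : ℕ → ℂ}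
    (ha : PolyGrowth a) (hb : PolyGrowth b) (hb0 : b 0 = 0)
    (hf : ∀ z : ℍ, f z = maassFn m A a b z) :
    ∃ cplus cminus : ℤ → ℂ, HasMaassExpansion (1 - (m : ℤ)) f cplus cminus ∧
      (∀ z : ℍ, ∑' n : ℤ, cplus n * qPow n z = qSer a z) ∧
      ∀ z : ℍ, ∑' n : ℤ, nonholTerm (1 - (m : ℤ)) cminus n z =
        A * (z.im : ℂ) ^ m + conjSer m b z := by
  set cp : ℤ → ℂ := fun n => if 0 ≤ n then a n.toNat else 0 with hcp
  -- The term b(n) R_m(4πny) conj(q^n) sits at index -n, and (m-1)! is the factor between R_m and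
  -- Γ(m, ·). Index 0 is taken by A y^m, which is why b(0) = 0 is required.
  set cm : ℤ → ℂ := fun n => if n = 0 then A else if n < 0 then
    b (-n).toNat / (m - 1).factorial else 0 with hcm
  have hfac : ((m - 1).factorial : ℂ) ≠ 0 := by exact_mod_cast Nat.factorial_ne_zero _
  have hP : ∀ z : ℍ, HasSum (fun n : ℤ => cp n * qPow n z) (qSer a z) := by
    intro z
    rw [← Function.Injective.hasSum_iff (g := fun n : ℕ => (n : ℤ)) Nat.cast_injective]
    · have : HasSum _ (qSer a z) := (summable_qE ha z.im_pos).hasSum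
      convert this using 2 with n
      simp [hcp, qPow_natCast]
    · intro n hn
      have : ¬ 0 ≤ n := fun h => hn ⟨n.toNat, by simp [h]⟩
      simp [hcp, this]
  have hM : ∀ z : ℍ, HasSum (fun n : ℤ => nonholTerm (1 - (m : ℤ)) cm n z)
      (A * (z.im : ℂ) ^ m + conjSer m b z) := by
    intro z
    rw [← Function.Injective.hasSum_iff (g := fun n : ℕ => -(n : ℤ))
      (fun x y h => by simpa using h)]
    · have h1 := hasSum_ite_eq (0 : ℕ) (A * (z.im : ℂ) ^ m)
      have h2 := hasSum_conjSer (m := m) hb (z := (z : ℂ)) z.im_pos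
      rw [← h2.tsum_eq, ← conjSer] at h2
      have h3 := h1.add h2
      convert h3 using 2 with n
      have hκ : 1 - (1 - (m : ℤ)) = m := by ring
      rcases Nat.eq_zero_or_pos n with rfl | hn
      · simp [nonholTerm, hcm, hb0, hκ]
      · have hn0 : n ≠ 0 := hn.ne'
        have hx : 0 < 4 * Real.pi * n * z.im := by
          have := z.im_pos
          have : (0 : ℝ) < n := by exact_mod_cast hn
          have := Real.pi_pos
          positivity
        have hx' : -4 * Real.pi * ((-(n : ℤ) : ℤ) : ℝ) * z.im = 4 * Real.pi * n * z.im := by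
          push_cast; ring
        simp only [Function.comp_apply, nonholTerm, hκ, hx', incGamma_eq hm hx, hcm, conj_qE]
        simp [hn0, hn, qPow]
        field_simp
    · intro n hn
      have : ¬ n ≤ 0 := fun h => hn ⟨(-n).toNat, by simp [h]⟩
      have h1 : n ≠ 0 := by omega
      have h2 : ¬ n < 0 := by omega
      simp [nonholTerm, hcm, h1, h2]
  refine ⟨cp, cm, ⟨⟨0, fun n hn => by simp [hcp, hn]⟩, ⟨0, fun n hn => ?_⟩,
    fun z => (hP z).summable, fun z => (hM z).summable, fun z => ?_⟩, fun z => (hP z).tsum_eq,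
    fun z => (hM z).tsum_eq⟩
  · have h1 : n ≠ 0 := by omega
    have h2 : ¬ n < 0 := by omega
    simp [hcm, h1, h2]
  · rw [(hP z).tsum_eq, (hM z).tsum_eq, hf, maassFn_eq A a hb z.im_pos]
    simp only [UpperHalfPlane.coe_im]
    ring

/-- A function with an expansion of the shape `maassFn` that transforms like a modular form and has
manageable growth gives a mock modular form. -/
theorem isMockModularFormWithShadow_of_maassFn {N m : ℕ} (hm : 1 ≤ m)
    {χ : DirichletCharacter ℂ N} {f g h : ℍ → ℂ} {A : ℂ} {a b : ℕ → ℂ}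
    (ha : PolyGrowth a) (hb : PolyGrowth b) (hb0 : b 0 = 0)
    (hf : ∀ z : ℍ, f z = maassFn m A a b z)
    (hmod : ∀ γ ∈ CongruenceSubgroup.Gamma0 N, ∀ z : ℍ,
      (f ∣[1 - (m : ℤ)] γ) z = χ ((γ 1 1 : ℤ) : ZMod N) * f z)
    (hgrowth : ∀ γ : SL(2, ℤ), ∃ ε : ℝ, 0 < ε ∧
      (f ∣[1 - (m : ℤ)] γ) =O[UpperHalfPlane.atImInfty] fun z : ℍ => Real.exp (ε * z.im))
    (hne : A ≠ 0 ∨ ∃ n, 1 ≤ n ∧ b n ≠ 0)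
    (hg : ∀ z : ℍ, g z = qSer a z)
    (hh : ∀ z : ℍ, h z = m * conj A - (4 * Real.pi) ^ m / (m - 1).factorial *
      qSer (fun n => (n : ℂ) ^ m * conj (b n)) z) :
    IsMockModularFormWithShadow N (1 - (m : ℤ)) χ g h := by
  obtain ⟨cp, cm, hexp, hp, hn⟩ := hasMaassExpansion_maassFn hm ha hb hb0 hf
  have hsm := contDiffOn_maassFn (m := m) A ha hb
  refine ⟨f, cp, cm, ⟨?_, hmod, ?_, hgrowth⟩, hexp, fun z => by rw [hg, hp], ?_, fun z => ?_⟩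
  · refine hsm.congr fun z hz => ?_
    exact (extend_eventuallyEq hf hz).self_of_nhds
  · exact laplacian_eq_zero hm hf hsm (fun z hz => hasDbarAt_maassFn hm A ha hb hz)
      (fun z hz => hasDerivAt_maassDbar A hb hz)
  · obtain ⟨z, hz⟩ := exists_nonhol_ne_zero hm hb hne
    exact ⟨z, by rwa [hn]⟩
  · rw [hh, shadow_maassFn hm A ha hb hf]

/-- Crude growth of `maassFn` towards the cusp. -/
lemma exists_bound_maassFn (m : ℕ) (A : ℂ) {a b : ℕ → ℂ} (ha : PolyGrowth a) (hb : PolyGrowth b)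
    {δ : ℝ} (hδ : 0 < δ) : ∃ M : ℝ, ∀ z : ℂ, δ ≤ z.im →
      ‖maassFn m A a b z‖ ≤ M * (1 + z.im) ^ m := by
  obtain ⟨Ma, hMa, hba⟩ := exists_bound_qSer ha δ hδ
  choose Mb hMb hbb using fun j => exists_bound_qSer (hb.conj.pow_mul j) δ hδ
  refine ⟨‖A‖ + Ma + ∑ j ∈ Finset.range m, (4 * Real.pi) ^ j / j.factorial * Mb j, fun z hz => ?_⟩
  have hy : 0 < z.im := hδ.trans_le hz
  have h1 : (1 : ℝ) ≤ (1 + z.im) ^ m := one_le_pow₀ (by linarith)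
  rw [maassFn, add_mul, add_mul, Finset.sum_mul]
  refine (norm_add₃_le).trans (add_le_add (add_le_add ?_ ?_) ((norm_sum_le _ _).trans
    (Finset.sum_le_sum fun j hj => ?_)))
  · rw [norm_mul, norm_pow, norm_real, Real.norm_of_nonneg hy.le]
    gcongr
    linarith
  · exact (hba z hz).trans (le_mul_of_one_le_right hMa h1)
  · have hjm : j ≤ m := (Finset.mem_range.mp hj).le
    have h2 : z.im ^ j ≤ (1 + z.im) ^ m := calc
      z.im ^ j ≤ (1 + z.im) ^ j := by gcongr; linarith
      _ ≤ (1 + z.im) ^ m := pow_le_pow_right₀ (by linarith) hjm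
    have h3 : ‖((4 * Real.pi) ^ j / j.factorial * (z.im : ℂ) ^ j : ℂ)‖ =
        (4 * Real.pi) ^ j / j.factorial * z.im ^ j := by
      simp [abs_of_pos Real.pi_pos, abs_of_pos hy]
    rw [norm_mul, RCLike.norm_conj, h3]
    calc _ ≤ (4 * Real.pi) ^ j / j.factorial * (1 + z.im) ^ m * Mb j := by
          gcongr
          exact hbb j z hz
      _ = _ := by ring

/-! ### The Poisson-type formula for one row -/

/-- The kernel `w⁻¹ conj(w)^{-m}`. -/
def kern (m : ℕ) (w : ℂ) : ℂ := w⁻¹ * (conj w ^ m)⁻¹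

lemma norm_kern (m : ℕ) (w : ℂ) : ‖kern m w‖ = (‖w‖ ^ (m + 1))⁻¹ := by
  rw [kern, norm_mul, norm_inv, norm_inv, norm_pow, RCLike.norm_conj, ← mul_inv, pow_succ']

lemma summable_inv_pow_add_int (w : ℂ) {k : ℕ} (hk : 2 ≤ k) :
    Summable fun j : ℤ => ((w + j) ^ k)⁻¹ := by
  have := EisensteinSeries.linear_right_summable w 1 (k := k) (by exact_mod_cast hk)
  simpa using this

lemma summable_kern {m : ℕ} (hm : 1 ≤ m) (w : ℂ) : Summable fun j : ℤ => kern m (w + j) := by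
  refine Summable.of_norm (((summable_inv_pow_add_int w (k := m + 1) (by omega)).norm).congr
    fun j => ?_)
  rw [norm_kern, norm_inv, norm_pow]

/-- The sequence `0, 1, 1, 1, …`. -/
def posInd (n : ℕ) : ℂ := if n = 0 then 0 else 1

lemma polyGrowth_posInd : PolyGrowth posInd :=
  ⟨1, 0, fun n => by by_cases h : n = 0 <;> simp [posInd, h]⟩

/-- Partial fractions, with w - conj w = 2i Im w. Since the imaginary part is constant on w + ℤ, the
identity can be summed over translates and drives the induction on m. -/
lemma kern_succ (m : ℕ) {w : ℂ} (hw : 0 < w.im) :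
    kern (m + 1) w = (2 * I * w.im)⁻¹ * (conj ((w ^ (m + 1))⁻¹) - kern m w) := by
  have h0 : w ≠ 0 := fun h => by simp [h] at hw
  have h1 : conj w ≠ 0 := (map_ne_zero _).mpr h0
  have h2 : 2 * I * w.im = w - conj w := by
    rw [sub_conj]; push_cast; ring
  have h3 : w - conj w ≠ 0 := by
    rw [← h2]
    have : (w.im : ℂ) ≠ 0 := by exact_mod_cast hw.ne'
    simp [this]
  rw [h2, kern, kern, map_inv₀, map_pow]
  field_simp
  ring

lemma tsum_geometric_qE {w : ℂ} (hw : 0 < w.im) :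
    ∑' n : ℕ, exp (2 * Real.pi * I * w) ^ n = 1 + qSer posInd w := by
  have h1 : PolyGrowth (fun _ => (1 : ℂ)) := ⟨1, 0, by simp⟩
  have h2 : ∑' n : ℕ, exp (2 * Real.pi * I * w) ^ n = qSer (fun _ => 1) w := by
    refine tsum_congr fun n => ?_
    rw [one_mul, qE_eq_pow, qE]; simp
  rw [h2, qSer_eq_zero_add h1 hw, qSer_eq_zero_add polyGrowth_posInd hw]
  simp [posInd]

/-- Partial fractions write |w+j|⁻² as a difference of conj((w+j)⁻¹) and (w+j)⁻¹. These are not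
separately summable over ℤ, so j and -j are paired; the paired sums are the cotangent series, whose
q-expansion is known. -/
lemma tsum_kern_one {w : ℂ} (hw : 0 < w.im) :
    ∑' j : ℤ, kern 1 (w + j) = Real.pi * (w.im : ℂ)⁻¹ *
      (1 + qSer posInd w + conjSer 1 posInd w) := by
  have hcot1 := cot_series_rep (x := w) (by
    rintro ⟨n, hn⟩
    rw [← hn] at hw
    simp at hw)
  have hcot2 := pi_mul_cot_pi_q_exp ⟨w, hw⟩
  simp only at hcot2
  have hk : ∀ j : ℤ, kern 1 (w + j) =
      (2 * I * w.im)⁻¹ * (conj ((w + j)⁻¹) - (w + j)⁻¹) := by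
    intro j
    have := kern_succ 0 (w := w + j) (by simpa using hw)
    simpa [kern] using this
  have ht : Summable fun n : ℕ+ => (1 / (w - n) + 1 / (w + n)) := by
    have := summable_cotTerm (x := w) (by
      rintro ⟨n, hn⟩
      rw [← hn] at hw
      simp at hw)
    have h2 := (Equiv.pnatEquivNat.summable_iff).mpr this
    refine h2.congr fun n => ?_
    simp only [Function.comp_apply, cotTerm, Equiv.pnatEquivNat_apply]
    have : ((n.natPred : ℂ) + 1) = n := by exact_mod_cast n.natPred_add_one
    rw [this]
  have hs := summable_kern le_rfl w
  rw [tsum_int_eq_zero_add_tsum_pnat hs, add_assoc, ← Summable.tsum_add]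
  rotate_left
  · exact hs.comp_injective (i := fun n : ℕ+ => ((n : ℕ) : ℤ)) (fun a b h => by simpa using h)
  · exact hs.comp_injective (i := fun n : ℕ+ => -((n : ℕ) : ℤ)) (fun a b h => by simpa using h)
  have hpair : ∀ n : ℕ+, kern 1 (w + ((n : ℕ) : ℤ)) + kern 1 (w + (-((n : ℕ) : ℤ) : ℤ)) =
      (2 * I * w.im)⁻¹ * (conj (1 / (w - n) + 1 / (w + n)) - (1 / (w - n) + 1 / (w + n))) := by
    intro n
    rw [hk, hk]
    push_cast
    simp only [map_add, one_div, ← sub_eq_add_neg]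
    ring
  rw [tsum_congr hpair, tsum_mul_left, Summable.tsum_sub ((Complex.hasSum_conj'.mpr
    (by simpa using ht.hasSum)).summable) ht, ← conj_tsum, hk 0]
  have e1 : ∑' n : ℕ+, (1 / (w - n) + 1 / (w + n)) = -(Real.pi * I) - 2 * Real.pi * I * qSer posInd w - w⁻¹ := by
    rw [tsum_geometric_qE hw] at hcot2
    rw [hcot2] at hcot1
    linear_combination -hcot1
  have e2 : conjSer 1 posInd w = conj (qSer posInd w) := by
    rw [conjSer, qSer, conj_tsum]
    refine tsum_congr fun n => ?_
    by_cases h : n = 0 <;> simp [posInd, h, expTrunc]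
  have hy : (w.im : ℂ) ≠ 0 := by exact_mod_cast hw.ne'
  rw [e1, e2]
  simp only [map_sub, map_mul, map_neg, conj_I, conj_ofReal, map_ofNat, Int.cast_zero, add_zero]
  have hI : I ≠ 0 := I_ne_zero
  field_simp
  ring

/-- The Poisson-type formula for `∑_j (w+j)⁻¹ conj(w+j)^{-m}`. -/
theorem tsum_kern {m : ℕ} (hm : 1 ≤ m) {w : ℂ} (hw : 0 < w.im) :
    ∑' j : ℤ, kern m (w + j) = Real.pi * (-2 * I) ^ (1 - (m : ℤ)) * ((w.im : ℂ) ^ m)⁻¹ *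
      (1 + qSer posInd w + conjSer m posInd w) := by
  induction m, hm using Nat.le_induction with
  | base => rw [tsum_kern_one hw]; simp
  | succ m hm ih =>
    have hy : (w.im : ℂ) ≠ 0 := by exact_mod_cast hw.ne'
    have hs : Summable fun j : ℤ => conj (((w + j) ^ (m + 1))⁻¹) :=
      (Complex.hasSum_conj'.mpr
        (by simpa using (summable_inv_pow_add_int w (k := m + 1) (by omega)).hasSum)).summable
    have h1 : ∀ j : ℤ, kern (m + 1) (w + j) =
        (2 * I * w.im)⁻¹ * (conj (((w + j) ^ (m + 1))⁻¹) - kern m (w + j)) := by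
      intro j
      have := kern_succ m (w := w + j) (by simpa using hw)
      simpa using this
    have hL := EisensteinSeries.qExpansion_identity hm ⟨w, hw⟩
    simp only [one_div] at hL
    have hL' : ∑' j : ℤ, conj (((w + j) ^ (m + 1))⁻¹) =
        conj ((-2 * Real.pi * I) ^ (m + 1) / m.factorial) *
          conj (qSer (fun n => (n : ℂ) ^ m * conj (posInd n)) w) := by
      rw [← conj_tsum, hL, map_mul]
      congr 2
      refine tsum_congr fun n => ?_
      rw [qE_eq_pow, qE]
      rcases Nat.eq_zero_or_pos n with rfl | hn
      · have : m ≠ 0 := by omega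
        simp [this]
      · simp [posInd, hn.ne']
    -- Passing from R_m to R_(m+1) adds the single term x^m/m!; up to the constants matched below,
    -- this is the conjugate of Lipschitz's formula for the exponent m+1.
    have hC : conjSer (m + 1) posInd w = conjSer m posInd w +
        ((4 * Real.pi) ^ m / m.factorial * (w.im : ℂ) ^ m) *
          conj (qSer (fun n => (n : ℂ) ^ m * conj (posInd n)) w) := by
      rw [conjSer, conjSer, (hasSum_conjSer polyGrowth_posInd hw).tsum_eq,
        (hasSum_conjSer polyGrowth_posInd hw).tsum_eq, Finset.sum_range_succ]
    rw [tsum_congr h1, tsum_mul_left, Summable.tsum_sub hs (summable_kern hm w), ih, hL', hC]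
    have e1 : (-2 * I) ^ (1 - (m : ℤ)) = (-2 * I) ^ (1 - ((m + 1 : ℕ) : ℤ)) * (-2 * I) := by
      rw [← zpow_add_one₀ (by simp)]
      congr 1
      push_cast
      ring
    have e2 : conj ((-2 * Real.pi * I) ^ (m + 1) / m.factorial : ℂ) =
        2 * I * Real.pi * ((-2 * I) ^ (1 - ((m + 1 : ℕ) : ℤ))) *
          ((4 * Real.pi) ^ m / m.factorial) := by
      have : (1 - ((m + 1 : ℕ) : ℤ)) = -(m : ℤ) := by push_cast; ring
      rw [this, zpow_neg, zpow_natCast]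
      have h4 : (4 * Real.pi : ℂ) = (2 * Real.pi * I) * (-2 * I) := by
        linear_combination (4 * Real.pi : ℂ) * I_mul_I
      rw [h4, mul_pow (2 * Real.pi * I : ℂ)]
      have h5 : ((-2 * I) ^ m : ℂ) ≠ 0 := by simp
      have h6 : conj (-2 * Real.pi * I) = 2 * Real.pi * I := by
        simp only [map_mul, map_neg, map_ofNat, conj_ofReal, conj_I]
        ring
      rw [map_div₀, map_pow, conj_natCast, h6]
      generalize ((-2 * I) ^ m : ℂ) = u at h5
      generalize h7 : (2 * Real.pi * I : ℂ) = v
      have h8 : 2 * I * Real.pi = v := by rw [← h7]; ring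
      rw [h8]
      field_simp
      ring
    rw [e1, e2]
    have hI : I ≠ 0 := I_ne_zero
    field_simp
    ring

/-! ### Lambert-type double series -/

/-- The sum of `β` over the factorizations `n = c d`. -/
def divSum (β : ℕ → ℕ → ℂ) (n : ℕ) : ℂ := ∑ p ∈ n.divisorsAntidiagonal, β p.1 p.2

lemma card_divisorsAntidiagonal_le (n : ℕ) : n.divisorsAntidiagonal.card ≤ n := by
  rw [← Nat.map_div_right_divisors, Finset.card_map]
  exact Nat.card_divisors_le_self n

lemma norm_divSum_le {β : ℕ → ℕ → ℂ} {C : ℝ} (hC : 0 ≤ C) {n : ℕ}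
    (hβ : ∀ c d, 1 ≤ c → 1 ≤ d → ‖β c d‖ ≤ C) : ‖divSum β n‖ ≤ n * C := by
  refine (norm_sum_le _ _).trans ((Finset.sum_le_card_nsmul _ _ C fun p hp => ?_).trans ?_)
  · have := Nat.mem_divisorsAntidiagonal.mp hp
    refine hβ _ _ (Nat.pos_of_ne_zero ?_) (Nat.pos_of_ne_zero ?_)
    · rintro h; simp [h] at this; omega
    · rintro h; simp [h] at this; omega
  · rw [nsmul_eq_mul]
    gcongr
    exact card_divisorsAntidiagonal_le n

lemma polyGrowth_divSum {β : ℕ → ℕ → ℂ} {C : ℝ} (hC : 0 ≤ C)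
    (hβ : ∀ c d, 1 ≤ c → 1 ≤ d → ‖β c d‖ ≤ C) : PolyGrowth (divSum β) := by
  refine ⟨C, 1, fun n => (norm_divSum_le hC hβ).trans ?_⟩
  rw [pow_one, mul_comm]
  gcongr
  linarith

/-- Grouping the pairs by their product leaves at most n pairs for each n, so summability of n
|E(n)| is enough for bounded β. -/
lemma summable_lambert {β : ℕ → ℕ → ℂ} {C : ℝ} (hC : 0 ≤ C)
    (hβ : ∀ c d, 1 ≤ c → 1 ≤ d → ‖β c d‖ ≤ C) {E : ℕ → ℂ} (hE : Summable fun n => n * ‖E n‖) :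
    Summable fun p : ℕ+ × ℕ+ => β p.1 p.2 * E (p.1 * p.2) := by
  rw [← sigmaAntidiagonalEquivProd.summable_iff]
  refine Summable.of_norm ?_
  rw [summable_sigma_of_nonneg fun a => norm_nonneg _]
  refine ⟨fun n => (hasSum_fintype _).summable, ?_⟩
  have hE' : Summable fun n : ℕ+ => C * ((n : ℕ) * ‖E n‖) :=
    (hE.mul_left C).comp_injective PNat.coe_injective
  refine Summable.of_nonneg_of_le (fun n => tsum_nonneg fun _ => norm_nonneg _) (fun n => ?_) hE'
  rw [tsum_fintype]
  have hcard : (Finset.univ : Finset (Nat.divisorsAntidiagonal (n : ℕ))).card ≤ n := by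
    simpa using card_divisorsAntidiagonal_le (n : ℕ)
  refine (Finset.sum_le_card_nsmul _ _ (C * ‖E n‖) fun x _ => ?_).trans ?_
  · have h' : ((divisorsAntidiagonalFactors n x).1 : ℕ) *
      ((divisorsAntidiagonalFactors n x).2 : ℕ) = n := divisorsAntidiagonalFactors_eq x
    change ‖β (divisorsAntidiagonalFactors n x).1 (divisorsAntidiagonalFactors n x).2 *
      E ((divisorsAntidiagonalFactors n x).1 * (divisorsAntidiagonalFactors n x).2)‖ ≤ _
    rw [h', norm_mul]
    gcongr
    exact hβ _ _ (PNat.pos _) (PNat.pos _)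
  · rw [nsmul_eq_mul]
    calc _ ≤ ((n : ℕ) : ℝ) * (C * ‖E n‖) := by gcongr
      _ = _ := by ring

lemma hasSum_lambert {β : ℕ → ℕ → ℂ} {C : ℝ} (hC : 0 ≤ C)
    (hβ : ∀ c d, 1 ≤ c → 1 ≤ d → ‖β c d‖ ≤ C) {E : ℕ → ℂ} (hE : Summable fun n => n * ‖E n‖) :
    HasSum (fun c : ℕ+ => ∑' n : ℕ+, β c n * E (c * n)) (∑' n : ℕ, divSum β n * E n) := by
  have hs := summable_lambert hC hβ hE
  have h1 : HasSum (fun c : ℕ+ => ∑' n : ℕ+, β c n * E (c * n))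
      (∑' p : ℕ+ × ℕ+, β p.1 p.2 * E (p.1 * p.2)) :=
    hs.hasSum.prod_fiberwise fun c => (hs.prod_factor c).hasSum
  convert h1 using 1
  have hs' := sigmaAntidiagonalEquivProd.summable_iff.mpr hs
  rw [← sigmaAntidiagonalEquivProd.tsum_eq]
  refine Eq.trans ?_ hs'.tsum_sigma.symm
  have hs0 : Summable fun n : ℕ => divSum β n * E n := by
    refine Summable.of_norm_bounded (hE.mul_left C) fun n => ?_
    rw [norm_mul]
    calc _ ≤ (n * C) * ‖E n‖ := by gcongr; exact norm_divSum_le hC hβ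
      _ = _ := by ring
  rw [← tsum_zero_pnat_eq_tsum_nat hs0]
  simp only [divSum, Nat.divisorsAntidiagonal_zero, Finset.sum_empty, zero_mul, zero_add]
  refine tsum_congr fun n => ?_
  rw [tsum_fintype, ← Finset.sum_coe_sort (Nat.divisorsAntidiagonal (n : ℕ)), Finset.sum_mul]
  refine Finset.sum_congr rfl fun x _ => ?_
  have h' : ((divisorsAntidiagonalFactors n x).1 : ℕ) *
      ((divisorsAntidiagonalFactors n x).2 : ℕ) = n := divisorsAntidiagonalFactors_eq x
  change _ = β (divisorsAntidiagonalFactors n x).1 (divisorsAntidiagonalFactors n x).2 *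
      E ((divisorsAntidiagonalFactors n x).1 * (divisorsAntidiagonalFactors n x).2)
  rw [h']
  rfl

/-! ### Residue classes and finite Fourier transforms -/

lemma tsum_int_residues (N : ℕ) [NeZero N] {f : ℤ → ℂ} (hf : Summable f) :
    ∑' d : ℤ, f d = ∑ r ∈ Finset.range N, ∑' j : ℤ, f (r + N * j) := by
  have hs := (Int.divModEquiv N).symm.summable_iff.mpr hf
  have hs' := (Equiv.prodComm (Fin N) ℤ).summable_iff.mpr hs
  rw [← (Int.divModEquiv N).symm.tsum_eq, ← (Equiv.prodComm (Fin N) ℤ).tsum_eq]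
  refine hs'.tsum_prod.trans ?_
  rw [tsum_fintype, ← Fin.sum_univ_eq_sum_range (fun r => ∑' j : ℤ, f (r + N * j))]
  refine Finset.sum_congr rfl fun r _ => tsum_congr fun j => ?_
  simp [Int.divModEquiv, add_comm, mul_comm]

variable {N : ℕ}

/-- The partial finite Fourier transform `∑_r φ(c, r) e(n r / N)`. -/
def fhat (φ : ZMod N → ZMod N → ℂ) (c : ZMod N) (n : ℤ) : ℂ :=
  ∑ r ∈ Finset.range N, φ c r * exp (2 * Real.pi * I * n * r / N)

/-- The row sums of `φ`. -/
def rowSum (φ : ZMod N → ZMod N → ℂ) (c : ZMod N) : ℂ := ∑ r ∈ Finset.range N, φ c r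

lemma exists_bound_of_zmod [NeZero N] (φ : ZMod N → ZMod N → ℂ) :
    ∃ M : ℝ, 0 ≤ M ∧ ∀ c d, ‖φ c d‖ ≤ M := by
  obtain ⟨M, hM⟩ := (Set.finite_range fun p : ZMod N × ZMod N => ‖φ p.1 p.2‖).bddAbove
  exact ⟨M, (norm_nonneg _).trans (hM ⟨(0, 0), rfl⟩), fun c d => hM ⟨(c, d), rfl⟩⟩

lemma exists_bound_fhat [NeZero N] (φ : ZMod N → ZMod N → ℂ) :
    ∃ M : ℝ, 0 ≤ M ∧ ∀ c n, ‖fhat φ c n‖ ≤ M := by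
  obtain ⟨M, hM, h⟩ := exists_bound_of_zmod φ
  refine ⟨N * M, by positivity, fun c n => (norm_sum_le _ _).trans ?_⟩
  refine (Finset.sum_le_card_nsmul _ _ M fun r _ => ?_).trans (by simp)
  have : (2 * Real.pi * I * n * r / N : ℂ) = ((2 * Real.pi * n * r / N : ℝ) : ℂ) * I := by
    push_cast; ring
  rw [norm_mul, this, norm_exp_ofReal_mul_I, mul_one]
  exact h _ _

/-- The coefficients `∑_{c d = n} c^{-m} φ^(c, ε d)`. -/
def eisCoef (m : ℕ) (φ : ZMod N → ZMod N → ℂ) (ε : ℤ) : ℕ → ℂ :=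
  divSum fun c d => ((c : ℂ) ^ m)⁻¹ * fhat φ c (ε * d)

lemma exists_bound_eisCoef_term [NeZero N] (m : ℕ) (φ : ZMod N → ZMod N → ℂ) (ε : ℤ) :
    ∃ M : ℝ, 0 ≤ M ∧ ∀ c d : ℕ, 1 ≤ c → 1 ≤ d → ‖((c : ℂ) ^ m)⁻¹ * fhat φ c (ε * d)‖ ≤ M := by
  obtain ⟨M, hM, h⟩ := exists_bound_fhat φ
  refine ⟨M, hM, fun c d hc _ => ?_⟩
  have hc' : (1 : ℝ) ≤ c := by exact_mod_cast hc
  rw [norm_mul, norm_inv, norm_pow, norm_natCast]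
  calc _ ≤ 1 * M := by
        gcongr
        · exact inv_le_one_of_one_le₀ (one_le_pow₀ hc')
        · exact h _ _
    _ = M := one_mul M

lemma polyGrowth_eisCoef [NeZero N] (m : ℕ) (φ : ZMod N → ZMod N → ℂ) (ε : ℤ) :
    PolyGrowth (eisCoef m φ ε) := by
  obtain ⟨M, hM, h⟩ := exists_bound_eisCoef_term m φ ε
  exact polyGrowth_divSum hM h

lemma eisCoef_zero (m : ℕ) (φ : ZMod N → ZMod N → ℂ) (ε : ℤ) : eisCoef m φ ε 0 = 0 := by
  simp [eisCoef, divSum]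

/-! ### Fourier expansion of the row with fixed c -/

/-- The antiholomorphic term `R_m(4 π n y) conj (q^n)`. -/
def conjTerm (m n : ℕ) (z : ℂ) : ℂ := (expTrunc m (4 * Real.pi * n * z.im) : ℂ) * conj (qE n z)

lemma PolyGrowth.summable_mul_norm_qE {a : ℕ → ℂ} (ha : PolyGrowth a) {z : ℂ} (hz : 0 < z.im) :
    Summable fun n : ℕ => n * ‖a n * qE n z‖ := by
  refine (summable_norm_qE (ha.pow_mul 1) hz).congr fun n => ?_
  simp [mul_assoc]

lemma polyGrowth_expTrunc (m : ℕ) {y : ℝ} (hy : 0 < y) :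
    PolyGrowth fun n => (expTrunc m (4 * Real.pi * n * y) : ℂ) := by
  refine ⟨expTrunc m (4 * Real.pi * y), m, fun n => ?_⟩
  have hpi := Real.pi_pos
  have h0 : 0 ≤ expTrunc m (4 * Real.pi * n * y) := by
    unfold expTrunc; positivity
  rw [norm_real, Real.norm_of_nonneg h0, expTrunc, expTrunc, Finset.sum_mul]
  refine Finset.sum_le_sum fun j hj => ?_
  have h1 : (4 * Real.pi * n * y) ^ j = (4 * Real.pi * y) ^ j * (n : ℝ) ^ j := by
    rw [← mul_pow]; ring
  have h2 : (n : ℝ) ^ j ≤ ((n : ℝ) + 1) ^ m := calc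
    (n : ℝ) ^ j ≤ ((n : ℝ) + 1) ^ j := by gcongr; linarith
    _ ≤ _ := pow_le_pow_right₀ (by linarith [(Nat.cast_nonneg n : (0 : ℝ) ≤ n)])
      (Finset.mem_range.mp hj).le
  rw [h1, mul_div_right_comm]
  gcongr

lemma summable_mul_norm_conjTerm (m : ℕ) {z : ℂ} (hz : 0 < z.im) :
    Summable fun n : ℕ => n * ‖conjTerm m n z‖ := by
  refine ((polyGrowth_expTrunc m hz).summable_mul_norm_qE hz).congr fun n => ?_
  rw [conjTerm, norm_mul, norm_mul, RCLike.norm_conj]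

lemma polyGrowth_one : PolyGrowth fun _ => (1 : ℂ) := ⟨1, 0, by simp⟩

/-- The nonconstant part of the `c`-th row of an Eisenstein series. -/
def rowTail (m : ℕ) (φ : ZMod N → ZMod N → ℂ) (c : ℕ) (z : ℂ) : ℂ :=
  ∑' n : ℕ+, (fhat φ c n * qE (c * n) z + fhat φ c (-n) * conjTerm m (c * n) z)

/-- The exponentials depend on c and n only through cn, so summation over the rows is a pair of
Lambert series, one holomorphic and one antiholomorphic. -/
lemma hasSum_rowTail [NeZero N] (m : ℕ) (φ : ZMod N → ZMod N → ℂ) {z : ℂ} (hz : 0 < z.im) :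
    HasSum (fun c : ℕ+ => ((c : ℂ) ^ m)⁻¹ * rowTail m φ c z)
      (qSer (eisCoef m φ 1) z + conjSer m (eisCoef m φ (-1)) z) := by
  obtain ⟨M, hM, hb⟩ := exists_bound_eisCoef_term m φ 1
  obtain ⟨M', hM', hb'⟩ := exists_bound_eisCoef_term m φ (-1)
  have e1 : Summable fun n : ℕ => n * ‖qE n z‖ := by
    simpa using polyGrowth_one.summable_mul_norm_qE hz
  have e2 := summable_mul_norm_conjTerm m hz
  have h1 := hasSum_lambert hM hb e1
  have h2 := hasSum_lambert hM' hb' e2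
  have h3 := h1.add h2
  have e3 : conjSer m (eisCoef m φ (-1)) z =
      ∑' n : ℕ, divSum (fun c d => ((c : ℂ) ^ m)⁻¹ * fhat φ c (-1 * d)) n * conjTerm m n z := by
    refine tsum_congr fun n => ?_
    rw [conjTerm, eisCoef]; ring
  rw [e3, qSer, eisCoef]
  convert h3 using 2 with c
  rw [← Summable.tsum_add ((summable_lambert hM hb e1).prod_factor c)
    ((summable_lambert hM' hb' e2).prod_factor c), rowTail, ← tsum_mul_left]
  refine tsum_congr fun n => ?_
  simp only [one_mul, neg_mul]
  ring

lemma qE_affine [NeZero N] (n c r : ℕ) (z : ℂ) :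
    qE n (c * z + r / N) = exp (2 * Real.pi * I * (n : ℤ) * r / N) * qE (c * n) z := by
  rw [qE, qE, ← exp_add]
  congr 1
  push_cast
  ring

lemma conjTerm_affine [NeZero N] (m n c r : ℕ) (z : ℂ) :
    conjTerm m n (c * z + r / N) =
      exp (2 * Real.pi * I * (-(n : ℤ) : ℤ) * r / N) * conjTerm m (c * n) z := by
  have him : (c * z + r / N : ℂ).im = c * z.im := by
    have : (r / N : ℂ) = ((r / N : ℝ) : ℂ) := by push_cast; rfl
    rw [this, add_im, ofReal_im, add_zero]
    simp
  have hc : conj (exp (2 * Real.pi * I * (n : ℤ) * r / N)) =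
      exp (2 * Real.pi * I * (-(n : ℤ) : ℤ) * r / N) := by
    rw [← exp_conj]
    congr 1
    simp only [map_mul, map_div₀, conj_I, conj_ofReal, map_ofNat, conj_natCast, map_intCast]
    push_cast
    ring
  rw [conjTerm, conjTerm, him, qE_affine, map_mul, hc]
  have : 4 * Real.pi * n * (c * z.im) = 4 * Real.pi * ((c * n : ℕ) : ℝ) * z.im := by
    push_cast; ring
  rw [this]
  ring

lemma summable_pnat_qE {w : ℂ} (hw : 0 < w.im) : Summable fun n : ℕ+ => qE n w := by
  have := summable_qE polyGrowth_one hw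
  simp only [one_mul] at this
  exact this.comp_injective PNat.coe_injective

lemma summable_conjTerm (m : ℕ) {w : ℂ} (hw : 0 < w.im) : Summable fun n : ℕ => conjTerm m n w := by
  refine Summable.of_norm ((summable_norm_qE (polyGrowth_expTrunc m hw) hw).congr fun n => ?_)
  rw [conjTerm, norm_mul, norm_mul, RCLike.norm_conj]

lemma qSer_posInd {w : ℂ} (hw : 0 < w.im) : qSer posInd w = ∑' n : ℕ+, qE n w := by
  rw [qSer, ← tsum_zero_pnat_eq_tsum_nat (summable_qE polyGrowth_posInd hw)]
  simp [posInd]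

lemma conjSer_posInd (m : ℕ) {w : ℂ} (hw : 0 < w.im) :
    conjSer m posInd w = ∑' n : ℕ+, conjTerm m n w := by
  rw [conjSer, ← tsum_zero_pnat_eq_tsum_nat (hasSum_conjSer polyGrowth_posInd hw).summable]
  simp [posInd, conjTerm]

/-- The constant `π (-2i)^{1-m}`. -/
def rowConst (m : ℕ) : ℂ := Real.pi * (-2 * I) ^ (1 - (m : ℤ))

/-- The kernel sum with the constant Fourier coefficient removed. -/
lemma tsum_kern' {m : ℕ} (hm : 1 ≤ m) {w : ℂ} (hw : 0 < w.im) :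
    ∑' j : ℤ, kern m (w + j) = rowConst m * ((w.im : ℂ) ^ m)⁻¹ *
      (1 + ∑' n : ℕ+, (qE n w + conjTerm m n w)) := by
  have h2 : Summable fun n : ℕ+ => conjTerm m n w :=
    (summable_conjTerm m hw).comp_injective PNat.coe_injective
  rw [tsum_kern hm hw, qSer_posInd hw, conjSer_posInd m hw, (summable_pnat_qE hw).tsum_add h2,
    rowConst, add_assoc]

lemma affine_im [NeZero N] (c r : ℕ) (z : ℂ) : (c * z + r / N : ℂ).im = c * z.im := by
  have : (r / N : ℂ) = ((r / N : ℝ) : ℂ) := by push_cast; rfl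
  rw [this, add_im, ofReal_im, add_zero]
  simp

lemma affine_im_pos [NeZero N] {c : ℕ} (hc : 1 ≤ c) (r : ℕ) {z : ℂ} (hz : 0 < z.im) :
    0 < (c * z + r / N : ℂ).im := by
  rw [affine_im]
  have : (0 : ℝ) < c := by exact_mod_cast hc
  positivity

lemma rowTail_eq [NeZero N] (m : ℕ) (φ : ZMod N → ZMod N → ℂ) {c : ℕ} (hc : 1 ≤ c) {z : ℂ}
    (hz : 0 < z.im) :
    ∑ r ∈ Finset.range N, φ c r *
      ∑' n : ℕ+, (qE n (c * z + r / N) + conjTerm m n (c * z + r / N)) = rowTail m φ c z := by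
  simp_rw [← tsum_mul_left]
  rw [← Summable.tsum_finsetSum]
  · refine tsum_congr fun n => ?_
    rw [fhat, fhat, Finset.sum_mul, Finset.sum_mul, ← Finset.sum_add_distrib]
    refine Finset.sum_congr rfl fun r _ => ?_
    rw [qE_affine, conjTerm_affine]
    push_cast
    ring
  · intro r _
    have hw := affine_im_pos (N := N) hc r hz
    exact ((summable_pnat_qE hw).add
      ((summable_conjTerm m hw).comp_injective PNat.coe_injective)).mul_left _

/-- The Poisson-type formula is applied in each residue class r. The constant terms add up to the
row sum, and the phases e(±nr/N) assemble into the finite Fourier transform at ±n, the minus sign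
belonging to the conjugated terms. -/
lemma sum_row_kern [NeZero N] {m : ℕ} (hm : 1 ≤ m) (φ : ZMod N → ZMod N → ℂ) {c : ℕ} (hc : 1 ≤ c)
    {z : ℂ} (hz : 0 < z.im) :
    ∑ r ∈ Finset.range N, φ c r * ∑' j : ℤ, kern m (c * z + r / N + j) =
      rowConst m * ((c : ℂ) ^ m)⁻¹ * ((z.im : ℂ) ^ m)⁻¹ * (rowSum φ c + rowTail m φ c z) := by
  rw [← rowTail_eq m φ hc hz, rowSum, ← Finset.sum_add_distrib, Finset.mul_sum]
  refine Finset.sum_congr rfl fun r _ => ?_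
  rw [tsum_kern' hm (affine_im_pos hc r hz), affine_im]
  push_cast
  rw [mul_pow, mul_inv]
  ring

lemma sum_row_inv_pow [NeZero N] {m : ℕ} (hm : 1 ≤ m) (φ : ZMod N → ZMod N → ℂ) {c : ℕ}
    (hc : 1 ≤ c) {z : ℂ} (hz : 0 < z.im) :
    ∑ r ∈ Finset.range N, φ c r * ∑' j : ℤ, ((c * z + r / N + j) ^ (m + 1))⁻¹ =
      (-2 * Real.pi * I) ^ (m + 1) / m.factorial *
        ∑' n : ℕ+, fhat φ c n * ((n : ℂ) ^ m * qE (c * n) z) := by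
  have hL : ∀ r : ℕ, ∑' j : ℤ, ((c * z + r / N + j) ^ (m + 1))⁻¹ =
      (-2 * Real.pi * I) ^ (m + 1) / m.factorial *
        ∑' n : ℕ+, ((n : ℂ) ^ m * qE n (c * z + r / N)) := by
    intro r
    have := EisensteinSeries.qExpansion_identity_pnat hm ⟨_, affine_im_pos (N := N) hc r hz⟩
    simp only [one_div] at this
    rw [this]
    congr 1
    refine tsum_congr fun n => ?_
    rw [qE_eq_pow n, qE]
    simp
  simp_rw [hL, mul_left_comm (φ _ _), ← Finset.mul_sum]
  congr 1
  simp_rw [← tsum_mul_left]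
  rw [← Summable.tsum_finsetSum]
  · refine tsum_congr fun n => ?_
    rw [fhat, Finset.sum_mul]
    refine Finset.sum_congr rfl fun r _ => ?_
    rw [qE_affine]
    push_cast
    ring
  · intro r _
    have := summable_qE (polyGrowth_one.pow_mul m) (affine_im_pos (N := N) hc r hz)
    simp only [mul_one] at this
    exact (this.comp_injective PNat.coe_injective).mul_left _

/-! ### Folding lattice sums -/

lemma tsum_lattice_fold {F : ℤ × ℤ → ℂ} (hF : Summable F) (hev : ∀ p, F (-p) = F p) :
    ∑' p, F p = ∑' d : ℤ, F (0, d) + 2 * ∑' c : ℕ+, ∑' d : ℤ, F (((c : ℕ) : ℤ), d) := by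
  rw [Summable.tsum_prod hF, tsum_int_eq_zero_add_two_mul_tsum_pnat _ hF.prod]
  · simp [two_mul]
  · intro c
    change ∑' d, F (-c, d) = ∑' d, F (c, d)
    rw [← (Equiv.neg ℤ).tsum_eq]
    exact tsum_congr fun d => hev (c, d)

lemma summable_lattice_rpow (z : ℍ) {a : ℝ} (ha : 2 < a) :
    Summable fun p : ℤ × ℤ => ‖(p.1 : ℂ) * z + p.2‖ ^ (-a) := by
  have h1 : Summable fun x : Fin 2 → ℤ => ‖(x 0 : ℂ) * z + x 1‖ ^ (-a) :=
    Summable.of_nonneg_of_le (fun x => by positivity)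
      (fun x => EisensteinSeries.summand_bound z (by linarith) x)
      ((EisensteinSeries.summable_one_div_norm_rpow ha).mul_left _)
  have h2 := (finTwoArrowEquiv ℤ).symm.summable_iff.mpr h1
  exact h2.congr fun p => by simp [finTwoArrowEquiv]

lemma summable_lattice_inv_pow (z : ℍ) {k : ℕ} (hk : 3 ≤ k) :
    Summable fun p : ℤ × ℤ => (‖(p.1 : ℂ) * z + p.2‖ ^ k)⁻¹ := by
  refine (summable_lattice_rpow z (a := k) (by exact_mod_cast hk)).congr fun p => ?_
  rw [Real.rpow_neg (norm_nonneg _), Real.rpow_natCast]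

lemma kern_natCast_mul (m : ℕ) (n : ℕ) (w : ℂ) :
    kern m (n * w) = ((n : ℂ) ^ (m + 1))⁻¹ * kern m w := by
  rw [kern, kern, map_mul, conj_natCast, mul_pow, pow_succ', mul_inv, mul_inv, mul_inv]
  ring

/-- `φ(-c, -d) = (-1)^k φ(c, d)`. -/
def HasParity (k : ℕ) (φ : ZMod N → ZMod N → ℂ) : Prop := ∀ c d, φ (-c) (-d) = (-1) ^ k * φ c d

/-- The coefficient of `y^m` in the Eisenstein series attached to `φ`. -/
def zeroRow (m : ℕ) (φ : ZMod N → ZMod N → ℂ) : ℂ := ∑' d : ℤ, φ 0 d * kern m d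

/-- The Fourier expansion of the (regularized) series `y^m ∑ φ(c,d) (cz+d)⁻¹ conj(cz+d)^{-m}`. -/
def eisFourier [NeZero N] (m : ℕ) (φ : ZMod N → ZMod N → ℂ) (z : ℂ) : ℂ :=
  zeroRow m φ * (z.im : ℂ) ^ m + 2 * rowConst m / N *
    (ZMod.LFunction (rowSum φ) m + (qSer (eisCoef m φ 1) (z / N) +
      conjSer m (eisCoef m φ (-1)) (z / N)))

/-- With d = r + Nj one has cz + d = N (c z/N + r/N + j). This is the origin of the argument z/N in
all the expansions below. -/
lemma tsum_row [NeZero N] (φ : ZMod N → ZMod N → ℂ) {f : ℂ → ℂ} {ν : ℂ}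
    (hf : ∀ w, f (N * w) = ν * f w) (c : ℕ) (z : ℂ) (hs : Summable fun d : ℤ => φ c d * f (c * z + d)) :
    ∑' d : ℤ, φ c d * f (c * z + d) =
      ν * ∑ r ∈ Finset.range N, φ c r * ∑' j : ℤ, f (c * (z / N) + r / N + j) := by
  have hN : (N : ℂ) ≠ 0 := by exact_mod_cast NeZero.ne N
  rw [tsum_int_residues N hs, Finset.mul_sum]
  refine Finset.sum_congr rfl fun r _ => ?_
  rw [← tsum_mul_left, ← tsum_mul_left]
  refine tsum_congr fun j => ?_
  have h1 : (c * z + ((r + N * j : ℤ) : ℂ)) = N * (c * (z / N) + r / N + j) := by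
    push_cast
    field_simp
    ring
  rw [h1, hf]
  push_cast
  simp only [ZMod.natCast_self, zero_mul, add_zero]
  ring

lemma hasSum_LFunction [NeZero N] (Φ : ZMod N → ℂ) {s : ℂ} (hs : 1 < s.re) :
    HasSum (fun c : ℕ+ => Φ (c : ℕ) * ((c : ℕ) : ℂ) ^ (-s)) (ZMod.LFunction Φ s) := by
  have h1 := (ZMod.LSeriesSummable_of_one_lt_re Φ hs).hasSum
  have h2 : ZMod.LFunction Φ s = ∑' n, LSeries.term (Φ ·) s n := ZMod.LFunction_eq_LSeries Φ hs
  rw [h2]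
  rw [← Function.Injective.hasSum_iff PNat.coe_injective] at h1
  · convert h1 using 2 with c
    rw [Function.comp_apply, LSeries.term_of_ne_zero c.ne_zero, cpow_neg, div_eq_mul_inv]
  · intro n hn
    have : n = 0 := by
      by_contra h
      exact hn ⟨⟨n, Nat.pos_of_ne_zero h⟩, rfl⟩
    simp [this]

lemma hasSum_LFunction_nat [NeZero N] (Φ : ZMod N → ℂ) {m : ℕ} (hm : 2 ≤ m) :
    HasSum (fun c : ℕ+ => ((c : ℂ) ^ m)⁻¹ * Φ (c : ℕ)) (ZMod.LFunction Φ m) := by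
  have := hasSum_LFunction Φ (s := m) (by rw [natCast_re]; exact_mod_cast hm)
  convert this using 2 with c
  rw [cpow_neg, cpow_natCast, mul_comm]

lemma kern_neg (m : ℕ) (w : ℂ) : kern m (-w) = (-1) ^ (m + 1) * kern m w := by
  rw [kern, kern, map_neg, neg_pow, inv_neg, mul_inv, ← inv_pow, pow_succ]
  norm_num
  ring

lemma summable_lattice_kern [NeZero N] {m : ℕ} (hm : 2 ≤ m) (φ : ZMod N → ZMod N → ℂ) (z : ℍ) :
    Summable fun p : ℤ × ℤ => φ p.1 p.2 * kern m (p.1 * z + p.2) := by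
  obtain ⟨M, hM, h⟩ := exists_bound_of_zmod φ
  refine Summable.of_norm_bounded ((summable_lattice_inv_pow z (k := m + 1) (by omega)).mul_left M)
    fun p => ?_
  rw [norm_mul, norm_kern]
  gcongr
  exact h _ _

/-- For `m ≥ 2` the Eisenstein series converges absolutely and has the expected expansion. -/
theorem tsum_lattice_kern [NeZero N] {m : ℕ} (hm : 2 ≤ m) {φ : ZMod N → ZMod N → ℂ}
    (hφ : HasParity (m + 1) φ) (z : ℍ) :
    (z.im : ℂ) ^ m * ∑' p : ℤ × ℤ, φ p.1 p.2 * kern m (p.1 * z + p.2) = eisFourier m φ z := by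
  have hN : (N : ℂ) ≠ 0 := by exact_mod_cast NeZero.ne N
  have hy : (z.im : ℂ) ≠ 0 := by exact_mod_cast z.im_ne_zero
  have hF := summable_lattice_kern hm φ z
  have hζ : 0 < ((z : ℂ) / N).im := by
    rw [div_natCast_im]
    have : (0 : ℝ) < N := by exact_mod_cast NeZero.pos N
    have := z.im_pos
    positivity
  rw [tsum_lattice_fold hF]
  · have hrow : ∀ c : ℕ+, ∑' d : ℤ, φ (((c : ℕ) : ℤ) : ZMod N) d * kern m ((((c : ℕ) : ℤ) : ℂ) * z + d) =
        rowConst m / N * ((z.im : ℂ) ^ m)⁻¹ * (((c : ℂ) ^ m)⁻¹ * rowSum φ (c : ℕ) +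
          ((c : ℂ) ^ m)⁻¹ * rowTail m φ c (z / N)) := by
      intro c
      have hs : Summable fun d : ℤ => φ (c : ℕ) d * kern m (((c : ℕ) : ℂ) * z + d) := by
        simpa using hF.prod_factor ((c : ℕ) : ℤ)
      have := tsum_row φ (kern_natCast_mul m N) c z hs
      rw [sum_row_kern (by omega) φ c.pos hζ, div_natCast_im] at this
      simp only [Int.cast_natCast]
      rw [this]
      push_cast
      rw [UpperHalfPlane.coe_im, div_pow]
      field_simp
      ring
    simp only [Int.cast_zero, zero_mul, zero_add]
    rw [tsum_congr hrow, tsum_mul_left, ((hasSum_LFunction_nat (rowSum φ) hm).add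
      (hasSum_rowTail m φ hζ)).tsum_eq, eisFourier, zeroRow, UpperHalfPlane.coe_im]
    field_simp
  · rintro ⟨c, d⟩
    have : ((-(c, d) : ℤ × ℤ).1 * (z : ℂ) + (-(c, d) : ℤ × ℤ).2) = -(c * z + d) := by
      simp; ring
    rw [this, kern_neg]
    simp only [Prod.neg_mk, Int.cast_neg]
    rw [hφ, mul_mul_mul_comm, ← mul_pow]
    norm_num

/-- The holomorphic Eisenstein series for `k = m + 1 ≥ 3`. -/
theorem tsum_lattice_inv_pow [NeZero N] {m : ℕ} (hm : 2 ≤ m) {φ : ZMod N → ZMod N → ℂ}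
    (hφ : HasParity (m + 1) φ) (z : ℍ) :
    ∑' p : ℤ × ℤ, φ p.1 p.2 * ((p.1 * z + p.2 : ℂ) ^ (m + 1))⁻¹ =
      ∑' d : ℤ, φ 0 d * ((d : ℂ) ^ (m + 1))⁻¹ + 2 * ((N : ℂ) ^ (m + 1))⁻¹ *
        ((-2 * Real.pi * I) ^ (m + 1) / m.factorial) *
          qSer (fun n => (n : ℂ) ^ m * eisCoef m φ 1 n) (z / N) := by
  have hN : (N : ℂ) ≠ 0 := by exact_mod_cast NeZero.ne N
  have hF : Summable fun p : ℤ × ℤ => φ p.1 p.2 * ((p.1 * z + p.2 : ℂ) ^ (m + 1))⁻¹ := by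
    refine ((summable_lattice_kern hm φ z).norm.congr fun p => ?_).of_norm
    rw [norm_mul, norm_mul, norm_kern, norm_inv, norm_pow]
  have hζ : 0 < ((z : ℂ) / N).im := by
    rw [div_natCast_im]
    have : (0 : ℝ) < N := by exact_mod_cast NeZero.pos N
    have := z.im_pos
    positivity
  rw [tsum_lattice_fold hF]
  -- Writing n^m = c^(-m) (cn)^m brings the row into Lambert form with the same coefficients
  -- `eisCoef` as in the nonholomorphic series.
  · have hrow : ∀ c : ℕ+, ∑' d : ℤ, φ (((c : ℕ) : ℤ) : ZMod N) d *
          (((((c : ℕ) : ℤ) : ℂ) * z + d) ^ (m + 1))⁻¹ =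
        ((N : ℂ) ^ (m + 1))⁻¹ * ((-2 * Real.pi * I) ^ (m + 1) / m.factorial) *
          ∑' n : ℕ+, ((c : ℂ) ^ m)⁻¹ * fhat φ (c : ℕ) (1 * (n : ℕ)) *
            (((c * n : ℕ) : ℂ) ^ m * qE (c * n) (z / N)) := by
      intro c
      have hs : Summable fun d : ℤ => φ (c : ℕ) d * ((((c : ℕ) : ℂ) * z + d) ^ (m + 1))⁻¹ := by
        simpa using hF.prod_factor ((c : ℕ) : ℤ)
      have := tsum_row φ (f := fun w => (w ^ (m + 1))⁻¹) (ν := ((N : ℂ) ^ (m + 1))⁻¹)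
        (fun w => by rw [mul_pow, mul_inv]) c z hs
      rw [sum_row_inv_pow (by omega) φ c.pos hζ] at this
      simp only [Int.cast_natCast]
      rw [this, ← mul_assoc]
      congr 1
      refine tsum_congr fun n => ?_
      have hc : ((c : ℕ) : ℂ) ≠ 0 := by exact_mod_cast c.ne_zero
      push_cast
      rw [mul_pow, one_mul]
      field_simp
    obtain ⟨M, hM, hb⟩ := exists_bound_eisCoef_term m φ 1
    have hl := hasSum_lambert hM hb
      ((polyGrowth_one.pow_mul m).summable_mul_norm_qE hζ)
    simp only [mul_one] at hl
    simp only [Int.cast_zero, zero_mul, zero_add]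
    have hq : ∑' n : ℕ, divSum (fun c d => ((c : ℂ) ^ m)⁻¹ * fhat φ c (1 * d)) n *
        ((n : ℂ) ^ m * qE n (z / N)) = qSer (fun n => (n : ℂ) ^ m * eisCoef m φ 1 n) (z / N) :=
      tsum_congr fun n => by rw [eisCoef]; ring
    rw [tsum_congr hrow, tsum_mul_left, hl.tsum_eq, hq]
    ring
  · rintro ⟨c, d⟩
    have : ((-(c, d) : ℤ × ℤ).1 * (z : ℂ) + (-(c, d) : ℤ × ℤ).2) = -(c * z + d) := by
      simp; ring
    rw [this, neg_pow, mul_inv]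
    simp only [Prod.neg_mk, Int.cast_neg]
    rw [hφ, mul_mul_mul_comm, ← inv_pow, ← mul_pow]
    norm_num

/-! ### Hecke's trick in weight `2` -/

/-- The kernel `|w|^{-2-2s}`. -/
def heckeKern (s : ℝ) (w : ℂ) : ℝ := ‖w‖ ^ (-(2 + 2 * s))

lemma heckeKern_nonneg (s : ℝ) (w : ℂ) : 0 ≤ heckeKern s w := Real.rpow_nonneg (norm_nonneg _) _

lemma heckeKern_natCast_mul (s : ℝ) (n : ℕ) (w : ℂ) :
    heckeKern s (n * w) = (n : ℝ) ^ (-(2 + 2 * s)) * heckeKern s w := by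
  rw [heckeKern, norm_mul, norm_natCast, Real.mul_rpow (by positivity) (norm_nonneg _), heckeKern]

lemma ofReal_heckeKern_zero (w : ℂ) : (heckeKern 0 w : ℂ) = kern 1 w := by
  have h : heckeKern 0 w = (‖w‖ ^ 2)⁻¹ := by
    rw [heckeKern, mul_zero, add_zero, Real.rpow_neg (norm_nonneg _)]
    norm_cast
  rw [h, kern, pow_one, ← mul_inv, mul_conj, normSq_eq_norm_sq]
  push_cast
  rfl

lemma norm_pos_of_im_pos {w : ℂ} (hw : 0 < w.im) : 0 < ‖w‖ :=
  norm_pos_iff.mpr fun h => by simp [h] at hw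

lemma im_le_norm (w : ℂ) : w.im ≤ ‖w‖ := (le_abs_self _).trans (abs_im_le_norm w)

lemma continuous_heckeKern {w : ℂ} (hw : 0 < w.im) :
    Continuous fun p : ℝ × ℝ => heckeKern p.1 (w + p.2) := by
  unfold heckeKern
  refine Continuous.rpow (by fun_prop) (by fun_prop) fun p => Or.inl ?_
  exact (norm_pos_of_im_pos (by simpa using hw)).ne'

lemma heckeKern_I (s t : ℝ) : heckeKern s (I + t) = (1 + t ^ 2) ^ (-(1 + s)) := by
  have h : ‖I + t‖ = (1 + t ^ 2) ^ (1 / 2 : ℝ) := by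
    rw [← Real.sqrt_eq_rpow, Complex.norm_def]
    congr 1
    simp [normSq_apply]
    ring
  rw [heckeKern, h, ← Real.rpow_mul (by positivity)]
  congr 1
  ring

lemma heckeKern_I_le {s : ℝ} (hs : 0 ≤ s) (t : ℝ) : heckeKern s (I + t) ≤ (1 + t ^ 2)⁻¹ := by
  rw [heckeKern_I, ← Real.rpow_neg_one]
  exact Real.rpow_le_rpow_of_exponent_le (by nlinarith [sq_nonneg t]) (by linarith)

/-- The total mass `∫ |i + t|^{-2-2s} dt`. -/
def heckeMass (s : ℝ) : ℝ := ∫ t : ℝ, heckeKern s (I + t)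

lemma continuous_heckeKern_right (s : ℝ) {w : ℂ} (hw : 0 < w.im) :
    Continuous fun t : ℝ => heckeKern s (w + t) :=
  (continuous_heckeKern hw).comp (by fun_prop : Continuous fun t : ℝ => (s, t))

lemma integrable_heckeKern_I {s : ℝ} (hs : 0 ≤ s) :
    MeasureTheory.Integrable fun t : ℝ => heckeKern s (I + t) := by
  refine integrable_inv_one_add_sq.mono'
    (continuous_heckeKern_right s (by simp)).aestronglyMeasurable (.of_forall fun t => ?_)
  rw [Real.norm_of_nonneg (heckeKern_nonneg _ _)]
  exact heckeKern_I_le hs t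

lemma heckeMass_zero : heckeMass 0 = Real.pi := by
  rw [heckeMass, ← integral_univ_inv_one_add_sq]
  refine MeasureTheory.integral_congr_ae (.of_forall fun t => ?_)
  simp only
  rw [heckeKern_I, add_zero, Real.rpow_neg_one]

lemma tendsto_heckeMass : Tendsto heckeMass (𝓝[>] 0) (𝓝 Real.pi) := by
  rw [← heckeMass_zero]
  unfold heckeMass
  refine MeasureTheory.tendsto_integral_filter_of_dominated_convergence
    (fun t => (1 + t ^ 2)⁻¹) (.of_forall fun s =>
      (continuous_heckeKern_right s (by simp)).aestronglyMeasurable) ?_ integrable_inv_one_add_sq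
    (.of_forall fun t => ?_)
  · filter_upwards [self_mem_nhdsWithin] with s hs
    refine .of_forall fun t => ?_
    rw [Real.norm_of_nonneg (heckeKern_nonneg _ _)]
    exact heckeKern_I_le (le_of_lt hs) t
  · have : Continuous fun s : ℝ => heckeKern s (I + t) :=
      (continuous_heckeKern (by simp)).comp (by fun_prop : Continuous fun s : ℝ => (s, t))
    exact (this.tendsto 0).mono_left nhdsWithin_le_nhds

lemma heckeKern_add_eq (s : ℝ) {w : ℂ} (hw : 0 < w.im) (t : ℝ) :
    heckeKern s (w + t) = w.im ^ (-(2 + 2 * s)) * heckeKern s (I + ((t + w.re) / w.im : ℝ)) := by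
  have h : w + t = (w.im : ℂ) * (I + ((t + w.re) / w.im : ℝ)) := by
    have : (w.im : ℂ) ≠ 0 := by exact_mod_cast hw.ne'
    push_cast
    field_simp
    apply Complex.ext <;> simp
    ring
  rw [h, heckeKern, norm_mul, norm_real, Real.norm_of_nonneg hw.le,
    Real.mul_rpow hw.le (norm_nonneg _), heckeKern]

lemma integrable_heckeKern {s : ℝ} (hs : 0 ≤ s) {w : ℂ} (hw : 0 < w.im) :
    MeasureTheory.Integrable fun t : ℝ => heckeKern s (w + t) := by
  simp_rw [heckeKern_add_eq s hw]
  exact (((integrable_heckeKern_I hs).comp_div hw.ne').comp_add_right w.re).const_mul _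

lemma integral_heckeKern (s : ℝ) {w : ℂ} (hw : 0 < w.im) :
    ∫ t : ℝ, heckeKern s (w + t) = w.im ^ (-(1 + 2 * s)) * heckeMass s := by
  simp_rw [heckeKern_add_eq s hw]
  rw [MeasureTheory.integral_const_mul,
    MeasureTheory.integral_add_right_eq_self (fun t : ℝ => heckeKern s (I + (t / w.im : ℝ))) w.re,
    MeasureTheory.Measure.integral_comp_div (fun t : ℝ => heckeKern s (I + t)) w.im,
    abs_of_pos hw, smul_eq_mul, ← mul_assoc, ← heckeMass]
  congr 1
  nth_rewrite 2 [← Real.rpow_one w.im]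
  rw [← Real.rpow_add hw]
  congr 1
  ring

/-- The kernel with its average over a unit segment removed. -/
def heckeDiff (s : ℝ) (w : ℂ) : ℝ := heckeKern s w - ∫ t in (0 : ℝ)..1, heckeKern s (w + t)

lemma abs_rpow_sub_rpow_le {a x y μ : ℝ} (ha : 0 ≤ a) (hμ : 0 < μ) (hx : μ ≤ x) (hy : μ ≤ y) :
    |x ^ (-a) - y ^ (-a)| ≤ a * μ ^ (-a - 1) * |x - y| := by
  have := (convex_Ici μ).norm_image_sub_le_of_norm_hasDerivWithin_le (f := fun r : ℝ => r ^ (-a))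
    (f' := fun r => (-a) * r ^ (-a - 1)) (C := a * μ ^ (-a - 1)) (x := y) (y := x)
    (fun r hr => (Real.hasDerivAt_rpow_const (Or.inl (hμ.trans_le hr).ne')).hasDerivWithinAt)
    (fun r hr => by
      rw [norm_mul, Real.norm_eq_abs, abs_neg, abs_of_nonneg ha,
        Real.norm_of_nonneg (Real.rpow_nonneg (hμ.le.trans hr) _)]
      have : r ^ (-a - 1) ≤ μ ^ (-a - 1) := Real.rpow_le_rpow_of_nonpos hμ hr (by linarith)
      gcongr) hy hx
  simpa using this

/-- Subtracting the local average gains one power of |w| by the mean value inequality. The bound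
|w|⁻³ is uniform in 0 ≤ s ≤ 1 and summable over the lattice, so these differences can be followed
down to s = 0. -/
lemma abs_heckeDiff_le {v₀ : ℝ} (hv₀ : 0 < v₀) {s : ℝ} (hs : s ∈ Set.Icc (0 : ℝ) 1) {w : ℂ}
    (hw : v₀ ≤ w.im) : |heckeDiff s w| ≤ 4 * (1 + v₀⁻¹) ^ 7 * (‖w‖ ^ 3)⁻¹ := by
  set ρ := 1 + v₀⁻¹ with hρ
  have hρ1 : 1 ≤ ρ := by rw [hρ]; have := inv_pos.mpr hv₀; linarith
  have hρ0 : 0 < ρ := by linarith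
  have hw0 : 0 < w.im := hv₀.trans_le hw
  have hwn : 0 < ‖w‖ := norm_pos_of_im_pos hw0
  have hinv : ‖w‖⁻¹ ≤ ρ := by
    have : ‖w‖⁻¹ ≤ v₀⁻¹ := inv_anti₀ hv₀ (hw.trans (im_le_norm w))
    linarith
  obtain ⟨hs0, hs1⟩ := hs
  have key : ∀ t ∈ Set.uIoc (0 : ℝ) 1, ‖heckeKern s w - heckeKern s (w + t)‖ ≤
      4 * ρ ^ 7 * (‖w‖ ^ 3)⁻¹ := by
    intro t ht
    rw [Set.uIoc_of_le zero_le_one] at ht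
    have ht1 : ‖(t : ℂ)‖ ≤ 1 := by
      rw [norm_real, Real.norm_of_nonneg ht.1.le]; exact ht.2
    have hle : ‖w‖ / ρ ≤ ‖w + t‖ := by
      rw [div_le_iff₀ hρ0]
      have h1 : ‖w‖ ≤ ‖w + t‖ + 1 := by
        have := norm_sub_le (w + t) t
        rw [add_sub_cancel_right] at this
        linarith
      have h2 : v₀ ≤ ‖w + t‖ := by
        refine hw.trans ?_
        have := im_le_norm (w + t)
        simpa using this
      have h3 : 1 ≤ ‖w + t‖ * v₀⁻¹ := by
        rw [← div_eq_mul_inv, le_div_iff₀ hv₀]; linarith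
      rw [hρ, mul_add, mul_one]
      linarith
    have h1 := abs_rpow_sub_rpow_le (a := 2 + 2 * s) (μ := ‖w‖ / ρ) (by linarith) (by positivity)
      (div_le_self hwn.le hρ1) hle
    have h2 : |‖w‖ - ‖w + t‖| ≤ 1 := by
      have := abs_norm_sub_norm_le w (w + t)
      refine this.trans ?_
      simpa using ht1
    -- The exponent 7 is 5 + 2: ρ^(3+2s) ≤ ρ^5, and |w|^(-2s) ≤ ρ^2 because |w|⁻¹ ≤ ρ. The constant
    -- 4 of the final bound comes from 2 + 2s ≤ 4.
    have h3 : (‖w‖ / ρ) ^ (-(2 + 2 * s) - 1) ≤ ρ ^ 7 * (‖w‖ ^ 3)⁻¹ := by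
      have e1 : (‖w‖ / ρ) ^ (-(2 + 2 * s) - 1) =
          ρ ^ (3 + 2 * s) * (‖w‖⁻¹ ^ (2 * s) * (‖w‖ ^ 3)⁻¹) := by
        have : (-(2 + 2 * s) - 1) = -(3 + 2 * s) := by ring
        rw [this, Real.rpow_neg (by positivity), ← Real.inv_rpow (by positivity), inv_div,
          div_eq_mul_inv, Real.mul_rpow hρ0.le (by positivity), add_comm 3 (2 * s),
          Real.rpow_add (inv_pos.mpr hwn)]
        congr 2
        norm_cast
        rw [inv_pow]
      have e2 : ρ ^ (3 + 2 * s) ≤ ρ ^ (5 : ℕ) := by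
        rw [← Real.rpow_natCast]
        exact Real.rpow_le_rpow_of_exponent_le hρ1 (by push_cast; linarith)
      have e3 : ‖w‖⁻¹ ^ (2 * s) ≤ ρ ^ (2 : ℕ) := calc
        ‖w‖⁻¹ ^ (2 * s) ≤ ρ ^ (2 * s) :=
          Real.rpow_le_rpow (by positivity) hinv (by linarith)
        _ ≤ ρ ^ (2 : ℕ) := by
          rw [← Real.rpow_natCast]
          exact Real.rpow_le_rpow_of_exponent_le hρ1 (by push_cast; linarith)
      rw [e1]
      calc _ ≤ ρ ^ 5 * (ρ ^ 2 * (‖w‖ ^ 3)⁻¹) := by gcongr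
        _ = _ := by ring
    rw [Real.norm_eq_abs]
    calc _ ≤ (2 + 2 * s) * (‖w‖ / ρ) ^ (-(2 + 2 * s) - 1) * |‖w‖ - ‖w + t‖| := h1
      _ ≤ 4 * (ρ ^ 7 * (‖w‖ ^ 3)⁻¹) * 1 := by
        gcongr
        linarith
      _ = _ := by ring
  have hint := intervalIntegral.norm_integral_le_of_norm_le_const key
  have heq : heckeDiff s w = ∫ t in (0 : ℝ)..1, (heckeKern s w - heckeKern s (w + t)) := by
    rw [intervalIntegral.integral_sub (by simp)
      ((continuous_heckeKern_right s hw0).intervalIntegrable _ _)]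
    simp [heckeDiff]
  rw [heq, ← Real.norm_eq_abs]
  simpa using hint

lemma tendsto_heckeDiff {w : ℂ} (hw : 0 < w.im) :
    Tendsto (fun s => heckeDiff s w) (𝓝[>] 0) (𝓝 (heckeDiff 0 w)) := by
  have h1 : Continuous fun s : ℝ => heckeKern s w := by
    have : Continuous fun s : ℝ => heckeKern s (w + (0 : ℝ)) :=
      (continuous_heckeKern hw).comp (by fun_prop : Continuous fun s : ℝ => (s, (0 : ℝ)))
    simpa using this
  have h2 : Continuous fun s : ℝ => ∫ t in (0 : ℝ)..1, heckeKern s (w + t) :=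
    intervalIntegral.continuous_parametric_intervalIntegral_of_continuous'
      (continuous_heckeKern hw) 0 1
  exact ((h1.sub h2).tendsto 0).mono_left nhdsWithin_le_nhds

lemma summable_heckeDiff {s : ℝ} (hs : s ∈ Set.Icc (0 : ℝ) 1) {w : ℂ} (hw : 0 < w.im) :
    Summable fun j : ℤ => heckeDiff s (w + j) := by
  refine Summable.of_norm_bounded (((summable_inv_pow_add_int w (k := 3)
    (by norm_num)).norm).mul_left (4 * (1 + w.im⁻¹) ^ 7)) fun j => ?_
  have := abs_heckeDiff_le hw hs (w := w + j) (by simp)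
  rw [norm_inv, norm_pow]
  exact this

lemma hasSum_segments {s : ℝ} (hs : 0 ≤ s) {w : ℂ} (hw : 0 < w.im) :
    HasSum (fun j : ℤ => ∫ t in (0 : ℝ)..1, heckeKern s (w + j + t))
      (w.im ^ (-(1 + 2 * s)) * heckeMass s) := by
  rw [← integral_heckeKern s hw]
  refine (integrable_heckeKern hs hw).hasSum_intervalIntegral_comp_add_int.congr_fun fun j => ?_
  refine intervalIntegral.integral_congr fun t _ => ?_
  congr 1
  push_cast
  ring

/-- The unit segments tile the real line, so the subtracted averages add up to the full integral.
Its dependence on the row is the explicit power c^(-(1+2s)), which sums over c to an L-function. -/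
lemma tsum_heckeKern {s : ℝ} (hs : s ∈ Set.Icc (0 : ℝ) 1) {w : ℂ} (hw : 0 < w.im) :
    ∑' j : ℤ, heckeKern s (w + j) =
      ∑' j : ℤ, heckeDiff s (w + j) + w.im ^ (-(1 + 2 * s)) * heckeMass s := by
  rw [← (hasSum_segments hs.1 hw).tsum_eq,
    ← (summable_heckeDiff hs hw).tsum_add (hasSum_segments hs.1 hw).summable]
  exact tsum_congr fun j => by simp [heckeDiff]

lemma heckeKern_neg (s : ℝ) (w : ℂ) : heckeKern s (-w) = heckeKern s w := by
  rw [heckeKern, norm_neg, heckeKern]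

lemma summable_lattice_hecke [NeZero N] {s : ℝ} (hs : 0 < s) (φ : ZMod N → ZMod N → ℂ) (z : ℍ) :
    Summable fun p : ℤ × ℤ => φ p.1 p.2 * (heckeKern s (p.1 * z + p.2) : ℂ) := by
  obtain ⟨M, hM, h⟩ := exists_bound_of_zmod φ
  refine Summable.of_norm_bounded ((summable_lattice_rpow z (a := 2 + 2 * s) (by linarith)).mul_left M)
    fun p => ?_
  rw [norm_mul, norm_real, Real.norm_of_nonneg (heckeKern_nonneg _ _)]
  exact mul_le_mul_of_nonneg_right (h _ _) (heckeKern_nonneg _ _)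

lemma div_natCast_im_pos [NeZero N] (z : ℍ) : 0 < ((z : ℂ) / N).im := by
  rw [div_natCast_im]
  have : (0 : ℝ) < N := by exact_mod_cast NeZero.pos N
  have := z.im_pos
  positivity

/-- The sum over the nonzero rows of the differences `heckeDiff`. -/
def heckeRest [NeZero N] (φ : ZMod N → ZMod N → ℂ) (s : ℝ) (ζ : ℂ) : ℂ :=
  ∑' p : ℕ+ × ℤ, ∑ r ∈ Finset.range N,
    φ (p.1 : ℕ) r * (heckeDiff s ((p.1 : ℕ) * ζ + r / N + p.2) : ℂ)

/-- A summable majorant of the terms of `heckeRest`. -/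
def heckeBound (N : ℕ) (M : ℝ) (ζ : ℂ) (p : ℕ+ × ℤ) : ℝ :=
  ∑ r ∈ Finset.range N,
    M * (4 * (1 + ζ.im⁻¹) ^ 7 * (‖((p.1 : ℕ) * ζ + r / N + p.2 : ℂ)‖ ^ 3)⁻¹)

lemma summable_heckeBound [NeZero N] (M : ℝ) (z : ℍ) :
    Summable (heckeBound N M (z / N)) := by
  have hN : (N : ℂ) ≠ 0 := by exact_mod_cast NeZero.ne N
  unfold heckeBound
  refine summable_sum fun r _ => ?_
  refine (Summable.mul_left _ ?_).mul_left _
  have h1 := summable_lattice_inv_pow z (k := 3) le_rfl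
  -- After scaling by N the point c z/N + r/N + j is the lattice point cz + (r + Nj); distinct (c,
  -- j) give distinct lattice points, so the convergent sum of |cz+d|⁻³ dominates.
  have hinj : Function.Injective fun p : ℕ+ × ℤ => (((p.1 : ℕ) : ℤ), (r : ℤ) + N * p.2) := by
    rintro ⟨c, j⟩ ⟨c', j'⟩ h
    simpa [NeZero.ne N] using h
  refine ((h1.comp_injective hinj).mul_left ((N : ℝ) ^ 3)).congr fun p => ?_
  have h2 : (((p.1 : ℕ) : ℤ) : ℂ) * z + ((r + N * p.2 : ℤ) : ℂ) =
      N * ((p.1 : ℕ) * (z / N) + r / N + p.2) := by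
    push_cast
    field_simp
    ring
  simp only [Function.comp_apply]
  rw [h2, norm_mul, Complex.norm_natCast, mul_pow, mul_inv]
  have hN' : (N : ℝ) ≠ 0 := by exact_mod_cast NeZero.ne N
  field_simp

lemma norm_heckeRest_term_le [NeZero N] {φ : ZMod N → ZMod N → ℂ} {M : ℝ} (hM : 0 ≤ M)
    (hφ : ∀ c d, ‖φ c d‖ ≤ M) {s : ℝ} (hs : s ∈ Set.Icc (0 : ℝ) 1) {ζ : ℂ} (hζ : 0 < ζ.im)
    (p : ℕ+ × ℤ) :
    ‖∑ r ∈ Finset.range N, φ (p.1 : ℕ) r * (heckeDiff s ((p.1 : ℕ) * ζ + r / N + p.2) : ℂ)‖ ≤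
      heckeBound N M ζ p := by
  refine (norm_sum_le _ _).trans (Finset.sum_le_sum fun r _ => ?_)
  rw [norm_mul, norm_real, Real.norm_eq_abs]
  have him : ζ.im ≤ ((p.1 : ℕ) * ζ + r / N + p.2 : ℂ).im := by
    rw [add_im, affine_im, intCast_im, add_zero]
    have : (1 : ℝ) ≤ (p.1 : ℕ) := by exact_mod_cast p.1.pos
    nlinarith
  exact mul_le_mul (hφ _ _) (abs_heckeDiff_le hζ hs him) (abs_nonneg _) hM

lemma tsum_heckeRest [NeZero N] (φ : ZMod N → ZMod N → ℂ) {s : ℝ} (hs : s ∈ Set.Icc (0 : ℝ) 1)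
    (z : ℍ) :
    HasSum (fun c : ℕ+ => ∑ r ∈ Finset.range N, φ (c : ℕ) r *
      ∑' j : ℤ, (heckeDiff s ((c : ℕ) * (z / N) + r / N + j) : ℂ)) (heckeRest φ s (z / N)) := by
  obtain ⟨M, hM, h⟩ := exists_bound_of_zmod φ
  have hζ := div_natCast_im_pos (N := N) z
  have hsum : Summable fun p : ℕ+ × ℤ => ∑ r ∈ Finset.range N,
      φ (p.1 : ℕ) r * (heckeDiff s ((p.1 : ℕ) * (z / N) + r / N + p.2) : ℂ) :=
    Summable.of_norm_bounded (summable_heckeBound M z) (norm_heckeRest_term_le hM h hs hζ)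
  have h1 := hsum.hasSum.prod_fiberwise fun c => (hsum.prod_factor c).hasSum
  refine h1.congr_fun fun c => ?_
  have h2 : ∀ r : ℕ, Summable fun j : ℤ =>
      (heckeDiff s ((c : ℕ) * (z / N) + r / N + j) : ℂ) := fun r =>
    (hasSum_ofReal.mpr (summable_heckeDiff hs (affine_im_pos (N := N) c.pos r hζ)).hasSum).summable
  change _ = ∑' j : ℤ, ∑ r ∈ Finset.range N,
    φ (c : ℕ) r * (heckeDiff s ((c : ℕ) * (z / N) + r / N + j) : ℂ)
  rw [Summable.tsum_finsetSum fun r _ => (h2 r).mul_left _]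
  exact Finset.sum_congr rfl fun r _ => tsum_mul_left.symm

lemma tendsto_heckeRest [NeZero N] (φ : ZMod N → ZMod N → ℂ) (z : ℍ) :
    Tendsto (fun s => heckeRest φ s (z / N)) (𝓝[>] 0) (𝓝 (heckeRest φ 0 (z / N))) := by
  obtain ⟨M, hM, h⟩ := exists_bound_of_zmod φ
  have hζ := div_natCast_im_pos (N := N) z
  refine tendsto_tsum_of_dominated_convergence (summable_heckeBound (N := N) M z) (fun p => ?_) ?_
  · refine tendsto_finsetSum _ fun r _ => Tendsto.const_mul _ ?_
    refine (continuous_ofReal.tendsto _).comp (tendsto_heckeDiff ?_)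
    rw [add_im, intCast_im, add_zero]
    exact affine_im_pos (N := N) p.1.pos r hζ
  · filter_upwards [Ioo_mem_nhdsGT zero_lt_one] with s hs p
    exact norm_heckeRest_term_le hM h ⟨hs.1.le, hs.2.le⟩ hζ p

/-- At s = 0 each row sum is known in two ways: from the Poisson-type formula, and as the sum of
differences plus the total mass π/(c Im(z/N)). The mass accounts exactly for the constant Fourier
term, so the differences give the remaining part of the row. -/
lemma heckeRest_zero [NeZero N] (φ : ZMod N → ZMod N → ℂ) (z : ℍ) :
    heckeRest φ 0 (z / N) = Real.pi * (((z : ℂ) / N).im : ℂ)⁻¹ *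
      (qSer (eisCoef 1 φ 1) (z / N) + conjSer 1 (eisCoef 1 φ (-1)) (z / N)) := by
  have hζ := div_natCast_im_pos (N := N) z
  have h1 := tsum_heckeRest φ (s := 0) (by simp) z
  have h2 := (hasSum_rowTail 1 φ hζ).mul_left (Real.pi * (((z : ℂ) / N).im : ℂ)⁻¹)
  refine h1.unique (h2.congr_fun fun c => ?_)
  have hrow := sum_row_kern le_rfl φ (c := c) c.pos hζ
  have hd : ∀ r : ℕ, ∑' j : ℤ, kern 1 ((c : ℕ) * (z / N) + r / N + j) =
      ∑' j : ℤ, (heckeDiff 0 ((c : ℕ) * (z / N) + r / N + j) : ℂ) +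
        Real.pi * (((c : ℕ) : ℂ) * (((z : ℂ) / N).im : ℂ))⁻¹ := by
    intro r
    have h3 := tsum_heckeKern (s := 0) (by simp) (affine_im_pos (N := N) c.pos r hζ)
    simp_rw [← ofReal_heckeKern_zero]
    rw [← ofReal_tsum, ← ofReal_tsum, h3, heckeMass_zero, mul_zero, add_zero, Real.rpow_neg_one,
      affine_im]
    push_cast
    ring
  simp_rw [hd, mul_add, Finset.sum_add_distrib, ← Finset.sum_mul] at hrow
  rw [← rowSum] at hrow
  rw [eq_sub_of_add_eq hrow, rowConst]
  simp only [pow_one, Nat.cast_one, sub_self, zpow_zero]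
  rw [mul_inv]
  ring

/-- The part of the Hecke-regularized series coming from a nonzero row. -/
lemma tsum_row_hecke [NeZero N] {s : ℝ} (hs : s ∈ Set.Ioo (0 : ℝ) 1) (φ : ZMod N → ZMod N → ℂ)
    (z : ℍ) (c : ℕ+) :
    ∑' d : ℤ, φ (c : ℕ) d * (heckeKern s ((c : ℕ) * z + d) : ℂ) =
      (((N : ℝ) ^ (-(2 + 2 * s)) : ℝ) : ℂ) * (∑ r ∈ Finset.range N, φ (c : ℕ) r *
        ∑' j : ℤ, (heckeDiff s ((c : ℕ) * (z / N) + r / N + j) : ℂ) +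
      ((((z : ℂ) / N).im ^ (-(1 + 2 * s)) * heckeMass s : ℝ) : ℂ) *
        (rowSum φ (c : ℕ) * ((c : ℕ) : ℂ) ^ (-((1 + 2 * s : ℝ) : ℂ)))) := by
  have hζ := div_natCast_im_pos (N := N) z
  have hs' : s ∈ Set.Icc (0 : ℝ) 1 := ⟨hs.1.le, hs.2.le⟩
  have hsum : Summable fun d : ℤ => φ (c : ℕ) d * (heckeKern s ((c : ℕ) * z + d) : ℂ) := by
    simpa using (summable_lattice_hecke hs.1 φ z).prod_factor ((c : ℕ) : ℤ)
  rw [tsum_row φ (f := fun w => (heckeKern s w : ℂ)) (ν := (((N : ℝ) ^ (-(2 + 2 * s)) : ℝ) : ℂ))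
    (fun w => by rw [heckeKern_natCast_mul]; push_cast; rfl) c z hsum]
  congr 1
  rw [rowSum, Finset.sum_mul, Finset.mul_sum, ← Finset.sum_add_distrib]
  refine Finset.sum_congr rfl fun r _ => ?_
  have hw := affine_im_pos (N := N) c.pos r hζ
  have h1 := tsum_heckeKern hs' hw
  have h2 : (∑' j : ℤ, (heckeKern s ((c : ℕ) * (z / N) + r / N + j) : ℂ)) =
      ((∑' j : ℤ, heckeKern s ((c : ℕ) * (z / N) + r / N + j) : ℝ) : ℂ) := (ofReal_tsum _).symm
  have h3 : (∑' j : ℤ, (heckeDiff s ((c : ℕ) * (z / N) + r / N + j) : ℂ)) =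
      ((∑' j : ℤ, heckeDiff s ((c : ℕ) * (z / N) + r / N + j) : ℝ) : ℂ) := (ofReal_tsum _).symm
  have h4 : ((c : ℕ) : ℂ) ^ (-((1 + 2 * s : ℝ) : ℂ)) = ((((c : ℕ) : ℝ) ^ (-(1 + 2 * s)) : ℝ) : ℂ) := by
    rw [ofReal_cpow (by positivity)]
    push_cast
    rfl
  rw [h2, h3, h1, h4, affine_im, Real.mul_rpow (by positivity) hζ.le]
  push_cast
  ring

lemma tsum_lattice_hecke [NeZero N] {s : ℝ} (hs : s ∈ Set.Ioo (0 : ℝ) 1) {φ : ZMod N → ZMod N → ℂ}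
    (hφ : HasParity 2 φ) (z : ℍ) :
    ∑' p : ℤ × ℤ, φ p.1 p.2 * (heckeKern s (p.1 * z + p.2) : ℂ) =
      ∑' d : ℤ, φ 0 d * (heckeKern s d : ℂ) + 2 * ((((N : ℝ) ^ (-(2 + 2 * s)) : ℝ) : ℂ) *
        (heckeRest φ s (z / N) + ((((z : ℂ) / N).im ^ (-(1 + 2 * s)) * heckeMass s : ℝ) : ℂ) *
          ZMod.LFunction (rowSum φ) ((1 + 2 * s : ℝ) : ℂ))) := by
  rw [tsum_lattice_fold (summable_lattice_hecke hs.1 φ z)]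
  · simp only [Int.cast_natCast, Int.cast_zero, zero_mul, zero_add]
    have hL := hasSum_LFunction (rowSum φ) (s := ((1 + 2 * s : ℝ) : ℂ))
      (by rw [ofReal_re]; linarith [hs.1])
    have h1 := ((tsum_heckeRest φ (s := s) ⟨hs.1.le, hs.2.le⟩ z).add
      (hL.mul_left ((((z : ℂ) / N).im ^ (-(1 + 2 * s)) * heckeMass s : ℝ) : ℂ))).mul_left
        (((N : ℝ) ^ (-(2 + 2 * s)) : ℝ) : ℂ)
    rw [← h1.tsum_eq]
    congr 2
    exact tsum_congr fun c => tsum_row_hecke hs φ z c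
  · rintro ⟨c, d⟩
    have : ((-(c, d) : ℤ × ℤ).1 * (z : ℂ) + (-(c, d) : ℤ × ℤ).2) = -(c * z + d) := by
      simp; ring
    rw [this, heckeKern_neg]
    simp only [Prod.neg_mk, Int.cast_neg]
    rw [hφ]
    norm_num

lemma tendsto_zeroRow_hecke [NeZero N] (φ : ZMod N → ZMod N → ℂ) :
    Tendsto (fun s => ∑' d : ℤ, φ 0 d * (heckeKern s d : ℂ)) (𝓝[>] 0) (𝓝 (zeroRow 1 φ)) := by
  obtain ⟨M, hM, h⟩ := exists_bound_of_zmod φ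
  have hb := (summable_inv_pow_add_int 0 (k := 2) le_rfl).norm.mul_left M
  refine tendsto_tsum_of_dominated_convergence hb (fun d => ?_) ?_
  · rw [← ofReal_heckeKern_zero]
    refine Tendsto.const_mul _ ((continuous_ofReal.tendsto _).comp ?_)
    rcases eq_or_ne d 0 with rfl | hd
    -- The real power of 0 with nonzero exponent is 0, so the term d = 0 vanishes both for s > 0 and
    -- in the limit.
    · refine Tendsto.congr' (f₁ := fun _ => (0 : ℝ)) ?_ ?_
      · filter_upwards [self_mem_nhdsWithin] with s hs
        have : (0 : ℝ) < s := hs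
        rw [heckeKern, Int.cast_zero, norm_zero, Real.zero_rpow (by linarith)]
      · rw [heckeKern, Int.cast_zero, norm_zero, Real.zero_rpow (by norm_num)]
        exact tendsto_const_nhds
    · have : Continuous fun s : ℝ => heckeKern s d := by
        unfold heckeKern
        refine Continuous.rpow continuous_const (by fun_prop) fun s => Or.inl ?_
        simpa using hd
      exact (this.tendsto 0).mono_left nhdsWithin_le_nhds
  · filter_upwards [self_mem_nhdsWithin] with s hs d
    have hs' : (0 : ℝ) < s := hs
    rw [norm_mul, norm_real, Real.norm_of_nonneg (heckeKern_nonneg _ _), zero_add]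
    refine mul_le_mul (h _ _) ?_ (heckeKern_nonneg _ _) hM
    rcases eq_or_ne d 0 with rfl | hd
    · rw [heckeKern, Int.cast_zero, norm_zero, Real.zero_rpow (by linarith)]
      simp
    · have h1 : (1 : ℝ) ≤ ‖(d : ℂ)‖ := by
        rw [norm_intCast]
        exact_mod_cast Int.one_le_abs hd
      rw [heckeKern, norm_inv, norm_pow, ← Real.rpow_natCast, ← Real.rpow_neg (by positivity)]
      exact Real.rpow_le_rpow_of_exponent_le h1 (by push_cast; linarith)

/-- Hecke's trick: the regularized weight-`2`-type series tends to its Fourier expansion. -/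
theorem tendsto_lattice_hecke [NeZero N] {φ : ZMod N → ZMod N → ℂ} (hφ : HasParity 2 φ)
    (hsum : ∑ c : ZMod N, rowSum φ c = 0) (z : ℍ) :
    Tendsto (fun s : ℝ => ((z.im ^ (1 + s) : ℝ) : ℂ) *
      ∑' p : ℤ × ℤ, φ p.1 p.2 * (heckeKern s (p.1 * z + p.2) : ℂ)) (𝓝[>] 0)
      (𝓝 (eisFourier 1 φ z)) := by
  have hN : (N : ℝ) ≠ 0 := by exact_mod_cast NeZero.ne N
  have hN0 : (0 : ℝ) < N := by exact_mod_cast NeZero.pos N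
  have hζ := div_natCast_im_pos (N := N) z
  -- Vanishing of the total sum of φ makes this L-function entire, so there is no pole at 1; in
  -- weight 2 this is where χ ≠ 1 is needed.
  have hL : Tendsto (fun s : ℝ => ZMod.LFunction (rowSum φ) ((1 + 2 * s : ℝ) : ℂ)) (𝓝[>] 0)
      (𝓝 (ZMod.LFunction (rowSum φ) 1)) := by
    have hc : Continuous fun s : ℝ => ZMod.LFunction (rowSum φ) ((1 + 2 * s : ℝ) : ℂ) :=
      (ZMod.differentiable_LFunction_of_sum_zero hsum).continuous.comp (by fun_prop)
    have := hc.tendsto 0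
    simp only [mul_zero, add_zero, ofReal_one] at this
    exact this.mono_left nhdsWithin_le_nhds
  have hpow : ∀ {x : ℝ} (a b : ℝ), 0 < x → Tendsto (fun s : ℝ => x ^ (a + b * s)) (𝓝[>] 0)
      (𝓝 (x ^ a)) := by
    intro x a b hx
    have hc : Continuous fun s : ℝ => x ^ (a + b * s) :=
      Continuous.rpow continuous_const (by fun_prop) fun s => Or.inl hx.ne'
    have := hc.tendsto 0
    simp only [mul_zero, add_zero] at this
    exact this.mono_left nhdsWithin_le_nhds
  have hy := (continuous_ofReal.tendsto _).comp (hpow 1 1 z.im_pos)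
  have hNp := (continuous_ofReal.tendsto _).comp (hpow (-2) (-2) hN0)
  have hηB := (continuous_ofReal.tendsto _).comp ((hpow (-1) (-2) hζ).mul tendsto_heckeMass)
  have hall := hy.mul ((tendsto_zeroRow_hecke φ).add
    ((hNp.mul ((tendsto_heckeRest φ z).add (hηB.mul hL))).const_mul 2))
  have hlim : eisFourier 1 φ z = ((z.im ^ (1 : ℝ) : ℝ) : ℂ) * (zeroRow 1 φ +
      2 * ((((N : ℝ) ^ (-2 : ℝ) : ℝ) : ℂ) * (heckeRest φ 0 (z / N) +
        (((((z : ℂ) / N).im ^ (-1 : ℝ) * Real.pi : ℝ)) : ℂ) *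
          ZMod.LFunction (rowSum φ) 1))) := by
    have hNc : (N : ℂ) ≠ 0 := by exact_mod_cast NeZero.ne N
    have hyc : (z.im : ℂ) ≠ 0 := by exact_mod_cast z.im_ne_zero
    have e1 : (N : ℝ) ^ (-2 : ℝ) = ((N : ℝ) ^ 2)⁻¹ := by
      rw [Real.rpow_neg hN0.le]; norm_cast
    rw [heckeRest_zero, Real.rpow_one, Real.rpow_neg_one, e1, eisFourier, rowConst, div_natCast_im,
      UpperHalfPlane.coe_im]
    push_cast
    simp only [zpow_zero, pow_one]
    field_simp
    ring
  rw [hlim]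
  refine hall.congr' ?_
  filter_upwards [Ioo_mem_nhdsGT zero_lt_one] with s hs
  rw [tsum_lattice_hecke hs hφ]
  simp only [Function.comp_apply, one_mul]
  have e2 : -(2 + 2 * s) = -2 + -2 * s := by ring
  have e3 : -(1 + 2 * s) = -1 + -2 * s := by ring
  rw [e2, e3]

/-! ### The action of SL₂(ℤ) and growth at the cusps -/

/-- The action of `SL₂(ℤ)` on functions of rows modulo `N`, `(γφ)(p) = φ(p γ⁻¹)`. -/
def rowAct (γ : SL(2, ℤ)) (φ : ZMod N → ZMod N → ℂ) (c d : ZMod N) : ℂ :=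
  φ (c * (γ 1 1 : ℤ) - d * (γ 1 0 : ℤ)) (d * (γ 0 0 : ℤ) - c * (γ 0 1 : ℤ))

lemma det_entries (γ : SL(2, ℤ)) : γ 0 0 * γ 1 1 - γ 0 1 * γ 1 0 = 1 := by
  rw [← Matrix.det_fin_two, γ.det_coe]

/-- Right multiplication of rows over a commutative ring by `γ`. -/
def rowEquiv (R : Type*) [CommRing R] (γ : SL(2, ℤ)) : R × R ≃ R × R where
  toFun p := (p.1 * (γ 0 0 : ℤ) + p.2 * (γ 1 0 : ℤ), p.1 * (γ 0 1 : ℤ) + p.2 * (γ 1 1 : ℤ))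
  invFun p := (p.1 * (γ 1 1 : ℤ) - p.2 * (γ 1 0 : ℤ), p.2 * (γ 0 0 : ℤ) - p.1 * (γ 0 1 : ℤ))
  left_inv p := by
    have h : ((γ 0 0 : ℤ) : R) * (γ 1 1 : ℤ) - (γ 0 1 : ℤ) * (γ 1 0 : ℤ) = 1 := by
      exact_mod_cast congrArg (Int.cast : ℤ → R) (det_entries γ)
    ext
    · linear_combination p.1 * h
    · linear_combination p.2 * h
  right_inv p := by
    have h : ((γ 0 0 : ℤ) : R) * (γ 1 1 : ℤ) - (γ 0 1 : ℤ) * (γ 1 0 : ℤ) = 1 := by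
      exact_mod_cast congrArg (Int.cast : ℤ → R) (det_entries γ)
    ext
    · linear_combination p.1 * h
    · linear_combination p.2 * h

lemma rowAct_rowEquiv (γ : SL(2, ℤ)) (φ : ZMod N → ZMod N → ℂ) (p : ZMod N × ZMod N) :
    rowAct γ φ (rowEquiv _ γ p).1 (rowEquiv _ γ p).2 = φ p.1 p.2 := by
  have h := (rowEquiv (ZMod N) γ).left_inv p
  exact congrArg (fun q : ZMod N × ZMod N => φ q.1 q.2) h

lemma rowAct_rowEquiv_int (γ : SL(2, ℤ)) (φ : ZMod N → ZMod N → ℂ) (p : ℤ × ℤ) :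
    rowAct γ φ (rowEquiv ℤ γ p).1 (rowEquiv ℤ γ p).2 = φ p.1 p.2 := by
  rw [← rowAct_rowEquiv γ φ ((p.1 : ZMod N), (p.2 : ZMod N))]
  simp [rowEquiv]

lemma HasParity.rowAct {k : ℕ} {φ : ZMod N → ZMod N → ℂ} (h : HasParity k φ) (γ : SL(2, ℤ)) :
    HasParity k (rowAct γ φ) := fun c d => by
  simp only [MockEisenstein.rowAct]
  rw [← h]
  congr 1 <;> ring

lemma sum_range_natCast [NeZero N] (f : ZMod N → ℂ) :
    ∑ r ∈ Finset.range N, f r = ∑ x : ZMod N, f x :=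
  Finset.sum_nbij' (fun r => (r : ZMod N)) ZMod.val (by simp)
    (fun x _ => Finset.mem_range.mpr x.val_lt)
    (fun r hr => ZMod.val_cast_of_lt (Finset.mem_range.mp hr)) (by simp) (by simp)

lemma sum_rowSum [NeZero N] (φ : ZMod N → ZMod N → ℂ) :
    ∑ c : ZMod N, rowSum φ c = ∑ p : ZMod N × ZMod N, φ p.1 p.2 := by
  rw [Fintype.sum_prod_type]
  refine Finset.sum_congr rfl fun c _ => sum_range_natCast _

lemma sum_rowSum_rowAct [NeZero N] (φ : ZMod N → ZMod N → ℂ) (γ : SL(2, ℤ)) :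
    ∑ c : ZMod N, rowSum (rowAct γ φ) c = ∑ c : ZMod N, rowSum φ c := by
  rw [sum_rowSum, sum_rowSum, ← (rowEquiv (ZMod N) γ).sum_comp]
  exact Finset.sum_congr rfl fun p _ => rowAct_rowEquiv γ φ p

lemma rowEquiv_linear (γ : SL(2, ℤ)) (p : ℤ × ℤ) (z : ℍ) :
    (p.1 * ((γ • z : ℍ) : ℂ) + p.2 : ℂ) =
      ((rowEquiv ℤ γ p).1 * (z : ℂ) + (rowEquiv ℤ γ p).2) / UpperHalfPlane.denom γ z := by
  have h := UpperHalfPlane.denom_ne_zero γ z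
  rw [UpperHalfPlane.specialLinearGroup_apply, eq_div_iff h]
  rw [ModularGroup.denom_apply] at h ⊢
  simp only [algebraMap_int_eq, Int.coe_castRingHom, ofReal_intCast]
  rw [add_mul, mul_assoc, div_mul_cancel₀ _ h]
  simp [rowEquiv]
  ring

lemma kern_div (m : ℕ) (w J : ℂ) : kern m (w / J) = J * conj J ^ m * kern m w := by
  simp only [kern, map_div₀, div_pow, inv_div]
  ring

lemma heckeKern_div (s : ℝ) (w J : ℂ) :
    heckeKern s (w / J) = (‖J‖ ^ 2) ^ (1 + s) * heckeKern s w := by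
  rw [heckeKern, heckeKern, norm_div, Real.div_rpow (norm_nonneg _) (norm_nonneg _),
    Real.rpow_neg (norm_nonneg J), div_inv_eq_mul, mul_comm, ← Real.rpow_natCast,
    ← Real.rpow_mul (norm_nonneg _)]
  congr 2
  push_cast
  ring

lemma tsum_lattice_smul (γ : SL(2, ℤ)) (φ : ZMod N → ZMod N → ℂ) (f : ℂ → ℂ) (z : ℍ) :
    ∑' p : ℤ × ℤ, φ p.1 p.2 * f (p.1 * ((γ • z : ℍ) : ℂ) + p.2) =
      ∑' p : ℤ × ℤ, rowAct γ φ p.1 p.2 *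
        f ((p.1 * (z : ℂ) + p.2) / UpperHalfPlane.denom γ z) := by
  refine (tsum_congr fun p => ?_).trans ((rowEquiv ℤ γ).tsum_eq fun p => rowAct γ φ p.1 p.2 *
    f ((p.1 * (z : ℂ) + p.2) / UpperHalfPlane.denom γ z))
  rw [rowAct_rowEquiv_int, rowEquiv_linear]

/-- Right multiplication by γ permutes the lattice rows. With J the automorphy factor, the kernel
scales by J conj(J)^m and y^m by |J|^(-2m), leaving J^(1-m). For m = 1 the factor y^(1+s) makes the
same argument exact for every s > 0, and the identity passes to the limit; the vanishing of the
total sum is preserved because γ permutes the residue pairs. -/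
theorem eisFourier_slash [NeZero N] {m : ℕ} (hm : 1 ≤ m) {φ : ZMod N → ZMod N → ℂ}
    (hφ : HasParity (m + 1) φ) (hsum : m = 1 → ∑ c : ZMod N, rowSum φ c = 0) (γ : SL(2, ℤ))
    (z : ℍ) :
    ((fun z : ℍ => eisFourier m φ z) ∣[1 - (m : ℤ)] γ) z = eisFourier m (rowAct γ φ) z := by
  have hJ := UpperHalfPlane.denom_ne_zero γ z
  have him := ModularGroup.im_smul_eq_div_normSq γ z
  rw [ModularForm.SL_slash_apply]
  set J := UpperHalfPlane.denom γ z with hJdef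
  rcases hm.eq_or_lt with rfl | hm
  · simp only [Nat.cast_one, sub_self, neg_zero, zpow_zero, mul_one]
    have h1 := tendsto_lattice_hecke hφ (hsum rfl) (γ • z)
    have h2 := tendsto_lattice_hecke (hφ.rowAct γ) ((sum_rowSum_rowAct φ γ).trans (hsum rfl)) z
    refine tendsto_nhds_unique h1 (h2.congr fun s => ?_)
    rw [tsum_lattice_smul γ φ (fun w => (heckeKern s w : ℂ)), ← hJdef]
    simp_rw [heckeKern_div, ofReal_mul, mul_left_comm _ (((‖J‖ ^ 2) ^ (1 + s) : ℝ) : ℂ)]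
    rw [tsum_mul_left, ← mul_assoc, ← ofReal_mul, him, normSq_eq_norm_sq,
      Real.div_rpow z.im_pos.le (by positivity), div_mul_cancel₀]
    exact (Real.rpow_pos_of_pos (by positivity) _).ne'
  · rw [← tsum_lattice_kern hm hφ, ← tsum_lattice_kern hm (hφ.rowAct γ),
      tsum_lattice_smul γ φ (kern m), ← hJdef]
    simp_rw [kern_div, mul_left_comm _ (J * conj J ^ m)]
    rw [tsum_mul_left, him, ofReal_div, normSq_eq_conj_mul_self, neg_sub, zpow_sub_one₀ hJ,
      zpow_natCast]
    have hJ' : conj J ≠ 0 := by simpa using hJ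
    generalize ∑' p : ℤ × ℤ, rowAct γ φ p.1 p.2 * kern m (p.1 * (z : ℂ) + p.2) = S
    rw [div_pow, mul_pow]
    field_simp

lemma eisFourier_eq_maassFn [NeZero N] (m : ℕ) (φ : ZMod N → ZMod N → ℂ) (z : ℍ) :
    eisFourier m φ z = zeroRow m φ * (z.im : ℂ) ^ m +
      2 * rowConst m / N * (ZMod.LFunction (rowSum φ) m +
        maassFn m 0 (eisCoef m φ 1) (eisCoef m φ (-1)) (z / N)) := by
  rw [maassFn_eq 0 _ (polyGrowth_eisCoef m φ (-1)) (div_natCast_im_pos z), zero_mul, zero_add,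
    eisFourier]
  rfl

/-- On y ≥ 1 the expansion is bounded by a power of 1 + y. As φ is arbitrary, the bound also covers
the translates `rowAct γ φ`, that is, all cusps. -/
lemma isBigO_eisFourier [NeZero N] (m : ℕ) (φ : ZMod N → ZMod N → ℂ) :
    (fun z : ℍ => eisFourier m φ z) =O[UpperHalfPlane.atImInfty]
      fun z : ℍ => Real.exp (1 * z.im) := by
  have hN : (1 : ℝ) ≤ N := by exact_mod_cast NeZero.one_le
  obtain ⟨M, hM⟩ := exists_bound_maassFn m 0 (polyGrowth_eisCoef m φ 1) (polyGrowth_eisCoef m φ (-1))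
    (δ := 1 / N) (by positivity)
  have h1 : (fun z : ℍ => eisFourier m φ z) =O[UpperHalfPlane.atImInfty]
      fun z : ℍ => (1 + z.im) ^ m := by
    refine IsBigO.of_bound (‖zeroRow m φ‖ + ‖2 * rowConst m / N‖ *
      (‖ZMod.LFunction (rowSum φ) m‖ + |M|)) ?_
    refine (UpperHalfPlane.atImInfty_mem _).mpr ⟨1, fun z hz => ?_⟩
    have h2 : (1 : ℝ) ≤ (1 + z.im) ^ m := one_le_pow₀ (by linarith)
    have him : ((z : ℂ) / N).im = z.im / N := div_natCast_im _ _
    have h3 := hM (z / N) (by rw [him]; gcongr)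
    have h4 : (1 + ((z : ℂ) / N).im) ^ m ≤ (1 + z.im) ^ m := by
      rw [him]
      have := z.im_pos
      gcongr
      exact div_le_self this.le hN
    have h5 : ‖maassFn m 0 (eisCoef m φ 1) (eisCoef m φ (-1)) (z / N)‖ ≤ |M| * (1 + z.im) ^ m :=
      h3.trans (mul_le_mul (le_abs_self M) h4 (by rw [him]; have := z.im_pos; positivity)
        (abs_nonneg M))
    have h6 : ‖(z.im : ℂ) ^ m‖ ≤ (1 + z.im) ^ m := by
      rw [norm_pow, norm_real, Real.norm_of_nonneg z.im_pos.le]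
      exact pow_le_pow_left₀ z.im_pos.le (by linarith) m
    rw [Set.mem_ofPred_eq, eisFourier_eq_maassFn, Real.norm_of_nonneg (by linarith)]
    refine (norm_add_le _ _).trans ?_
    rw [norm_mul, norm_mul, add_mul, mul_assoc, add_mul]
    gcongr
    refine (norm_add_le _ _).trans (add_le_add (le_mul_of_one_le_right (norm_nonneg _) h2) h5)
  refine h1.trans (IsBigO.of_bound (m.factorial * Real.exp 1) (Eventually.of_forall fun z => ?_))
  have h2 := Real.pow_div_factorial_le_exp (1 + z.im) (by linarith [z.im_pos]) m
  rw [div_le_iff₀ (by positivity), Real.exp_add] at h2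
  rw [Real.norm_of_nonneg (by have := z.im_pos; positivity), Real.norm_of_nonneg (by positivity),
    one_mul]
  linarith

lemma fhat_eq_sum [NeZero N] (φ : ZMod N → ZMod N → ℂ) (c : ZMod N) (n : ℤ) :
    fhat φ c n = ∑ x : ZMod N, φ c x * ZMod.stdAddChar ((n : ZMod N) * x) := by
  rw [fhat, ← sum_range_natCast]
  refine Finset.sum_congr rfl fun r _ => ?_
  have := ZMod.stdAddChar_coe (N := N) (n * r)
  push_cast at this
  rw [this, mul_assoc (2 * (Real.pi : ℂ) * I)]

lemma stdAddChar_eq_one_iff [NeZero N] (a : ZMod N) : ZMod.stdAddChar a = 1 ↔ a = 0 :=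
  ⟨fun h => ZMod.injective_stdAddChar (h.trans (AddChar.map_zero_eq_one _).symm),
    fun h => by rw [h, AddChar.map_zero_eq_one]⟩

/-! ### Shift invariance and integral powers of q -/

/-- Functions of rows modulo `N` invariant under `(c, d) ↦ (c, d + c)`. -/
def ShiftInvariant (φ : ZMod N → ZMod N → ℂ) : Prop := ∀ c d, φ c (d + c) = φ c d

/-- Translating the summation variable by c multiplies the transform by e(nc/N), so it vanishes
unless that factor is 1. -/
lemma ShiftInvariant.fhat_eq_zero [NeZero N] {φ : ZMod N → ZMod N → ℂ} (hφ : ShiftInvariant φ)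
    {c : ZMod N} {n : ℤ} (h : (n : ZMod N) * c ≠ 0) : fhat φ c n = 0 := by
  have h1 : fhat φ c n = ZMod.stdAddChar ((n : ZMod N) * c) * fhat φ c n := by
    rw [fhat_eq_sum, Finset.mul_sum]
    refine (Equiv.sum_comp (Equiv.addRight c) _).symm.trans (Finset.sum_congr rfl fun x _ => ?_)
    rw [Equiv.coe_addRight, hφ, mul_add, AddChar.map_add_eq_mul]
    ring
  have h2 : (ZMod.stdAddChar ((n : ZMod N) * c) - 1) * fhat φ c n = 0 := by
    linear_combination -h1
  exact (mul_eq_zero.mp h2).resolve_left fun h3 =>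
    h ((stdAddChar_eq_one_iff _).mp (sub_eq_zero.mp h3))

/-- Only products cd divisible by N survive, so the series in z/N is really a series in integral
powers of q. -/
lemma ShiftInvariant.eisCoef_eq_zero [NeZero N] {φ : ZMod N → ZMod N → ℂ} (hφ : ShiftInvariant φ)
    (m : ℕ) {ε : ℤ} (hε : IsUnit ε) {n : ℕ} (h : ¬ N ∣ n) : eisCoef m φ ε n = 0 := by
  rw [eisCoef, divSum]
  refine Finset.sum_eq_zero fun p hp => ?_
  rw [hφ.fhat_eq_zero, mul_zero]
  intro h0
  apply h
  have h1 : ((ε * n : ℤ) : ZMod N) = 0 := by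
    rw [← (Nat.mem_divisorsAntidiagonal.mp hp).1, ← h0]
    push_cast
    ring
  rw [ZMod.intCast_zmod_eq_zero_iff_dvd] at h1
  exact Int.natCast_dvd_natCast.mp (hε.dvd_mul_left.mp h1)

lemma qE_div [NeZero N] (n : ℕ) (z : ℂ) : qE (N * n) (z / N) = qE n z := by
  have : (N : ℂ) ≠ 0 := NeZero.ne _
  rw [qE, qE]
  congr 1
  push_cast
  field_simp

lemma natCast_mul_injective [NeZero N] : Function.Injective fun n : ℕ => N * n :=
  fun _ _ h => Nat.eq_of_mul_eq_mul_left (NeZero.pos N) h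

lemma tsum_eq_tsum_mul [NeZero N] {f : ℕ → ℂ} (hf : ∀ n, ¬ N ∣ n → f n = 0) :
    ∑' n, f n = ∑' n, f (N * n) := by
  refine (natCast_mul_injective.tsum_eq fun n hn => ?_).symm
  by_contra h
  exact hn (hf n fun ⟨j, hj⟩ => h ⟨j, hj.symm⟩)

lemma qSer_div [NeZero N] {a : ℕ → ℂ} (ha : ∀ n, ¬ N ∣ n → a n = 0) (z : ℂ) :
    qSer a (z / N) = qSer (fun n => a (N * n)) z := by
  rw [qSer, tsum_eq_tsum_mul fun n hn => by rw [ha n hn, zero_mul]]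
  exact tsum_congr fun n => by rw [qE_div]

lemma conjSer_div [NeZero N] (m : ℕ) {b : ℕ → ℂ} (hb : ∀ n, ¬ N ∣ n → b n = 0) (z : ℂ) :
    conjSer m b (z / N) = conjSer m (fun n => b (N * n)) z := by
  have hN : (N : ℝ) ≠ 0 := NeZero.ne _
  rw [conjSer, tsum_eq_tsum_mul fun n hn => by rw [hb n hn, zero_mul, zero_mul]]
  refine tsum_congr fun n => ?_
  rw [qE_div, div_natCast_im]
  congr 4
  push_cast
  field_simp

lemma PolyGrowth.comp_mul [NeZero N] {a : ℕ → ℂ} (ha : PolyGrowth a) :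
    PolyGrowth fun n => a (N * n) := by
  obtain ⟨C, K, h⟩ := ha
  have hC : 0 ≤ C := (norm_nonneg (a 0)).trans (by simpa using h 0)
  refine ⟨C * N ^ K, K, fun n => (h (N * n)).trans ?_⟩
  rw [mul_assoc, ← mul_pow]
  gcongr
  have hN : (1 : ℝ) ≤ N := by exact_mod_cast NeZero.one_le
  push_cast
  linarith

/-- The holomorphic Fourier coefficients of `eisFourier m φ`, for `φ` invariant under shifts. -/
def eisA [NeZero N] (m : ℕ) (φ : ZMod N → ZMod N → ℂ) (n : ℕ) : ℂ :=
  2 * rowConst m / N * (if n = 0 then ZMod.LFunction (rowSum φ) m else eisCoef m φ 1 (N * n))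

/-- The nonholomorphic Fourier coefficients of `eisFourier m φ`, for `φ` invariant under shifts. -/
def eisB (m : ℕ) (φ : ZMod N → ZMod N → ℂ) (n : ℕ) : ℂ :=
  2 * rowConst m / N * eisCoef m φ (-1) (N * n)

lemma polyGrowth_eisB [NeZero N] (m : ℕ) (φ : ZMod N → ZMod N → ℂ) : PolyGrowth (eisB m φ) :=
  (polyGrowth_eisCoef m φ (-1)).comp_mul.const_mul _

lemma eisA_eq [NeZero N] (m : ℕ) (φ : ZMod N → ZMod N → ℂ) (n : ℕ) :
    eisA m φ n = 2 * rowConst m / N *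
      ((if n = 0 then ZMod.LFunction (rowSum φ) m else 0) + eisCoef m φ 1 (N * n)) := by
  rw [eisA]
  split_ifs with h
  · rw [h, mul_zero, eisCoef_zero, add_zero]
  · rw [zero_add]

lemma polyGrowth_eisA [NeZero N] (m : ℕ) (φ : ZMod N → ZMod N → ℂ) : PolyGrowth (eisA m φ) := by
  rw [funext (eisA_eq m φ)]
  exact ((polyGrowth_single _).add (polyGrowth_eisCoef m φ 1).comp_mul).const_mul _

lemma qSer_eisA [NeZero N] (m : ℕ) {φ : ZMod N → ZMod N → ℂ} (hφ : ShiftInvariant φ) {z : ℂ}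
    (hz : 0 < z.im) : qSer (eisA m φ) z =
      2 * rowConst m / N * (ZMod.LFunction (rowSum φ) m + qSer (eisCoef m φ 1) (z / N)) := by
  rw [qSer_div fun n hn => hφ.eisCoef_eq_zero m isUnit_one hn]
  have h1 := (polyGrowth_eisCoef m φ 1).comp_mul (N := N)
  have hs : HasSum (fun n : ℕ => (if n = 0 then ZMod.LFunction (rowSum φ) m else 0) * qE n z)
      (ZMod.LFunction (rowSum φ) m) := by
    have := hasSum_ite_eq 0 (ZMod.LFunction (rowSum φ) m)
    refine this.congr_fun fun n => ?_
    split_ifs with h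
    · rw [h, qE_zero, mul_one]
    · rw [zero_mul]
  have h2 := (hs.add (summable_qE h1 hz).hasSum).mul_left (2 * rowConst m / N)
  refine (h2.congr_fun fun n => ?_).tsum_eq
  rw [eisA_eq]
  ring

lemma eisFourier_eq [NeZero N] (m : ℕ) {φ : ZMod N → ZMod N → ℂ} (hφ : ShiftInvariant φ) (z : ℍ) :
    eisFourier m φ z = maassFn m (zeroRow m φ) (eisA m φ) (eisB m φ) z := by
  rw [maassFn_eq _ _ (polyGrowth_eisB m φ) z.im_pos, qSer_eisA m hφ z.im_pos, eisFourier,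
    conjSer_div m fun n hn => hφ.eisCoef_eq_zero m isUnit_one.neg hn]
  have : conjSer m (eisB m φ) z =
      2 * rowConst m / N * conjSer m (fun n => eisCoef m φ (-1) (N * n)) z := by
    rw [conjSer, conjSer, ← tsum_mul_left]
    exact tsum_congr fun n => by rw [eisB]; ring
  rw [this]
  change zeroRow m φ * ((z : ℂ).im : ℂ) ^ m + _ = _
  ring

section linearity

lemma fhat_smul (t : ℂ) (φ : ZMod N → ZMod N → ℂ) (c : ZMod N) (n : ℤ) :
    fhat (t • φ) c n = t * fhat φ c n := by
  simp only [fhat, Pi.smul_apply, smul_eq_mul, Finset.mul_sum, mul_assoc]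

lemma eisCoef_smul (m : ℕ) (t : ℂ) (φ : ZMod N → ZMod N → ℂ) (ε : ℤ) (n : ℕ) :
    eisCoef m (t • φ) ε n = t * eisCoef m φ ε n := by
  simp only [eisCoef, divSum, fhat_smul, Finset.mul_sum]
  exact Finset.sum_congr rfl fun p _ => by ring

lemma zeroRow_smul (m : ℕ) (t : ℂ) (φ : ZMod N → ZMod N → ℂ) :
    zeroRow m (t • φ) = t * zeroRow m φ := by
  simp only [zeroRow, Pi.smul_apply, smul_eq_mul, mul_assoc, tsum_mul_left]

lemma LFunction_smul [NeZero N] (t : ℂ) (Φ : ZMod N → ℂ) (s : ℂ) :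
    ZMod.LFunction (t • Φ) s = t * ZMod.LFunction Φ s := by
  simp only [ZMod.LFunction, Pi.smul_apply, smul_eq_mul, Finset.mul_sum]
  exact Finset.sum_congr rfl fun p _ => by ring

lemma rowSum_smul (t : ℂ) (φ : ZMod N → ZMod N → ℂ) : rowSum (t • φ) = t • rowSum φ := by
  ext c
  simp [rowSum, Finset.mul_sum]

lemma eisFourier_smul [NeZero N] (m : ℕ) (t : ℂ) (φ : ZMod N → ZMod N → ℂ) (z : ℂ) :
    eisFourier m (t • φ) z = t * eisFourier m φ z := by
  have h1 : qSer (eisCoef m (t • φ) 1) (z / N) = t * qSer (eisCoef m φ 1) (z / N) := by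
    simp only [qSer, eisCoef_smul, mul_assoc, tsum_mul_left]
  have h2 : conjSer m (eisCoef m (t • φ) (-1)) (z / N) =
      t * conjSer m (eisCoef m φ (-1)) (z / N) := by
    simp only [conjSer, eisCoef_smul, mul_assoc, tsum_mul_left]
  rw [eisFourier, eisFourier, zeroRow_smul, rowSum_smul, LFunction_smul, h1, h2]
  ring

end linearity

/-! ### Mock modularity for a general function of rows -/

/-- Mock modularity of the Eisenstein series attached to a function of rows modulo `N` on which
`Γ₀(N)` acts by the character `χ`. -/
theorem isMockModularFormWithShadow_of_rowAct [NeZero N] {m : ℕ} (hm : 1 ≤ m)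
    {χ : DirichletCharacter ℂ N} {φ : ZMod N → ZMod N → ℂ} (hφ : HasParity (m + 1) φ)
    (hsum : m = 1 → ∑ c : ZMod N, rowSum φ c = 0) (hshift : ShiftInvariant φ)
    (hχ : ∀ γ ∈ CongruenceSubgroup.Gamma0 N, rowAct γ φ = χ ((γ 1 1 : ℤ) : ZMod N) • φ)
    {t : ℂ} (ht : t ≠ 0) (hne : zeroRow m φ ≠ 0 ∨ eisB m φ 1 ≠ 0) {g h : ℍ → ℂ}
    (hg : ∀ z : ℍ, g z = qSer (fun n => t * eisA m φ n) z)
    (hh : ∀ z : ℍ, h z = m * conj (t * zeroRow m φ) - (4 * Real.pi) ^ m / (m - 1).factorial *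
      qSer (fun n => (n : ℂ) ^ m * conj (t * eisB m φ n)) z) :
    IsMockModularFormWithShadow N (1 - (m : ℤ)) χ g h := by
  have hslash : ∀ γ : SL(2, ℤ), ∀ z : ℍ,
      ((fun z : ℍ => t * eisFourier m φ z) ∣[1 - (m : ℤ)] γ) z = t * eisFourier m (rowAct γ φ) z := by
    intro γ z
    rw [← eisFourier_slash hm hφ hsum, ModularForm.SL_slash_apply, ModularForm.SL_slash_apply,
      mul_assoc]
  refine isMockModularFormWithShadow_of_maassFn hm ((polyGrowth_eisA m φ).const_mul t)
    ((polyGrowth_eisB m φ).const_mul t) (by simp [eisB, eisCoef_zero])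
    (f := fun z : ℍ => t * eisFourier m φ z) (A := t * zeroRow m φ) (fun z => ?_)
    (fun γ hγ z => ?_) (fun γ => ⟨1, one_pos, ?_⟩) ?_ hg hh
  · rw [eisFourier_eq m hshift, maassFn_eq _ _ (polyGrowth_eisB m φ) z.im_pos,
      maassFn_eq _ _ ((polyGrowth_eisB m φ).const_mul t) z.im_pos]
    simp only [qSer, conjSer, mul_assoc, tsum_mul_left]
    ring
  · rw [hslash, hχ γ hγ, eisFourier_smul]
    ring
  · rw [show (fun z : ℍ => t * eisFourier m φ z) ∣[1 - (m : ℤ)] γ =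
      fun z : ℍ => t * eisFourier m (rowAct γ φ) z from funext (hslash γ)]
    exact (isBigO_eisFourier m _).const_mul_left t
  · rcases hne with h | h
    · exact Or.inl (mul_ne_zero ht h)
    · exact Or.inr ⟨1, le_rfl, mul_ne_zero ht h⟩

/-! ### Finite exponential sums -/

lemma sum_range_mul {M : Type*} [AddCommMonoid M] (m f : ℕ) (F : ℕ → M) :
    ∑ x ∈ Finset.range (m * f), F x =
      ∑ u ∈ Finset.range m, ∑ v ∈ Finset.range f, F (u + m * v) := by
  induction f with
  | zero => simp
  | succ f ih =>
    simp_rw [Finset.sum_range_succ, Finset.sum_add_distrib, Nat.mul_succ, Finset.sum_range_add, ih,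
      add_comm]

lemma sum_range_exp {f : ℕ} (hf : f ≠ 0) (a : ℕ) :
    ∑ v ∈ Finset.range f, exp (2 * Real.pi * I * a * v / f) = if f ∣ a then (f : ℂ) else 0 := by
  have : NeZero f := ⟨hf⟩
  have h1 := fhat_eq_sum (N := f) (fun _ _ => 1) 0 a
  simp only [fhat, one_mul, Int.cast_natCast] at h1
  simp_rw [h1, mul_comm (a : ZMod f)]
  rw [AddChar.sum_mulShift _ (ZMod.isPrimitive_stdAddChar f)]
  simp [ZMod.natCast_eq_zero_iff, ZMod.card]

/-! ### Homogeneous functions of rows -/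

/-- `φ(gc, gd) = θ(g) φ(c, d)`. -/
def IsHomogeneousBy (θ : DirichletCharacter ℂ N) (φ : ZMod N → ZMod N → ℂ) : Prop :=
  ∀ g c d, φ (g * c) (g * d) = θ g * φ c d

/-- The coprime pairs of integers. -/
abbrev CoprimePair := {p : ℤ × ℤ // Int.gcd p.1 p.2 = 1}

/-- A positive multiple of a coprime pair. -/
def scalePair (q : ℕ+ × CoprimePair) : ℤ × ℤ := (q.1 * q.2.1.1, q.1 * q.2.1.2)

lemma gcd_scalePair (q : ℕ+ × CoprimePair) : Int.gcd (scalePair q).1 (scalePair q).2 = q.1 := by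
  simp [scalePair, Int.gcd_mul_left, q.2.2]

lemma scalePair_injective : Function.Injective scalePair := by
  intro q r h
  have h1 : q.1 = r.1 := by
    have := congrArg (fun p : ℤ × ℤ => Int.gcd p.1 p.2) h
    simp only [gcd_scalePair] at this
    exact_mod_cast this
  have h0 : ((q.1 : ℕ) : ℤ) ≠ 0 := by exact_mod_cast q.1.ne_zero
  refine Prod.ext h1 (Subtype.ext (Prod.ext ?_ ?_))
  · have := congrArg Prod.fst h
    simp only [scalePair, ← h1] at this
    exact mul_left_cancel₀ h0 this
  · have := congrArg Prod.snd h
    simp only [scalePair, ← h1] at this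
    exact mul_left_cancel₀ h0 this

lemma exists_scalePair {p : ℤ × ℤ} (hp : p ≠ 0) : ∃ q, scalePair q = p := by
  have h : 0 < Int.gcd p.1 p.2 := by
    rw [Int.gcd_pos_iff]
    by_contra! h
    exact hp (Prod.ext h.1 h.2)
  refine ⟨(⟨_, h⟩, ⟨(p.1 / Int.gcd p.1 p.2, p.2 / Int.gcd p.1 p.2), Int.gcd_div_gcd_div_gcd h⟩),
    Prod.ext ?_ ?_⟩
  · exact Int.mul_ediv_cancel' (Int.gcd_dvd_left ..)
  · exact Int.mul_ediv_cancel' (Int.gcd_dvd_right ..)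

/-- Each nonzero pair is uniquely g times a coprime pair with g > 0, and homogeneity turns the sum
over g into L(θ, m+1). The zero pair contributes 0, as 0⁻¹ = 0. -/
lemma IsHomogeneousBy.tsum_coprime [NeZero N] {θ : DirichletCharacter ℂ N}
    {φ : ZMod N → ZMod N → ℂ} (hφ : IsHomogeneousBy θ φ) {m : ℕ} (hm : 2 ≤ m) (z : ℍ) :
    ∑' p : ℤ × ℤ, φ p.1 p.2 * ((p.1 * z + p.2 : ℂ) ^ (m + 1))⁻¹ =
      ZMod.LFunction θ (m + 1 : ℕ) * ∑' p : ℤ × ℤ, if Int.gcd p.1 p.2 = 1 then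
        φ p.1 p.2 * ((p.1 * z + p.2 : ℂ) ^ (m + 1))⁻¹ else 0 := by
  set F : ℤ × ℤ → ℂ := fun p => φ p.1 p.2 * ((p.1 * z + p.2 : ℂ) ^ (m + 1))⁻¹ with hFdef
  have hF : Summable F := by
    refine ((summable_lattice_kern hm φ z).norm.congr fun p => ?_).of_norm
    rw [hFdef, norm_mul, norm_mul, norm_kern, norm_inv, norm_pow]
  have h0 : F 0 = 0 := by simp [hFdef]
  have hscale : ∀ q : ℕ+ × CoprimePair, F (scalePair q) =
      ((q.1 : ℂ) ^ (m + 1))⁻¹ * θ (q.1 : ℕ) * F q.2.1 := by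
    intro q
    simp only [hFdef, scalePair, Int.cast_mul, Int.cast_natCast]
    rw [hφ, mul_assoc (q.1 : ℂ), ← mul_add, mul_pow, mul_inv]
    ring
  have hcop : ∑' p : ℤ × ℤ, (if Int.gcd p.1 p.2 = 1 then F p else 0) =
      ∑' p : CoprimePair, F p.1 := by
    refine (tsum_congr fun p => ?_).trans (tsum_subtype {p : ℤ × ℤ | Int.gcd p.1 p.2 = 1} F).symm
    simp only [Set.indicator_apply, Set.mem_ofPred_eq]
  have hsup : Function.support F ⊆ Set.range scalePair := fun p hp =>
    exists_scalePair fun h => hp (h ▸ h0)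
  rw [hcop, ← scalePair_injective.tsum_eq hsup, tsum_congr hscale]
  have hs : Summable fun q : ℕ+ × CoprimePair => F (scalePair q) :=
    hF.comp_injective scalePair_injective
  have hL := hasSum_LFunction_nat (θ : ZMod N → ℂ) (m := m + 1) (by omega)
  rw [← hL.tsum_eq, Summable.tsum_prod ((summable_congr hscale).mp hs), ← tsum_mul_right]
  exact tsum_congr fun g => (tsum_mul_left (f := fun p : CoprimePair => F p.1)).symm ▸ rfl

/-- The common value of the holomorphic Eisenstein series over all rows. -/
def holoEis (m : ℕ) (φ : ZMod N → ZMod N → ℂ) (z : ℂ) : ℂ :=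
  ∑' d : ℤ, φ 0 d * ((d : ℂ) ^ (m + 1))⁻¹ + 2 * (N : ℂ)⁻¹ *
    ((-2 * Real.pi * I) ^ (m + 1) / m.factorial) *
      qSer (fun n => (n : ℂ) ^ m * eisCoef m φ 1 (N * n)) z

lemma tsum_coprime_eq_holoEis [NeZero N] {θ : DirichletCharacter ℂ N}
    {φ : ZMod N → ZMod N → ℂ} (hφ : IsHomogeneousBy θ φ) {m : ℕ} (hm : 2 ≤ m)
    (hpar : HasParity (m + 1) φ) (hshift : ShiftInvariant φ) (z : ℍ) :
    ZMod.LFunction θ (m + 1 : ℕ) * (∑' p : ℤ × ℤ, if Int.gcd p.1 p.2 = 1 then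
      φ p.1 p.2 * ((p.1 * z + p.2 : ℂ) ^ (m + 1))⁻¹ else 0) = holoEis m φ z := by
  have hN : (N : ℂ) ≠ 0 := NeZero.ne _
  rw [← hφ.tsum_coprime hm, tsum_lattice_inv_pow hm hpar, qSer_div fun n hn => by
    rw [hshift.eisCoef_eq_zero m isUnit_one hn, mul_zero], holoEis]
  have : qSer (fun n => ((N * n : ℕ) : ℂ) ^ m * eisCoef m φ 1 (N * n)) z =
      (N : ℂ) ^ m * qSer (fun n => (n : ℂ) ^ m * eisCoef m φ 1 (N * n)) z := by
    rw [qSer, qSer, ← tsum_mul_left]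
    refine tsum_congr fun n => ?_
    push_cast
    ring
  rw [this, pow_succ (N : ℂ)]
  field_simp

/-! ### Primitive exponential sums -/

/-- The full exponential sums `∑_{d mod c} φ(c, d) e(nd/c)`. -/
def fullSum (φ : ZMod N → ZMod N → ℂ) (n : ℕ) : ArithmeticFunction ℂ :=
  ⟨fun c => ∑ d ∈ Finset.range c, φ c d * exp (2 * Real.pi * I * n * d / c), by simp⟩

/-- The primitive exponential sums `∑_{d mod c, (d, c) = 1} φ(c, d) e(nd/c)`. -/
def primSum (φ : ZMod N → ZMod N → ℂ) (n : ℕ) : ArithmeticFunction ℂ :=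
  ⟨fun c => ∑ d ∈ (Finset.range c).filter (fun d => Nat.Coprime d c),
    φ c d * exp (2 * Real.pi * I * n * d / c), by simp⟩

/-- The residues d modulo c are sorted by g = gcd(d, c): dividing d and c by g leaves a coprime
residue modulo c/g. -/
lemma sum_range_eq_sum_coprime {M : Type*} [AddCommMonoid M] (c : ℕ) (F : ℕ → ℕ → M) :
    ∑ d ∈ Finset.range c, F c d = ∑ p ∈ c.divisorsAntidiagonal,
      ∑ d ∈ (Finset.range p.2).filter (fun d => Nat.Coprime d p.2), F (p.1 * p.2) (p.1 * d) := by
  rw [Finset.sum_sigma']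
  refine Finset.sum_bij' (fun d _ => ⟨(Nat.gcd d c, c / Nat.gcd d c), d / Nat.gcd d c⟩)
    (fun q _ => q.1.1 * q.2) ?_ ?_ ?_ ?_ ?_
  · intro d hd
    have hd := Finset.mem_range.mp hd
    have hg : 0 < Nat.gcd d c := Nat.gcd_pos_of_pos_right _ (by omega)
    simp only [Finset.mem_sigma, Nat.mem_divisorsAntidiagonal, Finset.mem_filter, Finset.mem_range]
    exact ⟨⟨Nat.mul_div_cancel' (Nat.gcd_dvd_right d c), by omega⟩,
      Nat.div_lt_div_of_lt_of_dvd (Nat.gcd_dvd_right d c) hd, Nat.coprime_div_gcd_div_gcd hg⟩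
  · rintro ⟨⟨g, e⟩, d⟩ h
    simp only [Finset.mem_sigma, Nat.mem_divisorsAntidiagonal, Finset.mem_filter,
      Finset.mem_range] at h ⊢
    obtain ⟨⟨rfl, h1⟩, h2, h3⟩ := h
    exact Nat.mul_lt_mul_of_pos_left h2 (Nat.pos_of_ne_zero (left_ne_zero_of_mul h1))
  · intro d _
    exact Nat.mul_div_cancel' (Nat.gcd_dvd_left d c)
  · rintro ⟨⟨g, e⟩, d⟩ h
    simp only [Finset.mem_sigma, Nat.mem_divisorsAntidiagonal, Finset.mem_filter,
      Finset.mem_range] at h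
    obtain ⟨⟨rfl, h1⟩, h2, h3⟩ := h
    have hg : 0 < g := Nat.pos_of_ne_zero (left_ne_zero_of_mul h1)
    simp [Nat.gcd_mul_left, h3.gcd_eq_one, hg]
  · intro d hd
    have hd := Finset.mem_range.mp hd
    simp only
    rw [Nat.mul_div_cancel' (Nat.gcd_dvd_right d c), Nat.mul_div_cancel' (Nat.gcd_dvd_left d c)]

/-- A Dirichlet character as an arithmetic function. -/
def charArith (θ : DirichletCharacter ℂ N) : ArithmeticFunction ℂ :=
  toArithmeticFunction fun n : ℕ => θ n

/-- The Dirichlet inverse of a Dirichlet character. -/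
def charArithInv (θ : DirichletCharacter ℂ N) : ArithmeticFunction ℂ :=
  toArithmeticFunction ((fun n : ℕ => θ n) * fun n : ℕ => (ArithmeticFunction.moebius n : ℂ))

/-- Cancelling g = gcd(d, c) leaves the phase e(nd/c) unchanged and extracts θ(g), so the sorting by
gcd is a Dirichlet convolution. -/
lemma IsHomogeneousBy.fullSum_eq {θ : DirichletCharacter ℂ N} {φ : ZMod N → ZMod N → ℂ}
    (hφ : IsHomogeneousBy θ φ) (n : ℕ) : fullSum φ n = charArith θ * primSum φ n := by
  ext c
  rw [ArithmeticFunction.mul_apply]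
  refine (sum_range_eq_sum_coprime c fun c d => φ c d * exp (2 * Real.pi * I * n * d / c)).trans ?_
  refine Finset.sum_congr rfl fun p hp => ?_
  have h0 := (Nat.mem_divisorsAntidiagonal.mp hp).2
  rw [← (Nat.mem_divisorsAntidiagonal.mp hp).1] at h0
  have h1 : p.1 ≠ 0 := left_ne_zero_of_mul h0
  have h2 : (p.1 : ℂ) ≠ 0 := by exact_mod_cast h1
  have h3 : (p.2 : ℂ) ≠ 0 := by exact_mod_cast right_ne_zero_of_mul h0
  change _ = charArith θ p.1 * ∑ d ∈ _, _
  rw [Finset.mul_sum]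
  refine Finset.sum_congr rfl fun d _ => ?_
  have h4 : charArith θ p.1 = θ p.1 := by simp [charArith, toArithmeticFunction, h1]
  rw [h4]
  push_cast
  rw [hφ, mul_assoc]
  congr 3
  field_simp

lemma charArith_mul_inv (θ : DirichletCharacter ℂ N) : charArith θ * charArithInv θ = 1 := by
  ext n
  have := congrFun (DirichletCharacter.convolution_mul_moebius θ) n
  rw [LSeries.convolution] at this
  refine this.trans ?_
  simp [LSeries.delta, ArithmeticFunction.one_apply]

lemma IsHomogeneousBy.primSum_eq {θ : DirichletCharacter ℂ N} {φ : ZMod N → ZMod N → ℂ}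
    (hφ : IsHomogeneousBy θ φ) (n : ℕ) : primSum φ n = charArithInv θ * fullSum φ n := by
  rw [hφ.fullSum_eq, ← mul_assoc, mul_comm (charArithInv θ), charArith_mul_inv, one_mul]

lemma ShiftInvariant.add_mul {φ : ZMod N → ZMod N → ℂ} (hφ : ShiftInvariant φ) (c d : ZMod N)
    (j : ℕ) : φ c (d + c * j) = φ c d := by
  induction j with
  | zero => simp
  | succ j ih =>
    rw [← ih, ← hφ c (d + c * j)]
    congr 1
    push_cast
    ring

/-- The sum over d modulo cN is evaluated twice, by splitting d along multiples of c and along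
multiples of N. -/
lemma ShiftInvariant.fullSum_eq [NeZero N] {φ : ZMod N → ZMod N → ℂ} (hφ : ShiftInvariant φ)
    (n : ℕ) {c : ℕ} (hc : c ≠ 0) :
    fullSum φ n c = if c ∣ N * n then (c : ℂ) / N * fhat φ c ((N * n / c : ℕ) : ℤ) else 0 := by
  have hN : (N : ℂ) ≠ 0 := NeZero.ne _
  have hc' : (c : ℂ) ≠ 0 := by exact_mod_cast hc
  -- By shift invariance the summand has period c, so the long sum is N copies of the sum modulo c.
  have h1 : ∑ d ∈ Finset.range (c * N), φ c d * exp (2 * Real.pi * I * n * d / c) =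
      N * fullSum φ n c := by
    rw [sum_range_mul]
    have : ∀ u ∈ Finset.range c, ∑ v ∈ Finset.range N,
        φ c (u + c * v : ℕ) * exp (2 * Real.pi * I * n * (u + c * v : ℕ) / c) =
        N * (φ c u * exp (2 * Real.pi * I * n * u / c)) := by
      intro u _
      have : ∀ v ∈ Finset.range N,
          φ c (u + c * v : ℕ) * exp (2 * Real.pi * I * n * (u + c * v : ℕ) / c) =
          φ c u * exp (2 * Real.pi * I * n * u / c) := by
        intro v _
        push_cast
        rw [hφ.add_mul]
        congr 1
        rw [← exp_periodic.nat_mul (n * v) (2 * Real.pi * I * n * u / c)]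
        congr 1
        push_cast
        field_simp
      rw [Finset.sum_congr rfl this, Finset.sum_const, Finset.card_range, nsmul_eq_mul]
    rw [Finset.sum_congr rfl this, ← Finset.mul_sum]
    rfl
  -- With d = r + Nv, φ sees only r, and the geometric sum over v detects whether c divides Nn.
  have h2 : ∑ d ∈ Finset.range (N * c), φ c d * exp (2 * Real.pi * I * n * d / c) =
      ∑ r ∈ Finset.range N, φ c r * exp (2 * Real.pi * I * n * r / c) *
        (if c ∣ N * n then (c : ℂ) else 0) := by
    rw [sum_range_mul]
    refine Finset.sum_congr rfl fun r _ => ?_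
    rw [← sum_range_exp hc (N * n), Finset.mul_sum]
    refine Finset.sum_congr rfl fun v _ => ?_
    rw [mul_assoc (φ _ _), ← exp_add]
    push_cast
    rw [ZMod.natCast_self, zero_mul, add_zero]
    congr 2
    ring
  rw [mul_comm N c, h1] at h2
  rw [eq_div_of_mul_eq hN ((mul_comm _ _).trans h2)]
  split_ifs with h
  · rw [← Finset.sum_mul, fhat, mul_comm, mul_div_right_comm]
    congr 1
    refine Finset.sum_congr rfl fun r _ => ?_
    congr 2
    obtain ⟨e, he⟩ := h
    rw [he, Nat.mul_div_cancel_left _ (Nat.pos_of_ne_zero hc)]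
    have he' : (N : ℂ) * n = c * e := by exact_mod_cast he
    push_cast
    field_simp
    linear_combination r * he'
  · simp

open scoped LSeries.notation in
-- By Dirichlet inversion the series of primitive sums is L(θ, m+1)⁻¹ times that of full sums, and
-- the latter is finite, supported on the divisors of Nn. This replaces the passage to coprime pairs
-- in weight 2, where the lattice sum does not converge absolutely.
lemma tsum_primSum [NeZero N] {θ : DirichletCharacter ℂ N} {φ : ZMod N → ZMod N → ℂ}
    (hφ : IsHomogeneousBy θ φ) (hshift : ShiftInvariant φ) {m : ℕ} (hm : 1 ≤ m) {n : ℕ}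
    (hn : n ≠ 0) :
    ZMod.LFunction θ (m + 1 : ℕ) * ∑' c : ℕ, (if 0 < c then
      ((c : ℂ) ^ (m + 1))⁻¹ * primSum φ n c else 0) = (N : ℂ)⁻¹ * eisCoef m φ 1 (N * n) := by
  have hN : (N : ℂ) ≠ 0 := NeZero.ne _
  have hs : 1 < (((m + 1 : ℕ) : ℂ)).re := by rw [natCast_re]; exact_mod_cast (by omega : 1 < m + 1)
  have hterm : ∀ f : ℕ → ℂ, ∀ c : ℕ, LSeries.term f (m + 1 : ℕ) c =
      if 0 < c then ((c : ℂ) ^ (m + 1))⁻¹ * f c else 0 := by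
    intro f c
    split_ifs with h
    · rw [LSeries.term_of_ne_zero h.ne', cpow_natCast, div_eq_mul_inv, mul_comm]
    · rw [Nat.eq_zero_of_not_pos h, LSeries.term_zero]
  have hNn : N * n ≠ 0 := mul_ne_zero (NeZero.ne N) hn
  have hfull : HasSum (LSeries.term (fullSum φ n) (m + 1 : ℕ))
      ((N : ℂ)⁻¹ * eisCoef m φ 1 (N * n)) := by
    have h1 : ∀ c ∉ (N * n).divisors, LSeries.term (fullSum φ n) (m + 1 : ℕ) c = 0 := by
      intro c hc
      rw [hterm]
      split_ifs with h
      · rw [hshift.fullSum_eq n h.ne', if_neg fun h2 => hc (Nat.mem_divisors.mpr ⟨h2, hNn⟩), mul_zero]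
      · rfl
    have h2 : HasSum (LSeries.term (fullSum φ n) (m + 1 : ℕ)) _ := hasSum_sum_of_ne_finset_zero h1
    have h3 : ∑ c ∈ (N * n).divisors, LSeries.term (fullSum φ n) (m + 1 : ℕ) c =
        (N : ℂ)⁻¹ * eisCoef m φ 1 (N * n) := by
      rw [eisCoef, divSum, Finset.mul_sum, Nat.sum_divisorsAntidiagonal fun c d =>
        (N : ℂ)⁻¹ * (((c : ℂ) ^ m)⁻¹ * fhat φ c (1 * d))]
      refine Finset.sum_congr rfl fun c hc => ?_
      have hc0 := Nat.pos_of_mem_divisors hc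
      have hc0' : (c : ℂ) ≠ 0 := by exact_mod_cast hc0.ne'
      rw [hterm, if_pos hc0, hshift.fullSum_eq n hc0.ne', if_pos (Nat.dvd_of_mem_divisors hc), one_mul,
        pow_succ]
      field_simp
    rwa [h3] at h2
  have hθ := DirichletCharacter.LSeriesSummable_of_one_lt_re θ hs
  have hθμ := DirichletCharacter.LSeriesSummable_mul θ
    (ArithmeticFunction.LSeriesSummable_moebius_iff.mpr hs)
  have hinv := DirichletCharacter.LSeries.mul_mu_eq_one θ hs
  have hprim : LSeriesHasSum (primSum φ n) (m + 1 : ℕ)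
      (L (↗θ * ↗ArithmeticFunction.moebius) (m + 1 : ℕ) * ((N : ℂ)⁻¹ * eisCoef m φ 1 (N * n))) := by
    rw [hφ.primSum_eq]
    refine ArithmeticFunction.LSeriesHasSum_mul ?_ hfull
    refine (LSeriesHasSum_congr _ _ fun {c} hc => ?_).mpr hθμ.LSeriesHasSum
    simp [charArithInv, toArithmeticFunction, hc]
  rw [← tsum_congr (hterm _), hprim.tsum_eq, ← mul_assoc]
  have : ZMod.LFunction θ (m + 1 : ℕ) = L ↗θ (m + 1 : ℕ) :=
    ZMod.LFunction_eq_LSeries (θ : ZMod N → ℂ) hs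
  rw [this, hinv, one_mul]

/-! ### Complex conjugation and the shadow -/

/-- The complex conjugate of a function of rows. -/
def conjRow (φ : ZMod N → ZMod N → ℂ) (c d : ZMod N) : ℂ := conj (φ c d)

lemma conj_fhat (φ : ZMod N → ZMod N → ℂ) (c : ZMod N) (n : ℤ) :
    conj (fhat φ c n) = fhat (conjRow φ) c (-n) := by
  simp only [fhat, map_sum, map_mul, conjRow, ← exp_conj, map_div₀, conj_I, conj_ofReal, map_ofNat,
    map_intCast, map_natCast]
  refine Finset.sum_congr rfl fun r _ => ?_
  congr 2
  push_cast
  ring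

/-- Conjugation reverses the frequency, so the nonholomorphic coefficients of φ turn into
holomorphic coefficients of conj φ. -/
lemma conj_eisCoef (m : ℕ) (φ : ZMod N → ZMod N → ℂ) (ε : ℤ) (n : ℕ) :
    conj (eisCoef m φ ε n) = eisCoef m (conjRow φ) (-ε) n := by
  simp only [eisCoef, divSum, map_sum, map_mul, map_inv₀, map_pow, map_natCast, conj_fhat, neg_mul]

lemma conj_zeroRow (m : ℕ) (φ : ZMod N → ZMod N → ℂ) :
    conj (zeroRow m φ) = ∑' d : ℤ, conjRow φ 0 d * ((d : ℂ) ^ (m + 1))⁻¹ := by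
  rw [zeroRow, conj_tsum]
  refine tsum_congr fun d => ?_
  simp only [conjRow, kern, map_mul, map_inv₀, map_intCast, map_pow, pow_succ, mul_inv]
  ring

/-- This matches the constant of the Poisson-type formula with the one in Lipschitz's formula; the
key is 4 = (2i)(-2i). -/
lemma shadow_const (m : ℕ) : -((4 * Real.pi : ℂ) ^ m * conj (rowConst m)) =
    (-2 * Real.pi * I) ^ (m + 1) := by
  have h2 : (2 * I : ℂ) ≠ 0 := mul_ne_zero two_ne_zero I_ne_zero
  have h : conj (rowConst m) = Real.pi * (2 * I) ^ (1 - (m : ℤ)) := by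
    simp only [rowConst, map_mul, conj_ofReal, map_zpow₀, map_neg, map_ofNat, conj_I]
    rw [neg_mul_neg]
  have h4 : (4 : ℂ) ^ m = (2 * I) ^ m * (-2 * I) ^ m := by
    rw [← mul_pow]
    congr 1
    linear_combination 4 * I_mul_I
  rw [h, zpow_sub₀ h2, zpow_one, zpow_natCast, mul_pow, h4]
  field_simp
  ring

lemma shadow_eq_holoEis {m : ℕ} (hm : 1 ≤ m) (φ : ZMod N → ZMod N → ℂ) (t z : ℂ) :
    m * conj (t * zeroRow m φ) - (4 * Real.pi) ^ m / (m - 1).factorial *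
      qSer (fun n => (n : ℂ) ^ m * conj (t * eisB m φ n)) z =
      m * conj t * holoEis m (conjRow φ) z := by
  have hm0 : (m : ℂ) ≠ 0 := by exact_mod_cast (by omega : m ≠ 0)
  have hf : ((m - 1).factorial : ℂ) ≠ 0 := by exact_mod_cast (m - 1).factorial_ne_zero
  have hfac : (m.factorial : ℂ) = m * (m - 1).factorial := by
    exact_mod_cast (Nat.mul_factorial_pred (by omega)).symm
  have h1 : qSer (fun n => (n : ℂ) ^ m * conj (t * eisB m φ n)) z =
      conj t * (2 * conj (rowConst m) / N) *
        qSer (fun n => (n : ℂ) ^ m * eisCoef m (conjRow φ) 1 (N * n)) z := by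
    rw [qSer, qSer, ← tsum_mul_left]
    refine tsum_congr fun n => ?_
    simp only [eisB, map_mul, map_div₀, map_ofNat, map_natCast, conj_eisCoef, neg_neg]
    ring
  rw [h1, map_mul, conj_zeroRow, holoEis, ← shadow_const, hfac]
  field_simp
  ring

/-! ### The rows of the cusps `∞` and `0` -/

/-- The function of rows attached to the cusp `∞`. -/
def rowInfty (ψ : DirichletCharacter ℂ N) (c d : ZMod N) : ℂ := if c = 0 then ψ d else 0

/-- The function of rows attached to the cusp `0`. -/
def rowZero (ψ : DirichletCharacter ℂ N) (c _ : ZMod N) : ℂ := ψ c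

lemma conj_char [NeZero N] (ψ : DirichletCharacter ℂ N) (a : ZMod N) : conj (ψ a) = ψ⁻¹ a :=
  MulChar.star_apply' ψ a

lemma conjRow_rowInfty [NeZero N] (ψ : DirichletCharacter ℂ N) :
    conjRow (rowInfty ψ) = rowInfty ψ⁻¹ := by
  ext c d
  simp only [conjRow, rowInfty]
  split_ifs
  · exact conj_char ψ d
  · exact map_zero _

lemma conjRow_rowZero [NeZero N] (ψ : DirichletCharacter ℂ N) :
    conjRow (rowZero ψ) = rowZero ψ⁻¹ := by
  ext c d
  exact conj_char ψ c

lemma isHomogeneousBy_rowInfty (ψ : DirichletCharacter ℂ N) : IsHomogeneousBy ψ (rowInfty ψ) := by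
  intro g c d
  simp only [rowInfty]
  by_cases hg : IsUnit g
  · simp only [hg.mul_right_eq_zero, map_mul, mul_ite, mul_zero]
  · rw [map_mul, ψ.map_nonunit hg, zero_mul, zero_mul, ite_self]

lemma isHomogeneousBy_rowZero (ψ : DirichletCharacter ℂ N) : IsHomogeneousBy ψ (rowZero ψ) :=
  fun g c _ => map_mul ψ g c

lemma shiftInvariant_rowInfty (ψ : DirichletCharacter ℂ N) : ShiftInvariant (rowInfty ψ) := by
  intro c d
  simp only [rowInfty]
  split_ifs with h
  · rw [h, add_zero]
  · rfl

lemma shiftInvariant_rowZero (ψ : DirichletCharacter ℂ N) : ShiftInvariant (rowZero ψ) :=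
  fun _ _ => rfl

lemma char_neg {ψ : DirichletCharacter ℂ N} {k : ℕ} (h : ψ (-1) = (-1) ^ k) (a : ZMod N) :
    ψ (-a) = (-1) ^ k * ψ a := by
  rw [← h, ← map_mul, neg_one_mul]

lemma hasParity_rowInfty {ψ : DirichletCharacter ℂ N} {k : ℕ} (h : ψ (-1) = (-1) ^ k) :
    HasParity k (rowInfty ψ) := by
  intro c d
  simp only [rowInfty, neg_eq_zero, char_neg h, mul_ite, mul_zero]

lemma hasParity_rowZero {ψ : DirichletCharacter ℂ N} {k : ℕ} (h : ψ (-1) = (-1) ^ k) :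
    HasParity k (rowZero ψ) := fun c _ => char_neg h c

lemma inv_char_neg_one [NeZero N] {ψ : DirichletCharacter ℂ N} {k : ℕ} (h : ψ (-1) = (-1) ^ k) :
    ψ⁻¹ (-1) = (-1) ^ k := by
  rw [← conj_char, h]
  simp

lemma tsum_int_char [NeZero N] {ψ : DirichletCharacter ℂ N} {k : ℕ} (hk : 2 ≤ k)
    (h : ψ (-1) = (-1) ^ k) :
    ∑' d : ℤ, ψ d * ((d : ℂ) ^ k)⁻¹ = 2 * ZMod.LFunction ψ k := by
  have hk0 : k ≠ 0 := by omega
  have hs : Summable fun d : ℤ => ψ d * ((d : ℂ) ^ k)⁻¹ := by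
    refine Summable.of_norm_bounded (Real.summable_one_div_int_pow.mpr hk).norm fun d => ?_
    rw [norm_mul, norm_inv, norm_pow, norm_div, norm_one, norm_pow, norm_intCast, Real.norm_eq_abs,
      one_div]
    exact mul_le_of_le_one_left (by positivity) (ψ.norm_le_one _)
  rw [tsum_int_eq_zero_add_two_mul_tsum_pnat _ hs]
  · rw [← (hasSum_LFunction_nat (ψ : ZMod N → ℂ) hk).tsum_eq]
    simp only [Int.cast_zero, zero_pow hk0, inv_zero, Int.cast_natCast, mul_comm (ψ _), two_mul,
      two_nsmul, zero_mul, zero_add]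
  · intro d
    simp only [Int.cast_neg, char_neg h]
    rw [neg_pow (d : ℂ), mul_inv, ← inv_pow, mul_mul_mul_comm, ← mul_pow]
    norm_num

lemma LFunction_ne_zero [NeZero N] (ψ : DirichletCharacter ℂ N) {k : ℕ} (hk : 2 ≤ k) :
    ZMod.LFunction ψ k ≠ 0 := by
  have hk1 : (1 : ℝ) < ((k : ℂ)).re := by rw [natCast_re]; exact_mod_cast hk
  rw [ZMod.LFunction_eq_LSeries _ hk1]
  exact ψ.LSeries_ne_zero_of_one_lt_re hk1

lemma conj_LFunction [NeZero N] (ψ : DirichletCharacter ℂ N) {k : ℕ} (hk : 2 ≤ k) :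
    conj (ZMod.LFunction ψ k) = ZMod.LFunction (ψ⁻¹ : DirichletCharacter ℂ N) k := by
  rw [← (hasSum_LFunction_nat (ψ : ZMod N → ℂ) hk).tsum_eq,
    ← (hasSum_LFunction_nat ((ψ⁻¹ : DirichletCharacter ℂ N) : ZMod N → ℂ) hk).tsum_eq, conj_tsum]
  refine tsum_congr fun c => ?_
  rw [map_mul, conj_char, map_inv₀, map_pow, map_natCast]

lemma qSer_holoEis_one (φ : ZMod N → ZMod N → ℂ) (z : ℍ) :
    qSer (fun n => (n : ℂ) ^ 1 * eisCoef 1 φ 1 (N * n)) z =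
      ∑' n : ℕ, if 0 < n then (n : ℂ) * eisCoef 1 φ 1 (N * n) * qPow n z else 0 := by
  refine tsum_congr fun n => ?_
  split_ifs with h
  · simp only [pow_one, qPow_natCast]
  · rw [Nat.eq_zero_of_not_pos h]
    simp

lemma etaInfty_two [NeZero N] (ψ : DirichletCharacter ℂ N) {n : ℕ} (hn : n ≠ 0) :
    etaInfty N 2 ψ⁻¹ n = (ZMod.LFunction ψ (1 + 1 : ℕ))⁻¹ * (N : ℂ)⁻¹ * (-2 * Real.pi * I) ^ 2 *
      (n * eisCoef 1 (rowInfty ψ) 1 (N * n)) := by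
  have h := tsum_primSum (isHomogeneousBy_rowInfty ψ) (shiftInvariant_rowInfty ψ) le_rfl hn
  have h2 : ∀ c : ℕ, (if 0 < c ∧ N ∣ c then
      ((c : ℂ) ^ 2)⁻¹ * ∑ d ∈ (Finset.range c).filter (fun d => Nat.Coprime d c),
        ψ⁻¹⁻¹ (d : ZMod N) * exp (2 * Real.pi * I * n * d / c) else 0) =
      if 0 < c then ((c : ℂ) ^ (1 + 1))⁻¹ * primSum (rowInfty ψ) n c else 0 := by
    intro c
    rw [ite_and, inv_inv]
    refine if_congr Iff.rfl ?_ rfl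
    change _ = _ * ∑ d ∈ (Finset.range c).filter (fun d => Nat.Coprime d c),
      rowInfty ψ c d * exp (2 * Real.pi * I * n * d / c)
    simp only [rowInfty, ZMod.natCast_eq_zero_iff]
    split_ifs <;> simp
  rw [etaInfty, tsum_congr h2, (eq_inv_mul_iff_mul_eq₀ (LFunction_ne_zero ψ le_rfl)).mpr h, div_I]
  norm_num
  ring

lemma etaZero_two [NeZero N] (ψ : DirichletCharacter ℂ N) {n : ℕ} (hn : n ≠ 0) :
    etaZero N 2 ψ n = ((Real.sqrt N : ℂ) ^ (1 + 1))⁻¹ * ((ZMod.LFunction ψ (1 + 1 : ℕ))⁻¹ *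
      (N : ℂ)⁻¹ * (-2 * Real.pi * I) ^ 2 * (n * eisCoef 1 (rowZero ψ) 1 (N * n))) := by
  have h := tsum_primSum (isHomogeneousBy_rowZero ψ) (shiftInvariant_rowZero ψ) le_rfl hn
  have h2 : ∀ l : ℕ, (if 0 < l ∧ Nat.Coprime l N then
      (((Real.sqrt N : ℂ) * l) ^ 2)⁻¹ * ψ (l : ZMod N) *
        ∑ d ∈ (Finset.range l).filter (fun d => Nat.Coprime d l),
          exp (2 * Real.pi * I * n * d / l) else 0) =
      ((Real.sqrt N : ℂ) ^ (1 + 1))⁻¹ *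
        if 0 < l then ((l : ℂ) ^ (1 + 1))⁻¹ * primSum (rowZero ψ) n l else 0 := by
    intro l
    rw [ite_and, mul_ite, mul_zero]
    refine if_congr Iff.rfl ?_ rfl
    change _ = _ * (_ * ∑ d ∈ (Finset.range l).filter (fun d => Nat.Coprime d l),
      ψ l * exp (2 * Real.pi * I * n * d / l))
    rw [← Finset.mul_sum]
    split_ifs with h3
    · rw [mul_pow, mul_inv]
      ring
    · rw [ψ.map_nonunit (by rwa [ZMod.isUnit_iff_coprime])]
      simp
  rw [etaZero, tsum_congr h2, tsum_mul_left,
    (eq_inv_mul_iff_mul_eq₀ (LFunction_ne_zero ψ le_rfl)).mpr h, div_I]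
  norm_num
  ring

/-- For k ≥ 3 this is the reduction to coprime pairs. For k = 2 the Fourier coefficients are
compared, and the zero row contributes 2 L(ψ, 2), which the normalization turns into the constant
term 1. -/
lemma eisensteinInfty_eq [NeZero N] {m : ℕ} (hm : 1 ≤ m) {ψ : DirichletCharacter ℂ N}
    (h : ψ (-1) = (-1) ^ (m + 1)) (z : ℍ) :
    eisensteinInfty N (m + 1) ψ⁻¹ z =
      (2 * ZMod.LFunction ψ (m + 1 : ℕ))⁻¹ * holoEis m (rowInfty ψ) z := by
  have hL := LFunction_ne_zero ψ (k := m + 1) (by omega)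
  rcases hm.eq_or_lt with rfl | hm
  · have h0 : ∀ n : ℕ, (if 0 < n then etaInfty N 2 ψ⁻¹ n * qPow n z else 0) =
        (ZMod.LFunction ψ (1 + 1 : ℕ))⁻¹ * (N : ℂ)⁻¹ * (-2 * Real.pi * I) ^ 2 *
        if 0 < n then (n : ℂ) * eisCoef 1 (rowInfty ψ) 1 (N * n) * qPow n z else 0 := by
      intro n
      split_ifs with hn
      · rw [etaInfty_two ψ hn.ne']
        ring
      · rw [mul_zero]
    have h3 : ∀ d : ℤ, rowInfty ψ 0 d * ((d : ℂ) ^ (1 + 1))⁻¹ = ψ d * ((d : ℂ) ^ (1 + 1))⁻¹ :=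
      fun d => by rw [rowInfty, if_pos rfl]
    rw [eisensteinInfty, if_pos rfl, tsum_congr h0, tsum_mul_left, holoEis, qSer_holoEis_one,
      tsum_congr h3, tsum_int_char le_rfl h, mul_add, inv_mul_cancel₀ (mul_ne_zero two_ne_zero hL),
      Nat.factorial_one, Nat.cast_one]
    ring
  · rw [eisensteinInfty, if_neg (by omega), inv_inv,
      ← tsum_coprime_eq_holoEis (isHomogeneousBy_rowInfty ψ) hm (hasParity_rowInfty h)
        (shiftInvariant_rowInfty ψ)]
    have : ∀ p : ℤ × ℤ, (if Int.gcd p.1 p.2 = 1 ∧ (N : ℤ) ∣ p.1 then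
        ψ (p.2 : ZMod N) * (((p.1 : ℂ) * z + p.2) ^ (m + 1))⁻¹ else 0) =
        if Int.gcd p.1 p.2 = 1 then
          rowInfty ψ p.1 p.2 * (((p.1 : ℂ) * z + p.2) ^ (m + 1))⁻¹ else 0 := by
      intro p
      simp only [rowInfty, ZMod.intCast_zmod_eq_zero_iff_dvd, ite_mul, zero_mul, ite_and]
    rw [tsum_congr this, mul_inv]
    rw [mul_assoc 2⁻¹, inv_mul_cancel_left₀ hL, one_div]

lemma eisensteinZero_eq [NeZero N] {m : ℕ} (hm : 1 ≤ m) {ψ : DirichletCharacter ℂ N}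
    (h : ψ (-1) = (-1) ^ (m + 1)) (h1 : m = 1 → ψ ≠ 1) (z : ℍ) :
    eisensteinZero N (m + 1) ψ z = ((Real.sqrt N : ℂ) ^ (m + 1))⁻¹ *
      ((2 * ZMod.LFunction ψ (m + 1 : ℕ))⁻¹ * holoEis m (rowZero ψ) z) := by
  have hL := LFunction_ne_zero ψ (k := m + 1) (by omega)
  rcases hm.eq_or_lt with rfl | hm
  · have h0 : ∀ n : ℕ, (if 0 < n then etaZero N 2 ψ n * qPow n z else 0) =
        ((Real.sqrt N : ℂ) ^ (1 + 1))⁻¹ * ((ZMod.LFunction ψ (1 + 1 : ℕ))⁻¹ * (N : ℂ)⁻¹ *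
          (-2 * Real.pi * I) ^ 2) *
        if 0 < n then (n : ℂ) * eisCoef 1 (rowZero ψ) 1 (N * n) * qPow n z else 0 := by
      intro n
      split_ifs with hn
      · rw [etaZero_two ψ hn.ne']
        ring
      · rw [mul_zero]
    -- A nonprincipal character forces N ≠ 1, so ψ(0) = 0 and the zero row is absent, in agreement
    -- with the constant term 0.
    have hN : N ≠ 1 := fun hN => h1 rfl (ψ.level_one' hN)
    have h3 : ∀ d : ℤ, rowZero ψ 0 d * ((d : ℂ) ^ (1 + 1))⁻¹ = 0 :=
      fun d => by rw [rowZero, ψ.map_zero' hN, zero_mul]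
    rw [eisensteinZero, if_pos rfl, if_neg hN, tsum_congr h0, tsum_mul_left, holoEis,
      qSer_holoEis_one, tsum_congr h3, tsum_zero, Nat.factorial_one, Nat.cast_one]
    ring
  · rw [eisensteinZero, if_neg (by omega),
      ← tsum_coprime_eq_holoEis (isHomogeneousBy_rowZero ψ) hm (hasParity_rowZero h)
        (shiftInvariant_rowZero ψ)]
    have : ∀ p : ℤ × ℤ, (if Int.gcd p.1 p.2 = 1 ∧ Int.gcd p.1 N = 1 then
        ψ (p.1 : ZMod N) * (((Real.sqrt N : ℂ) * ((p.1 : ℂ) * z + p.2)) ^ (m + 1))⁻¹ else 0) =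
        ((Real.sqrt N : ℂ) ^ (m + 1))⁻¹ * if Int.gcd p.1 p.2 = 1 then
          rowZero ψ p.1 p.2 * (((p.1 : ℂ) * z + p.2) ^ (m + 1))⁻¹ else 0 := by
      intro p
      rw [ite_and]
      split_ifs with h2 h3
      · rw [mul_pow, mul_inv, rowZero]
        ring
      · rw [rowZero, (ψ.apply_eq_zero_iff p.1).mpr (by rwa [Int.isCoprime_iff_gcd_eq_one]),
          zero_mul, mul_zero]
      · rw [mul_zero]
    rw [tsum_congr this, tsum_mul_left, mul_inv, mul_assoc 2⁻¹, inv_mul_cancel_left₀ hL, one_div]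
    ring

/-! ### Gauss sums of imprimitive characters -/

/-- The exponential sums `∑_{x mod N} ψ(x) e(ax/N)`. -/
def charSum (ψ : DirichletCharacter ℂ N) (a : ℕ) : ℂ :=
  ∑ x ∈ Finset.range N, ψ x * exp (2 * Real.pi * I * a * x / N)

lemma charSum_eq_gaussSum [NeZero N] (ψ : DirichletCharacter ℂ N) (a : ℕ) :
    charSum ψ a = gaussSum ψ (ZMod.stdAddChar.mulShift (a : ZMod N)) := by
  have := fhat_eq_sum (fun _ => ψ) 0 a
  simp only [Int.cast_natCast] at this
  simp only [gaussSum, AddChar.mulShift_apply, ← this, fhat, charSum, Int.cast_natCast]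

lemma charSum_of_isPrimitive [NeZero N] {ψ : DirichletCharacter ℂ N} (hψ : ψ.IsPrimitive) (a : ℕ) :
    charSum ψ a = ψ⁻¹ a * charSum ψ 1 := by
  rw [charSum_eq_gaussSum, charSum_eq_gaussSum, gaussSum_mulShift_of_isPrimitive _ hψ,
    gaussSum_mulShift_of_isPrimitive _ hψ, Nat.cast_one, map_one, one_mul]

lemma gaussSumPrim_eq (χ : DirichletCharacter ℂ N) :
    gaussSumPrim χ = charSum χ.primitiveCharacter 1 := by
  simp [gaussSumPrim, charSum]

lemma sum_moebius_dvd {l : ℕ} (hl : l ≠ 0) (x : ℕ) :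
    ∑ e ∈ l.divisors, (if e ∣ x then (ArithmeticFunction.moebius e : ℂ) else 0) =
      if Nat.Coprime x l then 1 else 0 := by
  have h0 : Nat.gcd l x ≠ 0 := Nat.gcd_ne_zero_left hl
  have h1 : l.divisors.filter (fun e => e ∣ x) = (Nat.gcd l x).divisors := by
    ext e
    simp [Nat.dvd_gcd_iff, hl, h0]
  have h2 := congrArg (fun f : ArithmeticFunction ℂ => f (Nat.gcd l x))
    (ArithmeticFunction.coe_zeta_mul_coe_moebius (R := ℂ))
  simp only [ArithmeticFunction.coe_zeta_mul_apply, ArithmeticFunction.one_apply,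
    ArithmeticFunction.intCoe_apply] at h2
  rw [← Finset.sum_filter, h1, h2]
  simp only [Nat.Coprime, Nat.gcd_comm]

lemma primitiveCharacter_natCast_eq_zero (ψ : DirichletCharacter ℂ N) {x : ℕ}
    (hx : ¬ Nat.Coprime x ψ.conductor) : ψ.primitiveCharacter (x : ZMod ψ.conductor) = 0 :=
  MulChar.map_nonunit _ (by rwa [ZMod.isUnit_iff_coprime])

/-- Being prime to N means being prime to the conductor and to the quotient l of N by it. The
primitive character tests the former; Möbius summation over the common divisors of x and l tests the
latter. -/
lemma char_eq_sum_moebius [NeZero N] (ψ : DirichletCharacter ℂ N) (x : ℕ) :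
    ψ x = ∑ e ∈ (N / ψ.conductor).divisors, (if e ∣ x then (ArithmeticFunction.moebius e : ℂ) else 0) *
      ψ.primitiveCharacter (x : ZMod ψ.conductor) := by
  have hN : ψ.conductor * (N / ψ.conductor) = N := Nat.mul_div_cancel' ψ.conductor_dvd_level
  have hl : N / ψ.conductor ≠ 0 := fun h => NeZero.ne N (by rw [← hN, h, mul_zero])
  rw [← Finset.sum_mul, sum_moebius_dvd hl]
  by_cases hx : Nat.Coprime x N
  · have h1 := ψ.primitiveCharacter_apply_of_isCoprime (a := x) (Nat.isCoprime_iff_coprime.mpr hx)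
    rw [if_pos (Nat.Coprime.of_dvd_right (Dvd.intro_left _ hN) hx), one_mul]
    exact_mod_cast h1.symm
  · rw [MulChar.map_nonunit ψ (by rwa [ZMod.isUnit_iff_coprime])]
    rw [← hN, Nat.coprime_mul_iff_right, not_and_or] at hx
    rcases hx with hx | hx
    · rw [primitiveCharacter_natCast_eq_zero ψ hx, mul_zero]
    · rw [if_neg hx, zero_mul]

lemma sum_range_mul_dvd {e : ℕ} (he : 0 < e) (K : ℕ) (F : ℕ → ℂ) :
    ∑ x ∈ Finset.range (e * K), (if e ∣ x then F x else 0) =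
      ∑ y ∈ Finset.range K, F (e * y) := by
  rw [sum_range_mul, Finset.sum_eq_single_of_mem 0 (Finset.mem_range.mpr he)]
  · simp
  · intro u hu hu0
    refine Finset.sum_eq_zero fun v _ => if_neg fun h => ?_
    rw [Nat.dvd_add_left (Dvd.intro v rfl)] at h
    exact absurd (Nat.le_of_dvd (Nat.pos_of_ne_zero hu0) h) (not_le.mpr (Finset.mem_range.mp hu))

/-- Splitting y = u + Mv, the sum over v detects whether f divides a; what remains is a Gauss sum of
a primitive character with frequency a/f. -/
lemma sum_range_char_exp {M : ℕ} [NeZero M] {ψ : DirichletCharacter ℂ M} (hψ : ψ.IsPrimitive) (a : ℕ)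
    {f : ℕ} (hf : f ≠ 0) :
    ∑ y ∈ Finset.range (M * f), ψ y * exp (2 * Real.pi * I * a * y / (M * f : ℕ)) =
      if f ∣ a then f * (ψ⁻¹ (a / f : ℕ) * charSum ψ 1) else 0 := by
  have hM : (M : ℂ) ≠ 0 := NeZero.ne _
  have hf' : (f : ℂ) ≠ 0 := by exact_mod_cast hf
  rw [sum_range_mul]
  have h1 : ∀ u ∈ Finset.range M, ∑ v ∈ Finset.range f,
      ψ (u + M * v : ℕ) * exp (2 * Real.pi * I * a * (u + M * v : ℕ) / (M * f : ℕ)) =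
      ψ u * exp (2 * Real.pi * I * a * u / (M * f : ℕ)) * if f ∣ a then (f : ℂ) else 0 := by
    intro u _
    rw [← sum_range_exp hf a, Finset.mul_sum]
    refine Finset.sum_congr rfl fun v _ => ?_
    rw [mul_assoc (ψ _), ← exp_add]
    push_cast
    rw [ZMod.natCast_self, zero_mul, add_zero]
    congr 2
    field_simp
  rw [Finset.sum_congr rfl h1, ← Finset.sum_mul]
  split_ifs with h
  · rw [mul_comm, ← charSum_of_isPrimitive hψ, charSum]
    obtain ⟨b, rfl⟩ := h
    rw [Nat.mul_div_cancel_left _ (Nat.pos_of_ne_zero hf)]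
    congr 1
    refine Finset.sum_congr rfl fun u _ => ?_
    congr 2
    push_cast
    field_simp
  · rw [mul_zero]

/-- Inserting the Möbius expansion of ψ and substituting x = ey for each divisor e of l reduces the
sum to exponential sums of the primitive character over a multiple of its period. -/
theorem charSum_eq [NeZero N] (ψ : DirichletCharacter ℂ N) {a : ℕ} :
    charSum ψ a = charSum ψ.primitiveCharacter 1 *
      ∑ d ∈ (Nat.gcd (N / ψ.conductor) a).divisors,
        d * (ArithmeticFunction.moebius (N / ψ.conductor / d) : ℂ) *
          ψ.primitiveCharacter ((N / ψ.conductor / d : ℕ) : ZMod ψ.conductor) *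
          ψ.primitiveCharacter⁻¹ ((a / d : ℕ) : ZMod ψ.conductor) := by
  have hN : ψ.conductor * (N / ψ.conductor) = N := Nat.mul_div_cancel' ψ.conductor_dvd_level
  have : NeZero ψ.conductor := ⟨ψ.conductor_ne_zero⟩
  set l := N / ψ.conductor with hldef
  have hl : l ≠ 0 := fun h => NeZero.ne N (by rw [← hN, h, mul_zero])
  have h1 : (Nat.gcd l a).divisors = l.divisors.filter (fun e => e ∣ a) := by
    ext e
    simp [Nat.dvd_gcd_iff, hl]
  rw [h1, Finset.sum_filter, charSum]
  simp_rw [char_eq_sum_moebius ψ, ← hldef, Finset.sum_mul]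
  -- The sum over the Möbius divisor e is reindexed by the complementary divisor f = l/e, the
  -- variable d of the formula.
  rw [Finset.sum_comm, Finset.mul_sum, ← Nat.sum_div_divisors]
  refine Finset.sum_congr rfl fun f hf => ?_
  obtain ⟨e, he⟩ := Nat.dvd_of_mem_divisors hf
  have hf0 : f ≠ 0 := fun h => hl (by rw [he, h, zero_mul])
  have he0 : e ≠ 0 := fun h => hl (by rw [he, h, mul_zero])
  have hle : l / f = e := by rw [he, Nat.mul_div_cancel_left _ (Nat.pos_of_ne_zero hf0)]
  have hNe : N = e * (ψ.conductor * f) := hN.symm.trans (by rw [he]; ring)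
  have he0' : (e : ℂ) ≠ 0 := by exact_mod_cast he0
  rw [hle]
  have h2 := sum_range_mul_dvd (Nat.pos_of_ne_zero he0) (ψ.conductor * f) fun x =>
    (ArithmeticFunction.moebius e : ℂ) * ψ.primitiveCharacter (x : ZMod ψ.conductor) *
      exp (2 * Real.pi * I * a * x / N)
  rw [← hNe] at h2
  have h3 := sum_range_char_exp ψ.primitiveCharacter_isPrimitive a hf0
  calc _ = _ := Finset.sum_congr rfl fun x _ => by rw [ite_mul, ite_mul, zero_mul, zero_mul]
    _ = _ := h2
    _ = (ArithmeticFunction.moebius e : ℂ) * ψ.primitiveCharacter (e : ZMod ψ.conductor) *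
        ∑ y ∈ Finset.range (ψ.conductor * f), ψ.primitiveCharacter (y : ZMod ψ.conductor) *
          exp (2 * Real.pi * I * a * y / (ψ.conductor * f : ℕ)) := by
      rw [Finset.mul_sum]
      refine Finset.sum_congr rfl fun y _ => ?_
      have : (2 * Real.pi * I * a * (e * y : ℕ) / N : ℂ) =
          2 * Real.pi * I * a * y / (ψ.conductor * f : ℕ) := by
        have hc : (ψ.conductor : ℂ) ≠ 0 := NeZero.ne _
        have hf' : (f : ℂ) ≠ 0 := by exact_mod_cast hf0
        rw [show (N : ℂ) = e * (ψ.conductor * f) by exact_mod_cast hNe]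
        push_cast
        field_simp
      rw [this, Nat.cast_mul, map_mul]
      ring
    _ = _ := by
      rw [h3]
      split_ifs <;> ring

/-- The moduli are only propositionally equal, as happens for the conductors of χ and χ⁻¹, so the
characters are compared after lifting to level N. -/
lemma char_congr {M M' : ℕ} [NeZero N] (hM : M ∣ N) (hM' : M' ∣ N) (h : M = M')
    {ψ : DirichletCharacter ℂ M} {ψ' : DirichletCharacter ℂ M'}
    (heq : ψ.changeLevel hM = ψ'.changeLevel hM') (n : ℕ) : ψ n = ψ' n := by
  subst h
  rw [DirichletCharacter.changeLevel_injective hM heq]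

lemma primitiveCharacter_inv [NeZero N] (χ : DirichletCharacter ℂ N) (n : ℕ) :
    χ⁻¹.primitiveCharacter (n : ZMod χ⁻¹.conductor) =
      χ.primitiveCharacter⁻¹ (n : ZMod χ.conductor) := by
  refine char_congr χ⁻¹.conductor_dvd_level χ.conductor_dvd_level χ.conductor_inv ?_ n
  rw [map_inv, DirichletCharacter.changeLevel_primitiveCharacter,
    DirichletCharacter.changeLevel_primitiveCharacter]

lemma charSum_inv [NeZero N] (χ : DirichletCharacter ℂ N) (a : ℕ) :
    charSum χ⁻¹ a = gaussSumPrim χ⁻¹ *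
      ∑ d ∈ (Nat.gcd (N / χ.conductor) a).divisors,
        d * (ArithmeticFunction.moebius (N / χ.conductor / d) : ℂ) *
          conj (χ.primitiveCharacter ((N / χ.conductor / d : ℕ) : ZMod χ.conductor)) *
          χ.primitiveCharacter ((a / d : ℕ) : ZMod χ.conductor) := by
  have : NeZero χ.conductor := ⟨χ.conductor_ne_zero⟩
  have : NeZero χ⁻¹.conductor := ⟨χ⁻¹.conductor_ne_zero⟩
  rw [charSum_eq, ← gaussSumPrim_eq]
  simp_rw [← conj_char χ⁻¹.primitiveCharacter, primitiveCharacter_inv, ← conj_char χ.primitiveCharacter,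
    conj_conj, χ.conductor_inv]

/-! ### The Fourier coefficients at the cusps `∞` and `0` -/

lemma fhat_rowInfty (ψ : DirichletCharacter ℂ N) (c : ZMod N) (d : ℕ) :
    fhat (rowInfty ψ) c d = if c = 0 then charSum ψ d else 0 := by
  simp only [fhat, rowInfty, charSum, Int.cast_natCast]
  split_ifs <;> simp

lemma fhat_rowZero [NeZero N] (ψ : DirichletCharacter ℂ N) (c : ZMod N) (n : ℤ) :
    fhat (rowZero ψ) c n = ψ c * if (n : ZMod N) = 0 then (N : ℂ) else 0 := by
  rw [fhat_eq_sum]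
  simp only [rowZero, ← Finset.mul_sum, mul_comm (n : ZMod N)]
  rw [AddChar.sum_mulShift _ (ZMod.isPrimitive_stdAddChar N), ZMod.card]
  push_cast
  rfl

lemma rowSum_rowInfty [NeZero N] (ψ : DirichletCharacter ℂ N) (c : ZMod N) :
    rowSum (rowInfty ψ) c = if c = 0 then ∑ x, ψ x else 0 := by
  rw [rowSum, sum_range_natCast]
  simp only [rowInfty]
  split_ifs <;> simp

lemma rowSum_rowZero (ψ : DirichletCharacter ℂ N) (c : ZMod N) :
    rowSum (rowZero ψ) c = N * ψ c := by
  simp [rowSum, rowZero]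

lemma sum_rowSum_rowInfty [NeZero N] {ψ : DirichletCharacter ℂ N} (hψ : ψ ≠ 1) :
    ∑ c, rowSum (rowInfty ψ) c = 0 := by
  simp [rowSum_rowInfty, MulChar.sum_eq_zero_of_ne_one hψ]

lemma sum_rowSum_rowZero [NeZero N] {ψ : DirichletCharacter ℂ N} (hψ : ψ ≠ 1) :
    ∑ c, rowSum (rowZero ψ) c = 0 := by
  simp [rowSum_rowZero, ← Finset.mul_sum, MulChar.sum_eq_zero_of_ne_one hψ]

lemma dvd_mul_div_iff [NeZero N] {n d : ℕ} (hd : d ∣ N * n) (hn : n ≠ 0) :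
    N ∣ N * n / d ↔ d ∣ n := by
  obtain ⟨e, he⟩ := hd
  have h0 : d * e ≠ 0 := he ▸ mul_ne_zero (NeZero.ne N) hn
  have hd0 : 0 < d := Nat.pos_of_ne_zero (left_ne_zero_of_mul h0)
  rw [he, Nat.mul_div_cancel_left _ hd0]
  constructor
  · rintro ⟨t, rfl⟩
    exact ⟨t, Nat.eq_of_mul_eq_mul_left (NeZero.pos N) (by rw [he]; ring)⟩
  · rintro ⟨t, rfl⟩
    exact ⟨t, Nat.eq_of_mul_eq_mul_left hd0 (by rw [← he]; ring)⟩

/-- Among the factorizations Nn = cd only those with N ∣ c survive, that is, those with d ∣ n and c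
= N (n/d). -/
lemma eisCoef_rowInfty [NeZero N] (m : ℕ) (ψ : DirichletCharacter ℂ N) {n : ℕ} (hn : n ≠ 0) :
    eisCoef m (rowInfty ψ) 1 (N * n) =
      ((N : ℂ) ^ m * (n : ℂ) ^ m)⁻¹ * ∑ d ∈ n.divisors, (d : ℂ) ^ m * charSum ψ d := by
  have hN : (N : ℂ) ≠ 0 := NeZero.ne _
  have hNn : N * n ≠ 0 := mul_ne_zero (NeZero.ne N) hn
  rw [eisCoef, divSum, Nat.sum_divisorsAntidiagonal' fun c d : ℕ =>
    ((c : ℂ) ^ m)⁻¹ * fhat (rowInfty ψ) c (1 * d), Finset.mul_sum]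
  simp only [one_mul, fhat_rowInfty, ZMod.natCast_eq_zero_iff]
  symm
  refine Finset.sum_subset_zero_on_sdiff (Nat.divisors_subset_of_dvd hNn (Dvd.intro_left N rfl))
    (fun d hd => ?_) fun d hd => ?_
  · rw [Finset.mem_sdiff, Nat.mem_divisors, Nat.mem_divisors] at hd
    rw [if_neg fun h => hd.2 ⟨(dvd_mul_div_iff hd.1.1 hn).mp h, hn⟩, mul_zero]
  · have hd' := Nat.dvd_of_mem_divisors hd
    rw [if_pos ((dvd_mul_div_iff (hd'.mul_left N) hn).mpr hd')]
    obtain ⟨e, rfl⟩ := hd'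
    have hd0 := Nat.pos_of_mem_divisors hd
    have hd1 : (d : ℂ) ≠ 0 := by exact_mod_cast hd0.ne'
    rw [mul_left_comm N d e, Nat.mul_div_cancel_left _ hd0]
    push_cast
    rw [mul_pow, mul_pow, mul_inv, mul_inv, mul_inv]
    field_simp

/-- As φ does not depend on d, orthogonality keeps only the factorizations Nn = cd with N ∣ d, that
is, with c ∣ n. -/
lemma eisCoef_rowZero [NeZero N] (m : ℕ) (ψ : DirichletCharacter ℂ N) {ε : ℤ} (hε : IsUnit ε)
    {n : ℕ} (hn : n ≠ 0) :
    eisCoef m (rowZero ψ) ε (N * n) = N * ∑ c ∈ n.divisors, ((c : ℂ) ^ m)⁻¹ * ψ c := by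
  have hNn : N * n ≠ 0 := mul_ne_zero (NeZero.ne N) hn
  rw [eisCoef, divSum, Nat.sum_divisorsAntidiagonal fun c d : ℕ =>
    ((c : ℂ) ^ m)⁻¹ * fhat (rowZero ψ) c (ε * d), Finset.mul_sum]
  simp only [fhat_rowZero, ZMod.intCast_zmod_eq_zero_iff_dvd, hε.dvd_mul_left,
    Int.natCast_dvd_natCast]
  symm
  refine Finset.sum_subset_zero_on_sdiff (Nat.divisors_subset_of_dvd hNn (Dvd.intro_left N rfl))
    (fun d hd => ?_) fun d hd => ?_
  · rw [Finset.mem_sdiff, Nat.mem_divisors, Nat.mem_divisors] at hd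
    rw [if_neg fun h => hd.2 ⟨(dvd_mul_div_iff hd.1.1 hn).mp h, hn⟩, mul_zero, mul_zero]
  · have hd' := Nat.dvd_of_mem_divisors hd
    rw [if_pos ((dvd_mul_div_iff (hd'.mul_left N) hn).mpr hd')]
    ring

lemma LFunction_rowInfty [NeZero N] (ψ : DirichletCharacter ℂ N) (m : ℕ) :
    ZMod.LFunction (rowSum (rowInfty ψ)) m =
      ((N : ℂ) ^ m)⁻¹ * ((∑ x, ψ x) * riemannZeta m) := by
  rw [ZMod.LFunction, cpow_neg, cpow_natCast, Finset.sum_eq_single 0]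
  · rw [rowSum_rowInfty, if_pos rfl, map_zero, HurwitzZeta.hurwitzZeta_zero]
  · intro c _ hc
    rw [rowSum_rowInfty, if_neg hc, zero_mul]
  · simp

lemma LFunction_rowZero [NeZero N] (ψ : DirichletCharacter ℂ N) (s : ℂ) :
    ZMod.LFunction (rowSum (rowZero ψ)) s = N * ZMod.LFunction ψ s := by
  rw [show rowSum (rowZero ψ) = (N : ℂ) • (ψ : ZMod N → ℂ) from funext (rowSum_rowZero ψ),
    LFunction_smul]

lemma sum_principal_char [NeZero N] :
    ∑ x, (1 : DirichletCharacter ℂ N) x = N * ∏ p ∈ N.primeFactors, (1 - (p : ℂ)⁻¹) := by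
  rw [MulChar.sum_one_eq_card_units, ZMod.card_units_eq_totient]
  have := congrArg (Rat.cast : ℚ → ℂ) (Nat.totient_eq_mul_prod_factors N)
  push_cast at this
  exact this

/-- The normalizing factor at the cusp `∞`. -/
def normInfty (m : ℕ) [NeZero N] (χ : DirichletCharacter ℂ N) : ℂ :=
  (2 * m * ZMod.LFunction (χ⁻¹ : DirichletCharacter ℂ N) (m + 1 : ℕ))⁻¹

/-- The normalizing factor at the cusp `0`. -/
def normZero (m : ℕ) [NeZero N] (χ : DirichletCharacter ℂ N) : ℂ :=
  ((Real.sqrt N : ℂ) ^ (m + 1) * (2 * m * ZMod.LFunction χ (m + 1 : ℕ)))⁻¹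

/-- The positive coefficients rest on the Gauss sum evaluation `charSum_inv`. In the constant term
the sum of χ⁻¹ over all residues appears: it is Euler's totient of N for the principal character and
0 otherwise. -/
lemma aCoeff_eq [NeZero N] {m : ℕ} (χ : DirichletCharacter ℂ N) (n : ℕ) :
    aCoeff N (m + 1) χ n = normInfty m χ * eisA m (rowInfty χ⁻¹) n := by
  have hN : (N : ℂ) ≠ 0 := NeZero.ne _
  have hκ : (2 : ℤ) - ((m + 1 : ℕ) : ℤ) = 1 - m := by push_cast; ring
  have hκ' : (1 : ℤ) - ((m + 1 : ℕ) : ℤ) = -m := by push_cast; ring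
  have hk : ((m + 1 : ℕ) : ℂ) - 1 = m := by push_cast; ring
  rw [aCoeff, eisA, normInfty, rowConst, hκ, hκ', hk, Nat.add_sub_cancel, DirichletCharacter.LFunction]
  split_ifs with h0 h1
  · rw [LFunction_rowInfty, h1, inv_one, sum_principal_char]
    field_simp
  · rw [LFunction_rowInfty, MulChar.sum_eq_zero_of_ne_one (inv_ne_one.mpr h1)]
    simp
  · rw [eisCoef_rowInfty m _ h0, twistedSigma, Nat.add_sub_cancel]
    simp_rw [charSum_inv, mul_left_comm _ (gaussSumPrim χ⁻¹)]
    rw [← Finset.mul_sum, zpow_neg, zpow_natCast, pow_succ]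
    field_simp

lemma bCoeff_eq [NeZero N] {m : ℕ} (χ : DirichletCharacter ℂ N) (n : ℕ) :
    bCoeff N (m + 1) χ n = normZero m χ * eisA m (rowZero χ) n := by
  have hN : (N : ℂ) ≠ 0 := NeZero.ne _
  have hκ : (2 : ℤ) - ((m + 1 : ℕ) : ℤ) = 1 - m := by push_cast; ring
  have hκ' : (1 : ℤ) - ((m + 1 : ℕ) : ℤ) = -m := by push_cast; ring
  have hk : ((m + 1 : ℕ) : ℂ) - 1 = m := by push_cast; ring
  rw [bCoeff, eisA, normZero, rowConst, hκ, hk, DirichletCharacter.LFunction]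
  split_ifs with h0
  · rw [LFunction_rowZero, DirichletCharacter.LFunction]
    field_simp
  · have : hatSigma N (m + 1) χ n = ∑ c ∈ n.divisors, ((c : ℂ) ^ m)⁻¹ * χ c := by
      rw [hatSigma, hκ', Finset.sum_filter]
      refine Finset.sum_congr rfl fun c _ => ?_
      split_ifs with hc
      · rw [zpow_neg, zpow_natCast, mul_comm]
      · rw [MulChar.map_nonunit χ (by rwa [ZMod.isUnit_iff_coprime]), mul_zero]
    rw [eisCoef_rowZero m χ isUnit_one h0, this]
    field_simp

/-! ### Modularity under `Γ₀(N)` -/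

lemma Gamma0_entries {γ : SL(2, ℤ)} (hγ : γ ∈ CongruenceSubgroup.Gamma0 N) :
    ((γ 0 0 : ℤ) : ZMod N) * (γ 1 1 : ℤ) = 1 := by
  have h := congrArg (Int.cast : ℤ → ZMod N) (det_entries γ)
  push_cast at h
  rwa [CongruenceSubgroup.Gamma0_mem.mp hγ, mul_zero, sub_zero] at h

/-- On rows with c = 0, γ⁻¹ multiplies d by the upper left entry of γ, which modulo N is inverse to
the lower right one; this is why χ⁻¹ has to appear in φ. -/
lemma rowAct_rowInfty (χ : DirichletCharacter ℂ N) {γ : SL(2, ℤ)}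
    (hγ : γ ∈ CongruenceSubgroup.Gamma0 N) :
    rowAct γ (rowInfty χ⁻¹) = χ ((γ 1 1 : ℤ) : ZMod N) • rowInfty χ⁻¹ := by
  have h := Gamma0_entries hγ
  have hu : IsUnit ((γ 1 1 : ℤ) : ZMod N) := IsUnit.of_mul_eq_one_right _ h
  have hinv : χ⁻¹ ((γ 0 0 : ℤ) : ZMod N) = χ ((γ 1 1 : ℤ) : ZMod N) := by
    have h1 : χ⁻¹ (((γ 0 0 : ℤ) : ZMod N) * (γ 1 1 : ℤ)) = χ⁻¹ 1 := by rw [h]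
    rw [map_mul, map_one] at h1
    have h2 : χ⁻¹ ((γ 1 1 : ℤ) : ZMod N) * χ ((γ 1 1 : ℤ) : ZMod N) = 1 := by
      rw [← MulChar.mul_apply, inv_mul_cancel, MulChar.one_apply hu]
    linear_combination χ ((γ 1 1 : ℤ) : ZMod N) * h1 - χ⁻¹ ((γ 0 0 : ℤ) : ZMod N) * h2
  ext c d
  simp only [rowAct, rowInfty, Pi.smul_apply, smul_eq_mul, CongruenceSubgroup.Gamma0_mem.mp hγ,
    mul_zero, sub_zero, hu.mul_left_eq_zero]
  split_ifs with hc
  · rw [hc, zero_mul, sub_zero, map_mul, hinv, mul_comm]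
  · rw [mul_zero]

lemma rowAct_rowZero (χ : DirichletCharacter ℂ N) {γ : SL(2, ℤ)}
    (hγ : γ ∈ CongruenceSubgroup.Gamma0 N) :
    rowAct γ (rowZero χ) = χ ((γ 1 1 : ℤ) : ZMod N) • rowZero χ := by
  ext c d
  simp only [rowAct, rowZero, Pi.smul_apply, smul_eq_mul, CongruenceSubgroup.Gamma0_mem.mp hγ,
    mul_zero, sub_zero, map_mul, mul_comm]

/-! ### The two mock modular forms -/

/-- Up to conjugation the zero row is 2 L(ψ⁻¹, m+1), nonzero in the region of absolute convergence.
At this cusp the nonholomorphic part is thus detected by its y^m term. -/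
lemma zeroRow_rowInfty_ne_zero [NeZero N] {m : ℕ} (hm : 1 ≤ m) {ψ : DirichletCharacter ℂ N}
    (h : ψ (-1) = (-1) ^ (m + 1)) : zeroRow m (rowInfty ψ) ≠ 0 := by
  intro h0
  have h1 := congrArg conj h0
  rw [conj_zeroRow, conjRow_rowInfty, map_zero] at h1
  have h2 : ∀ d : ℤ, rowInfty ψ⁻¹ 0 d * ((d : ℂ) ^ (m + 1))⁻¹ = ψ⁻¹ d * ((d : ℂ) ^ (m + 1))⁻¹ :=
    fun d => by rw [rowInfty, if_pos rfl]
  rw [tsum_congr h2, tsum_int_char (by omega) (inv_char_neg_one h)] at h1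
  exact mul_ne_zero two_ne_zero (LFunction_ne_zero _ (by omega)) h1

/-- The zero row may vanish at this cusp, so the first conjugated coefficient is used instead; only
c = 1 contributes to it. -/
lemma eisB_rowZero_ne_zero [NeZero N] (m : ℕ) (ψ : DirichletCharacter ℂ N) :
    eisB m (rowZero ψ) 1 ≠ 0 := by
  have hN : (N : ℂ) ≠ 0 := NeZero.ne _
  rw [eisB, eisCoef_rowZero m ψ isUnit_one.neg one_ne_zero, rowConst]
  have : (-2 * I : ℂ) ^ (1 - (m : ℤ)) ≠ 0 := zpow_ne_zero _ (by simp)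
  have hpi : (Real.pi : ℂ) ≠ 0 := by exact_mod_cast Real.pi_ne_zero
  refine mul_ne_zero (div_ne_zero (mul_ne_zero two_ne_zero (mul_ne_zero hpi this)) hN) ?_
  simp [hN]

lemma qSer_eq_tsum_qPow (a : ℕ → ℂ) (z : ℍ) : qSer a z = ∑' n : ℕ, a n * qPow n z :=
  tsum_congr fun n => by rw [qPow_natCast]

lemma PolyGrowth.summable_qPow {a : ℕ → ℂ} (ha : PolyGrowth a) (z : ℍ) :
    Summable fun n : ℕ => a n * qPow n z :=
  (summable_qE ha z.im_pos).congr fun n => by rw [qPow_natCast]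

theorem summable_aCoeff [NeZero N] (m : ℕ) (χ : DirichletCharacter ℂ N) (z : ℍ) :
    Summable fun n : ℕ => aCoeff N (m + 1) χ n * qPow n z := by
  simp_rw [aCoeff_eq]
  exact ((polyGrowth_eisA m _).const_mul _).summable_qPow z

theorem summable_bCoeff [NeZero N] (m : ℕ) (χ : DirichletCharacter ℂ N) (z : ℍ) :
    Summable fun n : ℕ => bCoeff N (m + 1) χ n * qPow n z := by
  simp_rw [bCoeff_eq]
  exact ((polyGrowth_eisA m _).const_mul _).summable_qPow z

theorem isMock_aCoeff [NeZero N] {m : ℕ} (hm : 1 ≤ m) {χ : DirichletCharacter ℂ N}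
    (hχ : χ (-1) = (-1) ^ (m + 1)) (h1 : m = 1 → χ ≠ 1) :
    IsMockModularFormWithShadow N (1 - (m : ℤ)) χ
      (fun z => ∑' n : ℕ, aCoeff N (m + 1) χ n * qPow n z) (eisensteinInfty N (m + 1) χ⁻¹) := by
  have hχ' := inv_char_neg_one hχ
  have hm0 : (m : ℂ) ≠ 0 := by exact_mod_cast (by omega : m ≠ 0)
  have hL := LFunction_ne_zero χ⁻¹ (k := m + 1) (by omega)
  refine isMockModularFormWithShadow_of_rowAct hm (hasParity_rowInfty hχ')
    (fun h => sum_rowSum_rowInfty (inv_ne_one.mpr (h1 h))) (shiftInvariant_rowInfty _)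
    (fun γ hγ => rowAct_rowInfty χ hγ) (t := normInfty m χ)
    (inv_ne_zero (mul_ne_zero (mul_ne_zero two_ne_zero hm0) hL))
    (Or.inl (zeroRow_rowInfty_ne_zero hm hχ')) (fun z => ?_) (fun z => ?_)
  · rw [qSer_eq_tsum_qPow]
    simp_rw [aCoeff_eq]
  · rw [shadow_eq_holoEis hm, conjRow_rowInfty, inv_inv, eisensteinInfty_eq hm hχ, normInfty,
      map_inv₀, map_mul, map_mul, map_natCast, map_ofNat, conj_LFunction _ (by omega), inv_inv]
    field_simp

theorem isMock_bCoeff [NeZero N] {m : ℕ} (hm : 1 ≤ m) {χ : DirichletCharacter ℂ N}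
    (hχ : χ (-1) = (-1) ^ (m + 1)) (h1 : m = 1 → χ ≠ 1) :
    IsMockModularFormWithShadow N (1 - (m : ℤ)) χ
      (fun z => ∑' n : ℕ, bCoeff N (m + 1) χ n * qPow n z) (eisensteinZero N (m + 1) χ⁻¹) := by
  have hm0 : (m : ℂ) ≠ 0 := by exact_mod_cast (by omega : m ≠ 0)
  have hL := LFunction_ne_zero χ (k := m + 1) (by omega)
  have hs : (Real.sqrt N : ℂ) ≠ 0 := by
    exact_mod_cast (Real.sqrt_pos.mpr (by exact_mod_cast NeZero.pos N)).ne'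
  refine isMockModularFormWithShadow_of_rowAct hm (hasParity_rowZero hχ)
    (fun h => sum_rowSum_rowZero (h1 h)) (shiftInvariant_rowZero _)
    (fun γ hγ => rowAct_rowZero χ hγ) (t := normZero m χ)
    (inv_ne_zero (mul_ne_zero (pow_ne_zero _ hs) (mul_ne_zero (mul_ne_zero two_ne_zero hm0) hL)))
    (Or.inr (eisB_rowZero_ne_zero m χ)) (fun z => ?_) (fun z => ?_)
  · rw [qSer_eq_tsum_qPow]
    simp_rw [bCoeff_eq]
  · rw [shadow_eq_holoEis hm, conjRow_rowZero, eisensteinZero_eq hm (inv_char_neg_one hχ)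
      fun h => inv_ne_one.mpr (h1 h), normZero, map_inv₀, map_mul, map_mul, map_mul, map_natCast,
      map_ofNat, map_pow, conj_ofReal, conj_LFunction _ (by omega)]
    field_simp

end

end MockEisenstein

theorem theorem1p1 (N : ℕ) [NeZero N] (k : ℕ) (hk : 2 ≤ k) (χ : DirichletCharacter ℂ N)
    (hχ : χ (-1) = (-1) ^ k) (h2 : k = 2 → χ ≠ 1) :
    ((∀ z : UpperHalfPlane, Summable fun n : ℕ => MockEisenstein.aCoeff N k χ n * MockEisenstein.qPow n z) ∧
      MockEisenstein.IsMockModularFormWithShadow N (2 - (k : ℤ)) χ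
        (fun z => ∑' n : ℕ, MockEisenstein.aCoeff N k χ n * MockEisenstein.qPow n z)
        (MockEisenstein.eisensteinInfty N k χ⁻¹)) ∧
    ((∀ z : UpperHalfPlane, Summable fun n : ℕ => MockEisenstein.bCoeff N k χ n * MockEisenstein.qPow n z) ∧
      MockEisenstein.IsMockModularFormWithShadow N (2 - (k : ℤ)) χ
        (fun z => ∑' n : ℕ, MockEisenstein.bCoeff N k χ n * MockEisenstein.qPow n z)
        (MockEisenstein.eisensteinZero N k χ⁻¹)) := by
  -- The proof runs with m = k - 1 ≥ 1, the exponent in the kernel and in y^m.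
  obtain ⟨m, rfl⟩ : ∃ m, k = m + 1 := ⟨k - 1, by omega⟩
  have hm : 1 ≤ m := by omega
  have h1 : m = 1 → χ ≠ 1 := fun h => h2 (by omega)
  rw [show (2 : ℤ) - ((m + 1 : ℕ) : ℤ) = 1 - m by push_cast; ring]
  exact ⟨⟨MockEisenstein.summable_aCoeff m χ, MockEisenstein.isMock_aCoeff hm hχ h1⟩,
    ⟨MockEisenstein.summable_bCoeff m χ, MockEisenstein.isMock_bCoeff hm hχ h1⟩⟩
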